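/- Let $n\ge 1$, $C>0$, $0\le\alpha<\tfrac12$ and $p=\frac{4-2\alpha}{3}$. Then there is $\lambda_0=\lambda_0(C,n,\alpha)\in\mathbb R$ with the following property. Let $V\in L^\infty(\mathbb R\times\mathbb R^n;\mathbb C)$ and $W\in L^\infty(\mathbb R\times\mathbb R^n;\mathbb C\times\mathbb C^n)$ satisfy, for almost every $(t,x)\in\mathbb R\times\mathbb R^n$, $$|V(t,x)|\le \frac{C}{(1+|x|^2)^{\alpha/2}},\qquad |W(t,x)|\le\frac{C}{(1+|x|^2)^{(1+\alpha)/6}},$$ where $|\cdot|$ is the Euclidean norm. Let $u:\mathbb R\times\mathbb R^n\to\mathbb C$ belong to $C^1(\mathbb R;H^1(\mathbb R^n))\cap H^2_{loc}(\mathbb R\times\mathbb R^n)$ and satisfy $$\left|(\partial_t^2+\Delta)u\right|\le |Vu|+\left|W\cdot(\partial_t,\nabla)u\right|\qquad\text{a.e. in }\mathbb R\times\mathbb R^n,$$ where $\Delta$ and $\nabla$ act in $x$, the derivatives are weak derivatives, and $W\cdot(\partial_t,\nabla)u=W_0\,\partial_tu+\sum_{i=1}^nW_i\,\partial_{x_i}u$.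 If $$\sup_{t\in\mathbb R}\int_{\mathbb R^n}e^{4\lambda|x|^p}|u(t,x)|^2\,dx<\infty$$ for some $\lambda>\lambda_0$, then $u\equiv 0$, that is, for every $t\in\mathbb R$ one has $u(t,x)=0$ for almost every $x\in\mathbb R^n$. -/

import Mathlib

open MeasureTheory
open scoped ENNReal ContDiff

noncomputable section

section Weak

variable {F : Type*} [NormedAddCommGroup F] [NormedSpace ℝ F] [MeasureSpace F]

/-- `g` is the weak (distributional) derivative of `f` in the direction `e`; both functions are
locally integrable. -/
structure IsWeakDeriv (e : F) (f g : F → ℂ) : Prop where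
  locallyIntegrable : LocallyIntegrable f
  locallyIntegrable_deriv : LocallyIntegrable g
  integral_eq : ∀ φ : F → ℝ, ContDiff ℝ ∞ φ → HasCompactSupport φ →
    ∫ x, fderiv ℝ φ x e • f x = -∫ x, φ x • g x

open Classical in
/-- The weak derivative of `f` in the direction `e` (unique up to null sets when it exists;
the value is `0` if there is none). -/
def weakDeriv (e : F) (f : F → ℂ) : F → ℂ :=
  if h : ∃ g, IsWeakDeriv e f g then h.choose else 0

/-- The space `L²_loc`. -/
def MemL2Loc (f : F → ℂ) : Prop :=
  ∀ K : Set F, IsCompact K → MemLp f 2 (volume.restrict K)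

/-- The space `H^k_loc`: all weak derivatives of order at most `k` exist and lie in `L²_loc`. -/
def MemHLoc : ℕ → (F → ℂ) → Prop
  | 0, f => MemL2Loc f
  | k + 1, f => MemL2Loc f ∧ ∀ e : F, ∃ g, IsWeakDeriv e f g ∧ MemHLoc k g

end Weak

/-- The space `ℝⁿ` with its Euclidean norm. -/
abbrev Space (n : ℕ) : Type := EuclideanSpace ℝ (Fin n)

/-- Space-time `ℝ × ℝⁿ`, with Lebesgue measure. -/
abbrev SpaceTime (n : ℕ) : Type := ℝ × Space n

/-- The space `L²(ℝⁿ; ℂ)`. -/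
abbrev L2 (n : ℕ) : Type := Lp ℂ 2 (volume : Measure (Space n))

theorem L2.locallyIntegrable {n : ℕ} (f : L2 n) : LocallyIntegrable (f : Space n → ℂ) :=
  (Lp.memLp f).locallyIntegrable (by norm_num)

theorem L2.integrable_smul {n : ℕ} (f : L2 n) {φ : Space n → ℝ} (hφ : Continuous φ)
    (hc : HasCompactSupport φ) : Integrable (fun x => φ x • f x) :=
  (L2.locallyIntegrable f).integrable_smul_left_of_hasCompactSupport hφ hc

theorem continuous_fderiv_test {n : ℕ} {φ : Space n → ℝ} (hφ : ContDiff ℝ ∞ φ) (e : Space n) :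
    Continuous (fun x => fderiv ℝ φ x e) :=
  (hφ.continuous_fderiv (by simp)).clm_apply continuous_const

/-- The Sobolev space `H¹(ℝⁿ; ℂ)`, realised as the space of pairs `(f, ∇f)`, with the norm
`(‖f‖² + ‖∇f‖²)^(1/2)` (the norms on the right being those of `L²`). -/
def H1 (n : ℕ) : Submodule ℂ (WithLp 2 (L2 n × PiLp 2 (fun _ : Fin n => L2 n))) where
  carrier := {p | ∀ i : Fin n, IsWeakDeriv (EuclideanSpace.single i (1 : ℝ)) p.fst (p.snd i)}
  zero_mem' := fun i => by
    refine ⟨L2.locallyIntegrable _, L2.locallyIntegrable _, fun φ _ _ => ?_⟩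
    have h0 : ((0 : L2 n) : Space n → ℂ) =ᵐ[volume] 0 := Lp.coeFn_zero _ _ _
    rw [integral_eq_zero_of_ae, integral_eq_zero_of_ae, neg_zero]
    · filter_upwards [h0] with x hx
      exact (congrArg _ hx).trans (smul_zero _)
    · filter_upwards [h0] with x hx
      exact (congrArg _ hx).trans (smul_zero _)
  add_mem' := fun {p q} hp hq i => by
    refine ⟨L2.locallyIntegrable _, L2.locallyIntegrable _, fun φ hφ hc => ?_⟩
    have hd := continuous_fderiv_test hφ (EuclideanSpace.single i (1 : ℝ))
    have hdc : HasCompactSupport (fun x => fderiv ℝ φ x (EuclideanSpace.single i (1 : ℝ))) :=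
      hc.fderiv_apply ℝ _
    have h1 := Lp.coeFn_add p.fst q.fst
    have h2 := Lp.coeFn_add (p.snd i) (q.snd i)
    have e1 : ∫ x, fderiv ℝ φ x (EuclideanSpace.single i (1 : ℝ)) • (p + q).fst x =
        ∫ x, (fderiv ℝ φ x (EuclideanSpace.single i (1 : ℝ)) • p.fst x +
          fderiv ℝ φ x (EuclideanSpace.single i (1 : ℝ)) • q.fst x) := by
      refine integral_congr_ae ?_
      filter_upwards [h1] with x hx
      rw [← smul_add]
      exact congrArg _ hx
    have e2 : ∫ x, φ x • (p + q).snd i x = ∫ x, (φ x • p.snd i x + φ x • q.snd i x) := by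
      refine integral_congr_ae ?_
      filter_upwards [h2] with x hx
      rw [← smul_add]
      exact congrArg _ hx
    rw [e1, e2, integral_add (L2.integrable_smul _ hd hdc) (L2.integrable_smul _ hd hdc),
      integral_add (L2.integrable_smul _ hφ.continuous hc) (L2.integrable_smul _ hφ.continuous hc),
      (hp i).integral_eq φ hφ hc, (hq i).integral_eq φ hφ hc, neg_add]
  smul_mem' := fun c p hp i => by
    refine ⟨L2.locallyIntegrable _, L2.locallyIntegrable _, fun φ hφ hc => ?_⟩
    have h1 := Lp.coeFn_smul c p.fst
    have h2 := Lp.coeFn_smul c (p.snd i)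
    have e1 : ∫ x, fderiv ℝ φ x (EuclideanSpace.single i (1 : ℝ)) • (c • p).fst x =
        ∫ x, c • (fderiv ℝ φ x (EuclideanSpace.single i (1 : ℝ)) • p.fst x) := by
      refine integral_congr_ae ?_
      filter_upwards [h1] with x hx
      rw [smul_comm]
      exact congrArg _ hx
    have e2 : ∫ x, φ x • (c • p).snd i x = ∫ x, c • (φ x • p.snd i x) := by
      refine integral_congr_ae ?_
      filter_upwards [h2] with x hx
      rw [smul_comm]
      exact congrArg _ hx
    rw [e1, e2, integral_smul, integral_smul, (hp i).integral_eq φ hφ hc, smul_neg]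

/-- The space `C¹(ℝ; H¹(ℝⁿ))`: the slices of `u` form a continuously differentiable curve
in `H¹(ℝⁿ)`. -/
def MemC1H1 {n : ℕ} (u : SpaceTime n → ℂ) : Prop :=
  ∃ v : ℝ → H1 n, ContDiff ℝ 1 v ∧ ∀ t, ∀ᵐ x : Space n, u (t, x) = (v t).1.fst x

/-- The weak derivative `∂_t u`. -/
def weakDt {n : ℕ} (u : SpaceTime n → ℂ) : SpaceTime n → ℂ :=
  weakDeriv ((1 : ℝ), (0 : Space n)) u

/-- The weak derivative `∂_{x_i} u`. -/
def weakDx {n : ℕ} (i : Fin n) (u : SpaceTime n → ℂ) : SpaceTime n → ℂ :=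
  weakDeriv ((0 : ℝ), EuclideanSpace.single i (1 : ℝ)) u

/-- The weak form of `(∂_t² + Δ) u`, with `Δ` the Laplacian in `x`. -/
def weakSpaceTimeLaplacian {n : ℕ} (u : SpaceTime n → ℂ) (z : SpaceTime n) : ℂ :=
  weakDt (weakDt u) z + ∑ i, weakDx i (weakDx i u) z

/-- The values `ℂ × ℂⁿ` of the first-order coefficient, with the Euclidean norm. -/
abbrev CVec (n : ℕ) : Type := WithLp 2 (ℂ × EuclideanSpace ℂ (Fin n))

/-- The first-order term `W · (∂_t, ∇) u` (bilinear product, no conjugation). -/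
def firstOrderTerm {n : ℕ} (W : SpaceTime n → CVec n) (u : SpaceTime n → ℂ)
    (z : SpaceTime n) : ℂ :=
  (W z).fst * weakDt u z + ∑ i, (W z).snd i * weakDx i u z

end

/-!
Fix a space coordinate `x_i`, put `p = 2 m` and consider the weight
`φ = K x_i + M (1 + x_i²)^m - N t²`. Conjugating `∂_t² + Δ` with `e^φ` and computing the
commutator of the symmetric and skew-symmetric parts yields a Carleman inequality that gains the
convexity `b ≥ c M (1 + x_i²)^(m - 1)` of the weight on `|∇u|²` and `b K²` on `|u|²`, as long as
`N` is small compared with `b` and the slope `K` is large. The decay of `W` and `V` is exactly what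
is needed for their contributions to be absorbed, once `M` is large compared with `C²`.

At scale `R` one takes `K ~ M R^(2 m - 1)` and `N ~ M R^(2 m - 2)`, and applies the inequality to
the product of `u` with a cutoff that varies only for `|(t, x)| ~ R`. The error terms live there;
those with `∇u` are reduced to `u` by the Caccioppoli inequality. In the error region, either
`|t| ~ R` and `N t² ~ R^(2 m)` prevails, or `|x| ~ R`; in both cases Young's inequality and the
decay `e^(-2 λ |x|^p)` of `u` outweigh `e^φ` by a factor `e^(-c R^(2 m))`, whereas `e^φ` is only as
small as `e^(-c' R^(2 m - 1))` on any fixed ball. Letting `R → ∞` shows that `u` vanishes on that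
ball.
-/

open Filter Topology Convolution
open scoped NNReal

noncomputable section

section WeakDerivatives

variable {F : Type*} [NormedAddCommGroup F] [MeasureSpace F]

theorem MemL2Loc.congr_ae {f g : F → ℂ} (hf : MemL2Loc f) (h : f =ᵐ[volume] g) : MemL2Loc g :=
  fun K hK => (memLp_congr_ae (ae_restrict_of_ae h)).1 (hf K hK)

variable [NormedSpace ℝ F]

theorem IsWeakDeriv.weakDeriv {e : F} {f g : F → ℂ} (h : IsWeakDeriv e f g) :
    IsWeakDeriv e f (weakDeriv e f) := by
  have hex : ∃ g, IsWeakDeriv e f g := ⟨g, h⟩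
  rw [_root_.weakDeriv, dif_pos hex]
  exact hex.choose_spec

theorem IsWeakDeriv.congr_ae {e : F} {f f' g : F → ℂ} (h : IsWeakDeriv e f g)
    (hf : f =ᵐ[volume] f') : IsWeakDeriv e f' g where
  locallyIntegrable := h.locallyIntegrable.congr hf
  locallyIntegrable_deriv := h.locallyIntegrable_deriv
  integral_eq φ hφ hc := by
    rw [← h.integral_eq φ hφ hc]
    refine integral_congr_ae ?_
    filter_upwards [hf] with x hx
    rw [hx]

theorem IsWeakDeriv.ae_unique [BorelSpace F] [FiniteDimensional ℝ F] {e : F} {f g h : F → ℂ}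
    (hg : IsWeakDeriv e f g) (hh : IsWeakDeriv e f h) : g =ᵐ[volume] h := by
  refine ae_eq_of_integral_contDiff_smul_eq hg.locallyIntegrable_deriv
    hh.locallyIntegrable_deriv fun φ hφ hc => ?_
  have hneg := (hg.integral_eq φ hφ hc).symm.trans (hh.integral_eq φ hφ hc)
  exact neg_injective hneg

theorem MemHLoc.congr_ae {k : ℕ} {f g : F → ℂ} (hf : MemHLoc k f) (h : f =ᵐ[volume] g) :
    MemHLoc k g := by
  cases k with
  | zero => exact MemL2Loc.congr_ae hf h
  | succ k =>
    refine ⟨hf.1.congr_ae h, fun e => ?_⟩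
    obtain ⟨d, hd, hk⟩ := hf.2 e
    exact ⟨d, hd.congr_ae h, hk⟩

theorem MemHLoc.memL2Loc {k : ℕ} {f : F → ℂ} (hf : MemHLoc k f) : MemL2Loc f := by
  cases k with
  | zero => exact hf
  | succ k => exact hf.1

theorem MemHLoc.isWeakDeriv {k : ℕ} {f : F → ℂ} (hf : MemHLoc (k + 1) f) (e : F) :
    IsWeakDeriv e f (weakDeriv e f) := by
  obtain ⟨d, hd, -⟩ := hf.2 e
  exact hd.weakDeriv

theorem MemHLoc.weakDeriv [BorelSpace F] [FiniteDimensional ℝ F] {k : ℕ} {f : F → ℂ}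
    (hf : MemHLoc (k + 1) f) (e : F) : MemHLoc k (weakDeriv e f) := by
  obtain ⟨d, hd, hk⟩ := hf.2 e
  exact hk.congr_ae (hd.ae_unique hd.weakDeriv)

end WeakDerivatives

section Mollification

theorem enorm_integral_smul_rpow_le {α E : Type*} [MeasurableSpace α] {μ : Measure α}
    [NormedAddCommGroup E] [NormedSpace ℝ E] {ρ : α → ℝ} (hρ : Measurable ρ) (hρ₀ : 0 ≤ ρ)
    (hρ₁ : ∫⁻ t, ENNReal.ofReal (ρ t) ∂μ = 1) {g : α → E} (hg : StronglyMeasurable g)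
    {p : ℝ≥0} (hp : 1 ≤ p) :
    ‖∫ t, ρ t • g t ∂μ‖ₑ ^ (p : ℝ) ≤ ∫⁻ t, ENNReal.ofReal (ρ t) * ‖g t‖ₑ ^ (p : ℝ) ∂μ := by
  let ν := μ.withDensity fun t => ENNReal.ofReal (ρ t)
  have : IsProbabilityMeasure ν := ⟨by
    rw [withDensity_apply _ MeasurableSet.univ, Measure.restrict_univ, hρ₁]⟩
  calc ‖∫ t, ρ t • g t ∂μ‖ₑ ^ (p : ℝ)
      ≤ (∫⁻ t, ENNReal.ofReal (ρ t) * ‖g t‖ₑ ∂μ) ^ (p : ℝ) := by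
        gcongr
        refine (enorm_integral_le_lintegral_enorm _).trans_eq (lintegral_congr fun t => ?_)
        rw [enorm_smul, Real.enorm_eq_ofReal (hρ₀ t)]
    _ = eLpNorm g 1 ν ^ (p : ℝ) := by
        rw [eLpNorm_one_eq_lintegral_enorm,
          lintegral_withDensity_eq_lintegral_mul _ hρ.ennreal_ofReal hg.enorm]
        simp only [Pi.mul_apply]
    _ ≤ eLpNorm g p ν ^ (p : ℝ) := by
        gcongr
        exact eLpNorm_le_eLpNorm_of_exponent_le (by exact_mod_cast hp) hg.aestronglyMeasurable
    _ = ∫⁻ t, ENNReal.ofReal (ρ t) * ‖g t‖ₑ ^ (p : ℝ) ∂μ := by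
        rw [eLpNorm_nnreal_pow_eq_lintegral (by positivity),
          lintegral_withDensity_eq_lintegral_mul _ hρ.ennreal_ofReal (hg.enorm.pow_const _)]
        simp only [Pi.mul_apply]

variable {F : Type*} [NormedAddCommGroup F] [NormedSpace ℝ F] [FiniteDimensional ℝ F]
  [MeasurableSpace F] [BorelSpace F] {E : Type*} [NormedAddCommGroup E]
  {μ : Measure F} [μ.IsAddHaarMeasure]

theorem tendsto_eLpNorm_comp_sub_right_sub {f : F → E} {p : ℝ≥0∞} [Fact (1 ≤ p)] (hp : p ≠ ⊤)
    (hf : MemLp f p μ) :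
    Tendsto (fun t : F => eLpNorm (fun x => f (x - t) - f x) p μ) (𝓝 0) (𝓝 0) := by
  let shift : F → C(F, F) := fun t => ⟨fun x => x - t, by fun_prop⟩
  have hshift : Continuous shift := ContinuousMap.continuous_of_continuous_uncurry _ <|
    show Continuous fun q : F × F => q.2 - q.1 by fun_prop
  have hmp (t : F) : MeasurePreserving (shift t) μ μ := measurePreserving_sub_right _ t
  have hcont := (continuous_const (y := hf.toLp f)).compMeasurePreservingLp hshift hmp hp
  have hzero := (Lp.tendsto_Lp_iff_tendsto_eLpNorm' _ _).1 (hcont.tendsto 0)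
  refine hzero.congr fun t => eLpNorm_congr_ae ?_
  simp_rw [Lp.toLp_compMeasurePreserving]
  have hst := ((hf.comp_measurePreserving (hmp t)).coeFn_toLp).sub
    (hf.comp_measurePreserving (hmp 0)).coeFn_toLp
  filter_upwards [hst] with x hx
  simpa [shift] using hx

variable [NormedSpace ℝ E]

/-- The mollification of `f`, that is, its convolution with the bump function `b` normalised to
have integral one. -/
def mollify (μ : Measure F) (b : ContDiffBump (0 : F)) (f : F → E) : F → E :=
  b.normed μ ⋆[ContinuousLinearMap.lsmul ℝ ℝ, μ] f

variable {b : ContDiffBump (0 : F)}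

theorem lintegral_ofReal_normed_eq_one : ∫⁻ t, ENNReal.ofReal (b.normed μ t) ∂μ = 1 := by
  rw [← ofReal_integral_eq_lintegral_ofReal b.integrable_normed (ae_of_all _ b.nonneg_normed),
    b.integral_normed, ENNReal.ofReal_one]

theorem normed_eq_zero_of_notMem_ball {t : F} (ht : t ∉ Metric.ball 0 b.rOut) :
    b.normed μ t = 0 := by
  rwa [← b.support_normed_eq (μ := μ), Function.notMem_support] at ht

theorem contDiff_mollify {f : F → E} (hf : LocallyIntegrable f μ) :
    ContDiff ℝ ∞ (mollify μ b f) :=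
  b.hasCompactSupport_normed.contDiff_convolution_left _ b.contDiff_normed hf

theorem mollify_congr_ae {f g : F → E} (h : f =ᵐ[μ] g) : mollify μ b f = mollify μ b g := by
  funext x
  rw [mollify, mollify, convolution_eq_swap, convolution_eq_swap]
  refine integral_congr_ae ?_
  filter_upwards [h] with t ht
  rw [ht]

theorem mollify_congr_of_eqOn_ball {f g : F → E} {x : F}
    (h : Set.EqOn f g (Metric.ball x b.rOut)) : mollify μ b f x = mollify μ b g x := by
  refine integral_congr_ae (ae_of_all _ fun t => ?_)
  by_cases ht : t ∈ Metric.ball 0 b.rOut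
  · have hxt : x - t ∈ Metric.ball x b.rOut := by simpa using ht
    simp only [h hxt]
  · simp [normed_eq_zero_of_notMem_ball ht]

theorem mollify_sub_self [CompleteSpace E] {f : F → E} (hf : LocallyIntegrable f μ) (x : F) :
    mollify μ b f x - f x = ∫ t, b.normed μ t • (f (x - t) - f x) ∂μ := by
  have hex : Integrable (fun t => b.normed μ t • f (x - t)) μ :=
    (b.hasCompactSupport_normed.convolutionExists_left (ContinuousLinearMap.lsmul ℝ ℝ)
      b.continuous_normed hf x).integrable
  simp_rw [smul_sub]
  rw [integral_sub hex (b.integrable_normed.smul_const _), b.integral_normed_smul]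
  rfl

theorem eLpNorm_mollify_sub_le_of_stronglyMeasurable [CompleteSpace E] {f : F → E}
    (hfm : StronglyMeasurable f) (hf : LocallyIntegrable f μ) {p : ℝ≥0} (hp : 1 ≤ p) {ε : ℝ≥0∞}
    (hε : ∀ t ∈ Metric.ball 0 b.rOut, eLpNorm (fun x => f (x - t) - f x) p μ ≤ ε) :
    eLpNorm (mollify μ b f - f) p μ ≤ ε := by
  have hp₀ : 0 < p := one_pos.trans_le hp
  set ρ : F → ℝ := b.normed μ
  have hρ : Measurable ρ := b.continuous_normed.measurable
  have hdiff : StronglyMeasurable fun q : F × F => f (q.1 - q.2) - f q.1 :=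
    (hfm.comp_measurable (measurable_fst.sub measurable_snd)).sub
      (hfm.comp_measurable measurable_fst)
  rw [← ENNReal.rpow_le_rpow_iff (z := (p : ℝ)) (by exact_mod_cast hp₀),
    eLpNorm_nnreal_pow_eq_lintegral hp₀.ne']
  calc ∫⁻ x, ‖(mollify μ b f - f) x‖ₑ ^ (p : ℝ) ∂μ
      ≤ ∫⁻ x, ∫⁻ t, ENNReal.ofReal (ρ t) * ‖f (x - t) - f x‖ₑ ^ (p : ℝ) ∂μ ∂μ := by
        refine lintegral_mono fun x => ?_
        rw [Pi.sub_apply, mollify_sub_self hf]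
        exact enorm_integral_smul_rpow_le hρ b.nonneg_normed lintegral_ofReal_normed_eq_one
          (hdiff.comp_measurable measurable_prodMk_left) hp
    _ = ∫⁻ t, ∫⁻ x, ENNReal.ofReal (ρ t) * ‖f (x - t) - f x‖ₑ ^ (p : ℝ) ∂μ ∂μ :=
        lintegral_lintegral_swap ((hρ.ennreal_ofReal.comp measurable_snd).mul
          (hdiff.enorm.pow_const _)).aemeasurable
    _ ≤ ∫⁻ t, ENNReal.ofReal (ρ t) * ε ^ (p : ℝ) ∂μ := by
        refine lintegral_mono fun t => ?_
        by_cases ht : t ∈ Metric.ball 0 b.rOut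
        · rw [lintegral_const_mul' _ _ ENNReal.ofReal_ne_top,
            ← eLpNorm_nnreal_pow_eq_lintegral hp₀.ne']
          gcongr
          exact hε t ht
        · simp [ρ, normed_eq_zero_of_notMem_ball ht]
    _ = ε ^ (p : ℝ) := by
        rw [lintegral_mul_const _ hρ.ennreal_ofReal, lintegral_ofReal_normed_eq_one, one_mul]

theorem tendsto_eLpNorm_mollify_sub [CompleteSpace E] {ι : Type*} {l : Filter ι}
    {b : ι → ContDiffBump (0 : F)} (hb : Tendsto (fun i => (b i).rOut) l (𝓝 0)) {p : ℝ≥0}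
    (hp : 1 ≤ p) {f : F → E} (hf : MemLp f p μ) :
    Tendsto (fun i => eLpNorm (mollify μ (b i) f - f) p μ) l (𝓝 0) := by
  have hp' : (1 : ℝ≥0∞) ≤ p := by exact_mod_cast hp
  have : Fact ((1 : ℝ≥0∞) ≤ p) := ⟨hp'⟩
  obtain ⟨f', hf'm, hff'⟩ := hf.aestronglyMeasurable
  have hf' : MemLp f' p μ := hf.ae_eq hff'
  have hcongr (i : ι) : eLpNorm (mollify μ (b i) f - f) p μ =
      eLpNorm (mollify μ (b i) f' - f') p μ := by
    rw [mollify_congr_ae hff']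
    exact eLpNorm_congr_ae ((ae_eq_refl _).sub hff')
  simp_rw [hcongr]
  rw [ENNReal.tendsto_nhds_zero]
  intro ε hε
  obtain ⟨δ, hδ, hball⟩ := Metric.eventually_nhds_iff_ball.1 <|
    ENNReal.tendsto_nhds_zero.1 (tendsto_eLpNorm_comp_sub_right_sub ENNReal.coe_ne_top hf') ε hε
  filter_upwards [hb.eventually (gt_mem_nhds hδ)] with i hi
  exact eLpNorm_mollify_sub_le_of_stronglyMeasurable hf'm (hf'.locallyIntegrable hp') hp
    fun t ht => hball t (Metric.ball_subset_ball hi.le ht)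

end Mollification

section MeanSquareConvergence

variable {α ι κ E : Type*} [MeasurableSpace α] {μ : Measure α} {l : Filter ι}
  [NormedAddCommGroup E]

/-- Convergence in `L²(μ)` along `l` of a family of square integrable functions. -/
structure TendstoL2 (μ : Measure α) (l : Filter ι) (f : ι → α → E) (g : α → E) : Prop where
  memLp_family : ∀ i, MemLp (f i) 2 μ
  memLp : MemLp g 2 μ
  tendsto : Tendsto (fun i => eLpNorm (f i - g) 2 μ) l (𝓝 0)

theorem TendstoL2.add {f f' : ι → α → E} {g g' : α → E} (h : TendstoL2 μ l f g)
    (h' : TendstoL2 μ l f' g') :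
    TendstoL2 μ l (fun i z => f i z + f' i z) (fun z => g z + g' z) where
  memLp_family i := (h.memLp_family i).add (h'.memLp_family i)
  memLp := h.memLp.add h'.memLp
  tendsto := by
    have hsum := h.tendsto.add h'.tendsto
    rw [add_zero] at hsum
    refine tendsto_of_tendsto_of_tendsto_of_le_of_le tendsto_const_nhds hsum
      (fun _ => bot_le) fun i => ?_
    calc eLpNorm ((f i + f' i) - (g + g')) 2 μ
        = eLpNorm ((f i - g) + (f' i - g')) 2 μ := by rw [add_sub_add_comm]
      _ ≤ eLpNorm (f i - g) 2 μ + eLpNorm (f' i - g') 2 μ :=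
          eLpNorm_add_le ((h.memLp_family i).sub h.memLp).1 ((h'.memLp_family i).sub h'.memLp).1
            one_le_two

theorem TendstoL2.sum (s : Finset κ) {f : κ → ι → α → E} {g : κ → α → E}
    (h : ∀ j ∈ s, TendstoL2 μ l (f j) (g j)) :
    TendstoL2 μ l (fun i z => ∑ j ∈ s, f j i z) (fun z => ∑ j ∈ s, g j z) := by
  classical
  induction s using Finset.induction_on with
  | empty =>
    simp only [Finset.sum_empty]
    exact ⟨fun _ => MemLp.zero', MemLp.zero', tendsto_const_nhds.congr fun _ => by simp⟩
  | insert a s ha ih =>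
    simp only [Finset.sum_insert ha]
    exact (h a (Finset.mem_insert_self a s)).add
      (ih fun j hj => h j (Finset.mem_insert_of_mem hj))

theorem norm_toLp_sq {f : α → E} (hf : MemLp f 2 μ) : ‖hf.toLp f‖ ^ 2 = ∫ z, ‖f z‖ ^ 2 ∂μ := by
  have hnonneg : 0 ≤ ∫ z, ‖f z‖ ^ 2 ∂μ := integral_nonneg fun z => by positivity
  rw [Lp.norm_toLp, hf.eLpNorm_eq_integral_rpow_norm two_ne_zero ENNReal.ofNat_ne_top,
    ENNReal.toReal_ofReal (by positivity)]
  simp only [ENNReal.toReal_ofNat, Real.rpow_ofNat]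
  rw [← one_div, ← Real.sqrt_eq_rpow, Real.sq_sqrt hnonneg]

theorem TendstoL2.tendsto_integral {f : ι → α → E} {g : α → E} (h : TendstoL2 μ l f g) :
    Tendsto (fun i => ∫ z, ‖f i z‖ ^ 2 ∂μ) l (𝓝 (∫ z, ‖g z‖ ^ 2 ∂μ)) := by
  have : Fact ((1 : ℝ≥0∞) ≤ 2) := ⟨one_le_two⟩
  have hnorm := ((Lp.tendsto_Lp_iff_tendsto_eLpNorm'' f h.memLp_family g h.memLp).2
    h.tendsto).norm.pow 2
  simpa only [norm_toLp_sq] using hnorm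

end MeanSquareConvergence

section WeakDerivatives

variable {F : Type*} [NormedAddCommGroup F] [MeasureSpace F]

theorem MemL2Loc.locallyIntegrable [LocallyCompactSpace F]
    [IsFiniteMeasureOnCompacts (volume : Measure F)] {f : F → ℂ} (hf : MemL2Loc f) :
    LocallyIntegrable f :=
  locallyIntegrable_iff.2 fun K hK =>
    have : IsFiniteMeasure (volume.restrict K) := ⟨by simpa using hK.measure_lt_top⟩
    (hf K hK).integrable one_le_two

variable [BorelSpace F]

theorem MemL2Loc.memLp_smul {f : F → ℂ} (hf : MemL2Loc f) {c : F → ℝ} (hc : Continuous c)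
    (hcs : HasCompactSupport c) : MemLp (fun z => c z • f z) 2 volume := by
  obtain ⟨B, hB⟩ := hcs.exists_bound_of_continuous hc
  have hf' : MemLp ((tsupport c).indicator f) 2 volume :=
    (memLp_indicator_iff_restrict (isClosed_tsupport c).measurableSet).2 (hf _ hcs)
  have hcut : (fun z => c z • (tsupport c).indicator f z) = fun z => c z • f z := by
    funext z
    by_cases hz : z ∈ tsupport c
    · rw [Set.indicator_of_mem hz]
    · simp [image_eq_zero_of_notMem_tsupport hz]
  rw [← hcut]
  refine .of_le_mul (c := B) hf' (hc.aestronglyMeasurable.smul hf'.1) (ae_of_all _ fun z => ?_)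
  rw [norm_smul]
  gcongr
  exact hB z

theorem MemL2Loc.integrable_norm_smul_sq {f : F → ℂ} (hf : MemL2Loc f) {c : F → ℝ}
    (hc : Continuous c) (hcs : HasCompactSupport c) : Integrable fun z => ‖c z • f z‖ ^ 2 :=
  (hf.memLp_smul hc hcs).integrable_norm_pow two_ne_zero

variable [NormedSpace ℝ F] [FiniteDimensional ℝ F] [(volume : Measure F).IsAddHaarMeasure]

theorem IsWeakDeriv.fderiv_mollify {e : F} {f g : F → ℂ} (h : IsWeakDeriv e f g)
    (b : ContDiffBump (0 : F)) (z : F) :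
    fderiv ℝ (mollify volume b f) z e = mollify volume b g z := by
  let ρ : F → ℝ := b.normed volume
  have hρc : HasCompactSupport ρ := b.hasCompactSupport_normed
  have hρ : ContDiff ℝ ∞ ρ := b.contDiff_normed
  have hconv : ConvolutionExistsAt (fderiv ℝ ρ) f z
      ((ContinuousLinearMap.lsmul ℝ ℝ : ℝ →L[ℝ] ℂ →L[ℝ] ℂ).precompL F) volume :=
    (hρc.fderiv ℝ).convolutionExists_left _ (hρ.continuous_fderiv (by simp))
      h.locallyIntegrable z
  have hreflect (t : F) : fderiv ℝ (fun t => ρ (z - t)) t e = -fderiv ℝ ρ (z - t) e := by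
    have hd : HasFDerivAt (fun t => ρ (z - t)) _ t :=
      ((hρ.differentiable (by simp)).differentiableAt (x := z - t)).hasFDerivAt.comp t
        ((hasFDerivAt_const z t).sub (hasFDerivAt_id t))
    rw [hd.fderiv]
    simp
  have htest := h.integral_eq (fun t => ρ (z - t)) (hρ.comp (contDiff_const.sub contDiff_id))
    (hρc.comp_homeomorph (Homeomorph.subLeft z))
  simp_rw [hreflect, neg_smul, integral_neg, neg_inj] at htest
  rw [mollify, (hρc.hasFDerivAt_convolution_left (ContinuousLinearMap.lsmul ℝ ℝ)
    (hρ.of_le (by simp)) h.locallyIntegrable z).fderiv, convolution_eq_swap,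
    ContinuousLinearMap.integral_apply hconv.integrable_swap, mollify, convolution_eq_swap]
  exact htest

theorem MemL2Loc.tendstoL2_mollify {ι : Type*} {l : Filter ι} {b : ι → ContDiffBump (0 : F)}
    (hb : ∀ i, (b i).rOut ≤ 1) (hb' : Tendsto (fun i => (b i).rOut) l (𝓝 0)) {f : F → ℂ}
    (hf : MemL2Loc f) {c : F → ℝ} (hc : Continuous c) (hcs : HasCompactSupport c) :
    TendstoL2 volume l (fun i z => c z • mollify volume (b i) f z) (fun z => c z • f z) where
  memLp_family i :=
    have hfi := (contDiff_mollify (b := b i) hf.locallyIntegrable).continuous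
    (hc.smul hfi).memLp_of_hasCompactSupport hcs.smul_right
  memLp := hf.memLp_smul hc hcs
  tendsto := by
    obtain ⟨B, hB⟩ := hcs.exists_bound_of_continuous hc
    have hB₀ : 0 ≤ B := (norm_nonneg _).trans (hB 0)
    let K : Set F := Metric.cthickening 1 (tsupport c)
    have hK : IsCompact K := hcs.isCompact.cthickening
    have hfK : MemLp (K.indicator f) 2 volume :=
      (memLp_indicator_iff_restrict hK.measurableSet).2 (hf K hK)
    have hlim := ENNReal.Tendsto.const_mul (a := ENNReal.ofReal B)
      (tendsto_eLpNorm_mollify_sub hb' (p := 2) one_le_two hfK) (Or.inr ENNReal.ofReal_ne_top)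
    rw [mul_zero] at hlim
    refine tendsto_of_tendsto_of_tendsto_of_le_of_le tendsto_const_nhds hlim (fun _ => bot_le)
      fun i => eLpNorm_le_mul_eLpNorm_of_ae_le_mul (ae_of_all _ fun z => ?_) 2
    by_cases hz : z ∈ tsupport c
    · have hball : Set.EqOn f (K.indicator f) (Metric.ball z (b i).rOut) := fun x hx => by
        refine (Set.indicator_of_mem (Metric.mem_cthickening_of_dist_le x z 1 _ hz ?_) f).symm
        exact (Metric.mem_ball.1 hx).le.trans (hb i)
      have hzz := hball (Metric.mem_ball_self (b i).rOut_pos)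
      simp only [Pi.sub_apply]
      rw [← smul_sub, norm_smul, mollify_congr_of_eqOn_ball hball, hzz]
      gcongr
      exact hB z
    · simp only [Pi.sub_apply, image_eq_zero_of_notMem_tsupport hz, zero_smul, sub_zero,
        norm_zero]
      positivity

end WeakDerivatives

section Mollification

/-- A sequence of bump functions whose supports shrink to the origin; a concrete choice of
mollifiers. -/
def shrinkingBump (F : Type*) [NormedAddCommGroup F] (k : ℕ) : ContDiffBump (0 : F) where
  rIn := 1 / (2 * (k + 1))
  rOut := 1 / (k + 1)
  rIn_pos := by positivity
  rIn_lt_rOut := by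
    gcongr
    linarith [(Nat.cast_nonneg k : (0 : ℝ) ≤ k)]

variable {F : Type*} [NormedAddCommGroup F]

theorem shrinkingBump_rOut_le_one (k : ℕ) : (shrinkingBump F k).rOut ≤ 1 :=
  div_le_one_of_le₀ (le_add_of_nonneg_left k.cast_nonneg) (by positivity)

theorem tendsto_shrinkingBump_rOut :
    Tendsto (fun k => (shrinkingBump F k).rOut) atTop (𝓝 0) :=
  tendsto_one_div_add_atTop_nhds_zero_nat

end Mollification

section DirDeriv

variable {F G : Type*} [NormedAddCommGroup F] [NormedSpace ℝ F] [NormedAddCommGroup G]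
  [NormedSpace ℝ G]

/-- The derivative of a function in the direction `e`. -/
def dirDeriv (e : F) (f : F → G) (z : F) : G := fderiv ℝ f z e

theorem contDiff_dirDeriv {f : F → G} (hf : ContDiff ℝ ∞ f) (e : F) :
    ContDiff ℝ ∞ (dirDeriv e f) :=
  (hf.fderiv_right (m := ∞) (by simp)).clm_apply contDiff_const

theorem hasCompactSupport_dirDeriv {f : F → G} (hf : HasCompactSupport f) (e : F) :
    HasCompactSupport (dirDeriv e f) :=
  hf.fderiv_apply ℝ e

theorem tsupport_dirDeriv_subset (e : F) (f : F → G) : tsupport (dirDeriv e f) ⊆ tsupport f :=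
  tsupport_fderiv_apply_subset ℝ e

theorem dirDeriv_eq_zero_of_notMem {e : F} {f : F → G} {z : F} (hz : z ∉ tsupport f) :
    dirDeriv e f z = 0 :=
  image_eq_zero_of_notMem_tsupport fun h => hz (tsupport_dirDeriv_subset e f h)

theorem dirDeriv_smul {f : F → ℝ} {g : F → G} (hf : ContDiff ℝ ∞ f) (hg : ContDiff ℝ ∞ g)
    (e z : F) :
    dirDeriv e (fun z => f z • g z) z = dirDeriv e f z • g z + f z • dirDeriv e g z := by
  have h := ((hf.differentiable (by simp)).differentiableAt (x := z)).hasFDerivAt.smul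
    ((hg.differentiable (by simp)).differentiableAt (x := z)).hasFDerivAt
  have h' : HasFDerivAt (fun z => f z • g z) _ z := h
  rw [dirDeriv, h'.fderiv]
  exact add_comm _ _

theorem dirDeriv_mul {f g : F → ℝ} (hf : ContDiff ℝ ∞ f) (hg : ContDiff ℝ ∞ g) (e z : F) :
    dirDeriv e (fun z => f z * g z) z = dirDeriv e f z * g z + f z * dirDeriv e g z :=
  dirDeriv_smul hf hg e z

theorem dirDeriv_add {f g : F → G} (hf : ContDiff ℝ ∞ f) (hg : ContDiff ℝ ∞ g) (e z : F) :
    dirDeriv e (fun z => f z + g z) z = dirDeriv e f z + dirDeriv e g z := by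
  have h := ((hf.differentiable (by simp)).differentiableAt (x := z)).hasFDerivAt.add
    ((hg.differentiable (by simp)).differentiableAt (x := z)).hasFDerivAt
  have h' : HasFDerivAt (fun z => f z + g z) _ z := h
  rw [dirDeriv, h'.fderiv]
  rfl

theorem dirDeriv_clm_comp {G' : Type*} [NormedAddCommGroup G'] [NormedSpace ℝ G'] {f : F → G}
    (hf : ContDiff ℝ ∞ f) (L : G →L[ℝ] G') (e z : F) :
    dirDeriv e (fun z => L (f z)) z = L (dirDeriv e f z) := by
  have h : HasFDerivAt (fun z => L (f z)) _ z := L.hasFDerivAt.comp z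
    ((hf.differentiable (by simp)).differentiableAt (x := z)).hasFDerivAt
  rw [dirDeriv, h.fderiv]
  rfl

theorem dirDeriv_const (c : ℝ) (e z : F) : dirDeriv e (fun _ => c) z = 0 := by
  simp [dirDeriv]

theorem dirDeriv_exp {f : F → ℝ} (hf : ContDiff ℝ ∞ f) (e z : F) :
    dirDeriv e (fun z => Real.exp (f z)) z = Real.exp (f z) * dirDeriv e f z := by
  have h := ((hf.differentiable (by simp)).differentiableAt (x := z)).hasFDerivAt.exp
  rw [dirDeriv, h.fderiv]
  rfl

theorem dirDeriv_comm {f : F → G} (hf : ContDiff ℝ ∞ f) (d e z : F) :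
    dirDeriv d (dirDeriv e f) z = dirDeriv e (dirDeriv d f) z := by
  have hsym : IsSymmSndFDerivAt ℝ f z :=
    (hf.contDiffAt (x := z)).isSymmSndFDerivAt (by
      rw [minSmoothness_of_isRCLikeNormedField]
      exact WithTop.coe_le_coe.2 le_top)
  have h1 : DifferentiableAt ℝ (fderiv ℝ f) z :=
    ((hf.fderiv_right (m := ∞) (by simp)).differentiable (by simp)).differentiableAt
  have key : ∀ a b : F, dirDeriv a (dirDeriv b f) z = fderiv ℝ (fderiv ℝ f) z a b := fun a b => by
    have h2 : HasFDerivAt (dirDeriv b f) _ z := h1.hasFDerivAt.clm_apply (hasFDerivAt_const b z)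
    rw [dirDeriv, h2.fderiv]
    simp
  rw [key, key]
  exact hsym d e

theorem dirDeriv_comp_clm {h : ℝ → ℝ} (hh : Differentiable ℝ h) (ℓ : F →L[ℝ] ℝ) (e z : F) :
    dirDeriv e (fun z => h (ℓ z)) z = ℓ e * deriv h (ℓ z) := by
  have hd : HasFDerivAt (fun z => h (ℓ z)) _ z :=
    (hh (ℓ z)).hasDerivAt.comp_hasFDerivAt z ℓ.hasFDerivAt
  rw [dirDeriv, hd.fderiv]
  simp [mul_comm]

end DirDeriv

section Laplacian

variable {F G : Type*} [NormedAddCommGroup F] [NormedSpace ℝ F] [NormedAddCommGroup G]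
  [NormedSpace ℝ G] {J : Type*} [Fintype J]

/-- The sum of the squares of the derivatives in the directions `E j`, that is `|∇f|²` when `E` is
an orthonormal basis. -/
def gradSq (E : J → F) (f : F → ℝ) (z : F) : ℝ := ∑ j, dirDeriv (E j) f z ^ 2

/-- The sum of the second derivatives in the directions `E j`, that is `Δf` when `E` is an
orthonormal basis. -/
def frameLaplacian (E : J → F) (f : F → G) (z : F) : G :=
  ∑ j, dirDeriv (E j) (dirDeriv (E j) f) z

variable {E : J → F} {f : F → ℝ} {g : F → G}

theorem continuous_gradSq (hf : ContDiff ℝ ∞ f) : Continuous (gradSq E f) :=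
  continuous_finsetSum _ fun j _ => (contDiff_dirDeriv hf (E j)).continuous.pow 2

theorem continuous_frameLaplacian (hg : ContDiff ℝ ∞ g) : Continuous (frameLaplacian E g) :=
  continuous_finsetSum _ fun j _ =>
    (contDiff_dirDeriv (contDiff_dirDeriv hg (E j)) (E j)).continuous

theorem gradSq_eq_zero_of_notMem {z : F} (hz : z ∉ tsupport f) : gradSq E f z = 0 :=
  Finset.sum_eq_zero fun j _ => by rw [dirDeriv_eq_zero_of_notMem hz, zero_pow two_ne_zero]

theorem frameLaplacian_eq_zero_of_notMem {z : F} (hz : z ∉ tsupport g) :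
    frameLaplacian E g z = 0 :=
  Finset.sum_eq_zero fun _ _ =>
    dirDeriv_eq_zero_of_notMem fun hz' => hz (tsupport_dirDeriv_subset _ _ hz')

theorem frameLaplacian_const (E : J → F) (c : ℝ) (z : F) :
    frameLaplacian E (fun _ => c) z = 0 :=
  Finset.sum_eq_zero fun j _ => by
    rw [funext (dirDeriv_const c (E j)), dirDeriv_const]

theorem frameLaplacian_clm_comp {G' : Type*} [NormedAddCommGroup G'] [NormedSpace ℝ G']
    (hg : ContDiff ℝ ∞ g) (L : G →L[ℝ] G') (z : F) :
    frameLaplacian E (fun z => L (g z)) z = L (frameLaplacian E g z) := by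
  simp only [frameLaplacian, map_sum, funext (dirDeriv_clm_comp hg L _),
    dirDeriv_clm_comp (contDiff_dirDeriv hg _)]

theorem dirDeriv_sq_le_gradSq (E : J → F) (f : F → ℝ) (j : J) (z : F) :
    dirDeriv (E j) f z ^ 2 ≤ gradSq E f z :=
  Finset.single_le_sum (f := fun j => dirDeriv (E j) f z ^ 2) (fun _ _ => sq_nonneg _)
    (Finset.mem_univ j)

end Laplacian

section NullIntegral

variable {F : Type*} [MeasureSpace F]

/-- `h` is integrable with vanishing integral: the calculus of exact divergences, in which
integrations by parts are recorded. -/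
def NullIntegral (h : F → ℝ) : Prop := Integrable h ∧ ∫ z, h z = 0

theorem NullIntegral.add {f g : F → ℝ} (hf : NullIntegral f) (hg : NullIntegral g) :
    NullIntegral fun z => f z + g z :=
  ⟨hf.1.add hg.1, by rw [integral_add hf.1 hg.1, hf.2, hg.2, add_zero]⟩

theorem NullIntegral.const_mul {f : F → ℝ} (hf : NullIntegral f) (c : ℝ) :
    NullIntegral fun z => c * f z :=
  ⟨hf.1.const_mul c, by rw [integral_const_mul, hf.2, mul_zero]⟩

theorem NullIntegral.sum {ι : Type*} (s : Finset ι) {f : ι → F → ℝ}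
    (hf : ∀ i ∈ s, NullIntegral (f i)) : NullIntegral fun z => ∑ i ∈ s, f i z :=
  ⟨integrable_finsetSum _ fun i hi => (hf i hi).1, by
    rw [integral_finsetSum _ fun i hi => (hf i hi).1]
    exact Finset.sum_eq_zero fun i hi => (hf i hi).2⟩

theorem NullIntegral.congr {f g : F → ℝ} (hf : NullIntegral f) (h : ∀ z, f z = g z) :
    NullIntegral g := (funext h : f = g) ▸ hf

theorem NullIntegral.integral_le {f g h : F → ℝ} (hh : NullIntegral h) (hf : Integrable f)
    (hg : Integrable g) (hle : ∀ z, f z ≤ g z + h z) : ∫ z, f z ≤ ∫ z, g z :=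
  calc ∫ z, f z ≤ ∫ z, (g z + h z) := integral_mono hf (hg.add hh.1) hle
    _ = ∫ z, g z := by rw [integral_add hg hh.1, hh.2, add_zero]

variable [NormedAddCommGroup F] [NormedSpace ℝ F] [BorelSpace F] [FiniteDimensional ℝ F]
  [(volume : Measure F).IsAddHaarMeasure]

theorem nullIntegral_dirDeriv {q : F → ℝ} (hq : ContDiff ℝ ∞ q) (hc : HasCompactSupport q)
    (e : F) : NullIntegral (dirDeriv e q) := by
  have hi : Integrable (dirDeriv e q) :=
    (contDiff_dirDeriv hq e).continuous.integrable_of_hasCompactSupport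
      (hasCompactSupport_dirDeriv hc e)
  refine ⟨hi, ?_⟩
  have h := integral_mul_fderiv_eq_neg_fderiv_mul_of_integrable (μ := (volume : Measure F))
    (f := fun _ : F => (1 : ℝ)) (g := q) (v := e) (by simp) (by simpa [dirDeriv] using! hi)
    (by simpa using hq.continuous.integrable_of_hasCompactSupport hc)
    (fun x _ => differentiableAt_const _)
    (fun x _ => (hq.differentiable (by simp)).differentiableAt)
  simpa [dirDeriv] using h

variable {f : F → ℝ} (hf : ContDiff ℝ ∞ f) (hfc : HasCompactSupport f) {c : F → ℝ}
  (hc : ContDiff ℝ ∞ c)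

include hf hfc hc

theorem nullIntegral_second_mul_first (e d : F) :
    NullIntegral fun z => c z * dirDeriv e (dirDeriv e f) z * dirDeriv d f z
      + dirDeriv e c z * dirDeriv e f z * dirDeriv d f z
      - 1 / 2 * dirDeriv d c z * dirDeriv e f z ^ 2 := by
  have he := contDiff_dirDeriv hf e
  have hd := contDiff_dirDeriv hf d
  have h1 := nullIntegral_dirDeriv (hc.mul (he.mul hd))
    (hasCompactSupport_dirDeriv hfc d).mul_left.mul_left e
  have h2 := nullIntegral_dirDeriv (hc.mul (he.mul he))
    (hasCompactSupport_dirDeriv hfc e).mul_left.mul_left d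
  refine (h1.add (h2.const_mul (-1 / 2))).congr fun z => ?_
  rw [dirDeriv_mul hc (he.mul hd), dirDeriv_mul hc (he.mul he), dirDeriv_mul he hd,
    dirDeriv_mul he he, dirDeriv_comm hf d e]
  ring

theorem nullIntegral_second_mul_self (e : F) :
    NullIntegral fun z => c z * dirDeriv e (dirDeriv e f) z * f z + c z * dirDeriv e f z ^ 2
      - 1 / 2 * dirDeriv e (dirDeriv e c) z * f z ^ 2 := by
  have he := contDiff_dirDeriv hf e
  have hce := contDiff_dirDeriv hc e
  have h1 := nullIntegral_dirDeriv (hc.mul (he.mul hf)) hfc.mul_left.mul_left e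
  have h2 := nullIntegral_dirDeriv (hce.mul (hf.mul hf)) hfc.mul_left.mul_left e
  refine (h1.add (h2.const_mul (-1 / 2))).congr fun z => ?_
  rw [dirDeriv_mul hc (he.mul hf), dirDeriv_mul hce (hf.mul hf), dirDeriv_mul he hf,
    dirDeriv_mul hf hf]
  ring

theorem nullIntegral_self_mul_first (d : F) :
    NullIntegral fun z => c z * f z * dirDeriv d f z + 1 / 2 * dirDeriv d c z * f z ^ 2 := by
  have h := nullIntegral_dirDeriv (hc.mul (hf.mul hf)) hfc.mul_left.mul_left d
  refine (h.const_mul (1 / 2)).congr fun z => ?_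
  rw [dirDeriv_mul hc (hf.mul hf), dirDeriv_mul hf hf]
  ring

variable {J : Type*} [Fintype J] (E : J → F)

theorem nullIntegral_frameLaplacian_mul_self :
    NullIntegral fun z => c z * frameLaplacian E f z * f z + c z * gradSq E f z
      - 1 / 2 * frameLaplacian E c z * f z ^ 2 := by
  refine (NullIntegral.sum Finset.univ fun j _ =>
    nullIntegral_second_mul_self hf hfc hc (E j)).congr fun z => ?_
  simp only [frameLaplacian, gradSq, Finset.sum_sub_distrib, Finset.sum_add_distrib,
    Finset.mul_sum, Finset.sum_mul]

theorem nullIntegral_frameLaplacian_mul_first [DecidableEq J] {c' : F → ℝ} (i : J)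
    (hc' : ∀ j z, dirDeriv (E j) c z = if j = i then c' z else 0) :
    NullIntegral fun z => c z * frameLaplacian E f z * dirDeriv (E i) f z
      + c' z * dirDeriv (E i) f z ^ 2 - 1 / 2 * c' z * gradSq E f z := by
  refine (NullIntegral.sum Finset.univ fun j _ =>
    nullIntegral_second_mul_first hf hfc hc (E j) (E i)).congr fun z => ?_
  simp only [hc', frameLaplacian, gradSq, Finset.sum_sub_distrib, Finset.sum_add_distrib,
    Finset.mul_sum, Finset.sum_mul, ite_mul, zero_mul, Finset.sum_ite_eq', Finset.mem_univ,
    if_true]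
  ring

end NullIntegral

section Carleman

variable {F : Type*} [NormedAddCommGroup F] [NormedSpace ℝ F] {J : Type*} [DecidableEq J]

/-- A weight `B (ℓ₁ z) - N (ℓ₀ z)²`, together with a family of directions `E j` among which `E j₀`
and `E j₁` are dual to `ℓ₀` and `ℓ₁` while all the others are annihilated by both. In the
application `E` is the standard basis of space-time, `ℓ₀` is time and `ℓ₁` a space coordinate. -/
structure SeparatedWeight (F J : Type*) [NormedAddCommGroup F] [NormedSpace ℝ F]
    [DecidableEq J] where
  E : J → F
  j₀ : J
  j₁ : J
  ℓ₀ : F →L[ℝ] ℝ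
  ℓ₁ : F →L[ℝ] ℝ
  N : ℝ
  B : ℝ → ℝ
  ne : j₀ ≠ j₁
  ℓ₀_apply : ∀ j, ℓ₀ (E j) = if j = j₀ then 1 else 0
  ℓ₁_apply : ∀ j, ℓ₁ (E j) = if j = j₁ then 1 else 0
  contDiff_B : ContDiff ℝ ∞ B

namespace SeparatedWeight

variable (w : SeparatedWeight F J)

/-- The weight function of `w`. -/
def φ (z : F) : ℝ := w.B (w.ℓ₁ z) - w.N * w.ℓ₀ z ^ 2

/-- The `k`-th derivative in the direction `E j₁` of the weight function, for `1 ≤ k`. -/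
def b (k : ℕ) (z : F) : ℝ := iteratedDeriv k w.B (w.ℓ₁ z)

variable {w}

theorem contDiff_b (k : ℕ) : ContDiff ℝ ∞ (w.b k) := by
  have h := w.contDiff_B.iterate_deriv k
  rw [← iteratedDeriv_eq_iterate] at h
  exact h.comp w.ℓ₁.contDiff

theorem contDiff_φ : ContDiff ℝ ∞ w.φ :=
  (w.contDiff_B.comp w.ℓ₁.contDiff).sub (contDiff_const.mul (w.ℓ₀.contDiff.pow 2))

theorem dirDeriv_ℓ₀ (e z : F) : dirDeriv e w.ℓ₀ z = w.ℓ₀ e := by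
  rw [dirDeriv, w.ℓ₀.fderiv]

theorem dirDeriv_b (k : ℕ) (e z : F) : dirDeriv e (w.b k) z = w.ℓ₁ e * w.b (k + 1) z := by
  have hd := w.contDiff_B.differentiable_iteratedDeriv k
    (WithTop.coe_lt_coe.2 (ENat.natCast_lt_top k))
  unfold b
  rw [dirDeriv_comp_clm hd, iteratedDeriv_succ]

theorem dirDeriv_φ (e z : F) :
    dirDeriv e w.φ z = w.ℓ₁ e * w.b 1 z - 2 * w.N * w.ℓ₀ e * w.ℓ₀ z := by
  have hφ : w.φ = fun z => w.b 0 z + -w.N * (w.ℓ₀ z * w.ℓ₀ z) := by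
    funext z
    simp only [φ, b, iteratedDeriv_zero]
    ring
  have hsq := w.ℓ₀.contDiff (n := ∞).mul w.ℓ₀.contDiff
  rw [hφ, dirDeriv_add (contDiff_b 0) (contDiff_const.mul hsq), dirDeriv_mul contDiff_const hsq,
    dirDeriv_mul w.ℓ₀.contDiff w.ℓ₀.contDiff, dirDeriv_const, dirDeriv_ℓ₀, dirDeriv_b]
  ring

theorem dirDeriv_exp_φ_mul {v : F → ℝ} (hv : ContDiff ℝ ∞ v) (e z : F) :
    dirDeriv e (fun z => Real.exp (w.φ z) * v z) z =
      Real.exp (w.φ z) * (dirDeriv e w.φ z * v z + dirDeriv e v z) := by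
  rw [dirDeriv_mul contDiff_φ.exp hv, dirDeriv_exp contDiff_φ]
  ring

variable (w) in
/-- The potential of the symmetric part of `e^φ Δ e^{-φ}`, namely `|∇φ|²`, increased by `b₂`. -/
def potential (z : F) : ℝ := 4 * w.N ^ 2 * w.ℓ₀ z ^ 2 + w.b 1 z ^ 2 + w.b 2 z

theorem contDiff_potential : ContDiff ℝ ∞ w.potential :=
  ((contDiff_const.mul (w.ℓ₀.contDiff.pow 2)).add ((contDiff_b 1).pow 2)).add (contDiff_b 2)

theorem dirDeriv_potential (e z : F) :
    dirDeriv e w.potential z =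
      w.ℓ₀ e * (8 * w.N ^ 2 * w.ℓ₀ z) + w.ℓ₁ e * (2 * w.b 1 z * w.b 2 z + w.b 3 z) := by
  have ha : ContDiff ℝ ∞ w.ℓ₀ := w.ℓ₀.contDiff
  have hb : ContDiff ℝ ∞ (w.b 1) := contDiff_b 1
  unfold potential
  simp only [sq (w.ℓ₀ _), sq (w.b 1 _)]
  rw [dirDeriv_add ((contDiff_const.mul (ha.mul ha)).add (hb.mul hb)) (contDiff_b 2),
    dirDeriv_add (contDiff_const.mul (ha.mul ha)) (hb.mul hb),
    dirDeriv_mul contDiff_const (ha.mul ha), dirDeriv_mul ha ha, dirDeriv_mul hb hb,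
    dirDeriv_const, dirDeriv_ℓ₀, dirDeriv_b, dirDeriv_b]
  ring

variable (w) in
/-- The zeroth order coefficient of `commutatorForm`. -/
def commutatorCoeff (z : F) : ℝ :=
  2 * w.b 1 z ^ 2 * w.b 2 z - 2 * (2 * w.N * w.ℓ₀ z) ^ 2 * w.b 2 z
    - 8 * w.N * (2 * w.N * w.ℓ₀ z) ^ 2 + 2 * w.b 1 z * w.b 3 z - 2 * w.b 2 z ^ 2 - 2 * w.b 4 z

/-- The conditions on a separated weight under which the Carleman inequality holds for functions
supported in `S`: the slope of the weight in the direction `E j₁` is comparable to the large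
parameter `K`, its convexity `b 2` in that direction dominates its concavity `2 N` in the direction
`E j₀`, and all remaining terms are small. -/
structure IsCarlemanOn (w : SeparatedWeight F J) (K : ℝ) (S : Set F) : Prop where
  one_le : 1 ≤ K
  N_nonneg : 0 ≤ w.N
  abs_ℓ₀_le : ∀ z ∈ S, 16 * w.N * |w.ℓ₀ z| ≤ K
  le_b_one : ∀ z ∈ S, K / 2 ≤ w.b 1 z
  b_one_le : ∀ z ∈ S, w.b 1 z ≤ 2 * K
  le_b_two : ∀ z ∈ S, 8 * w.N ≤ w.b 2 z
  b_two_le : ∀ z ∈ S, 50 * w.b 2 z ≤ K ^ 2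
  abs_b_three_le : ∀ z ∈ S, 40 * |w.b 3 z| ≤ K * w.b 2 z
  abs_b_four_le : ∀ z ∈ S, 40 * |w.b 4 z| ≤ K * w.b 2 z

namespace IsCarlemanOn

theorem mono {K : ℝ} {S T : Set F} (h : w.IsCarlemanOn K T) (hST : S ⊆ T) :
    w.IsCarlemanOn K S where
  one_le := h.one_le
  N_nonneg := h.N_nonneg
  abs_ℓ₀_le z hz := h.abs_ℓ₀_le z (hST hz)
  le_b_one z hz := h.le_b_one z (hST hz)
  b_one_le z hz := h.b_one_le z (hST hz)
  le_b_two z hz := h.le_b_two z (hST hz)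
  b_two_le z hz := h.b_two_le z (hST hz)
  abs_b_three_le z hz := h.abs_b_three_le z (hST hz)
  abs_b_four_le z hz := h.abs_b_four_le z (hST hz)

variable {K : ℝ} {S : Set F} (h : w.IsCarlemanOn K S) {z : F} (hz : z ∈ S)

include h hz

theorem b_two_nonneg : 0 ≤ w.b 2 z := by
  linarith [h.N_nonneg, h.le_b_two z hz]

theorem ℓ₀_sq_le : (2 * w.N * w.ℓ₀ z) ^ 2 ≤ K ^ 2 / 64 := by
  have habs : |2 * w.N * w.ℓ₀ z| ≤ K / 8 := by
    rw [abs_mul, abs_of_nonneg (mul_nonneg zero_le_two h.N_nonneg)]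
    linarith [h.abs_ℓ₀_le z hz]
  calc (2 * w.N * w.ℓ₀ z) ^ 2 ≤ (K / 8) ^ 2 := sq_le_sq' (abs_le.1 habs).1 (abs_le.1 habs).2
    _ = K ^ 2 / 64 := by ring

theorem le_commutatorCoeff : w.b 2 z * (K ^ 2 / 4) ≤ w.commutatorCoeff z := by
  have hK := h.one_le
  have hb₂ := h.b_two_nonneg hz
  have hℓ := h.ℓ₀_sq_le hz
  have hb₁_sq : K ^ 2 / 4 ≤ w.b 1 z ^ 2 := by nlinarith [h.le_b_one z hz]
  have hmain : w.b 2 z * (K ^ 2 / 4) ≤ w.b 2 z * w.b 1 z ^ 2 := by gcongr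
  have hℓ_b : w.b 2 z * (2 * w.N * w.ℓ₀ z) ^ 2 ≤ w.b 2 z * (K ^ 2 / 64) := by gcongr
  have hℓ_N : 8 * w.N * (2 * w.N * w.ℓ₀ z) ^ 2 ≤ w.b 2 z * (2 * w.N * w.ℓ₀ z) ^ 2 :=
    mul_le_mul_of_nonneg_right (h.le_b_two z hz) (sq_nonneg _)
  have hb₁b₃ : -(2 * K * (K * w.b 2 z / 40)) ≤ w.b 1 z * w.b 3 z := by
    refine (abs_le.1 ?_).1
    rw [abs_mul]
    refine mul_le_mul (abs_le.2 ⟨?_, h.b_one_le z hz⟩) ?_ (abs_nonneg _) (by linarith)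
    · linarith [h.le_b_one z hz]
    · linarith [h.abs_b_three_le z hz]
  have hb₂_sq : w.b 2 z * w.b 2 z ≤ w.b 2 z * (K ^ 2 / 50) :=
    mul_le_mul_of_nonneg_left (by linarith [h.b_two_le z hz]) hb₂
  have hb₄ : 40 * w.b 4 z ≤ K ^ 2 * w.b 2 z := by
    have hKK : K * w.b 2 z ≤ K ^ 2 * w.b 2 z := by
      gcongr
      exact le_self_pow₀ hK two_ne_zero
    linarith [le_abs_self (w.b 4 z), h.abs_b_four_le z hz]
  have hpos : 0 ≤ w.b 2 z * K ^ 2 := mul_nonneg hb₂ (sq_nonneg K)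
  rw [commutatorCoeff]
  linarith

end IsCarlemanOn

variable [Fintype J]

theorem frameLaplacian_b (k : ℕ) (z : F) : frameLaplacian w.E (w.b k) z = w.b (k + 2) z := by
  have hdd (j : J) : dirDeriv (w.E j) (dirDeriv (w.E j) (w.b k)) z =
      if j = w.j₁ then w.b (k + 2) z else 0 := by
    rw [funext (dirDeriv_b k (w.E j)), dirDeriv_mul contDiff_const (contDiff_b (k + 1)),
      dirDeriv_const, dirDeriv_b, w.ℓ₁_apply]
    split_ifs <;> simp
  simp only [frameLaplacian, hdd, Finset.sum_ite_eq', Finset.mem_univ, if_true]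

theorem sum_dirDeriv_φ_mul (z : F) (x : J → ℝ) :
    ∑ j, dirDeriv (w.E j) w.φ z * x j = w.b 1 z * x w.j₁ - 2 * w.N * w.ℓ₀ z * x w.j₀ := by
  simp only [dirDeriv_φ, w.ℓ₀_apply, w.ℓ₁_apply, sub_mul, ite_mul, one_mul, zero_mul, mul_ite,
    mul_one, mul_zero, Finset.sum_sub_distrib, Finset.sum_ite_eq', Finset.mem_univ, if_true]

theorem gradSq_φ (z : F) :
    gradSq w.E w.φ z = 4 * w.N ^ 2 * w.ℓ₀ z ^ 2 + w.b 1 z ^ 2 := by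
  simp only [gradSq, sq (dirDeriv _ _ _), sum_dirDeriv_φ_mul]
  simp only [dirDeriv_φ, w.ℓ₀_apply, w.ℓ₁_apply, w.ne, w.ne.symm, if_true, if_false]
  ring

theorem frameLaplacian_φ (z : F) : frameLaplacian w.E w.φ z = w.b 2 z - 2 * w.N := by
  have hdd (j : J) : dirDeriv (w.E j) (dirDeriv (w.E j) w.φ) z =
      (if j = w.j₁ then w.b 2 z else 0) + (if j = w.j₀ then -(2 * w.N) else 0) := by
    have hd : dirDeriv (w.E j) w.φ =
        fun z => w.ℓ₁ (w.E j) * w.b 1 z + -(2 * w.N * w.ℓ₀ (w.E j)) * w.ℓ₀ z :=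
      funext fun z => by rw [dirDeriv_φ]; ring
    rw [hd, dirDeriv_add (contDiff_const.mul (contDiff_b 1)) (contDiff_const.mul w.ℓ₀.contDiff),
      dirDeriv_mul contDiff_const (contDiff_b 1), dirDeriv_mul contDiff_const w.ℓ₀.contDiff,
      dirDeriv_const, dirDeriv_const, dirDeriv_b, dirDeriv_ℓ₀, w.ℓ₀_apply, w.ℓ₁_apply]
    split_ifs <;> simp
  simp only [frameLaplacian, hdd, Finset.sum_add_distrib, Finset.sum_ite_eq', Finset.mem_univ,
    if_true]
  ring

theorem frameLaplacian_exp_φ_mul {v : F → ℝ} (hv : ContDiff ℝ ∞ v) (z : F) :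
    frameLaplacian w.E (fun z => Real.exp (w.φ z) * v z) z =
      Real.exp (w.φ z) * (gradSq w.E w.φ z * v z
        + 2 * ∑ j, dirDeriv (w.E j) w.φ z * dirDeriv (w.E j) v z
        + frameLaplacian w.E w.φ z * v z + frameLaplacian w.E v z) := by
  have hdd (j : J) : dirDeriv (w.E j) (dirDeriv (w.E j) fun z => Real.exp (w.φ z) * v z) z =
      Real.exp (w.φ z) * (dirDeriv (w.E j) w.φ z ^ 2 * v z
        + 2 * (dirDeriv (w.E j) w.φ z * dirDeriv (w.E j) v z)
        + dirDeriv (w.E j) (dirDeriv (w.E j) w.φ) z * v z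
        + dirDeriv (w.E j) (dirDeriv (w.E j) v) z) := by
    have hd := contDiff_dirDeriv w.contDiff_φ (w.E j)
    have hvd := contDiff_dirDeriv hv (w.E j)
    rw [funext (dirDeriv_exp_φ_mul hv (w.E j)), dirDeriv_exp_φ_mul ((hd.mul hv).add hvd),
      dirDeriv_add (hd.mul hv) hvd, dirDeriv_mul hd hv]
    ring
  simp only [frameLaplacian, gradSq, hdd, Finset.sum_add_distrib, Finset.mul_sum, Finset.sum_mul,
    mul_add]

variable (w) in
/-- The symmetric part of `e^φ Δ e^{-φ}`, increased by the multiplication operator `b₂` so that the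
commutator with the other part controls the full gradient. -/
def symmPart (f : F → ℝ) (z : F) : ℝ :=
  frameLaplacian w.E f z + w.potential z * f z

variable (w) in
/-- The skew-symmetric part of `e^φ Δ e^{-φ}`, decreased by the multiplication operator `b₂`. -/
def skewPart (f : F → ℝ) (z : F) : ℝ :=
  4 * w.N * w.ℓ₀ z * dirDeriv (w.E w.j₀) f z - 2 * w.b 1 z * dirDeriv (w.E w.j₁) f z
    - (2 * w.b 2 z - 2 * w.N) * f z

theorem exp_φ_mul_frameLaplacian {v : F → ℝ} (hv : ContDiff ℝ ∞ v) (z : F) :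
    Real.exp (w.φ z) * frameLaplacian w.E v z =
      w.symmPart (fun z => Real.exp (w.φ z) * v z) z
        + w.skewPart (fun z => Real.exp (w.φ z) * v z) z := by
  rw [symmPart, skewPart, potential, frameLaplacian_exp_φ_mul hv, dirDeriv_exp_φ_mul hv,
    dirDeriv_exp_φ_mul hv, gradSq_φ, frameLaplacian_φ, sum_dirDeriv_φ_mul, dirDeriv_φ, dirDeriv_φ]
  simp only [w.ℓ₀_apply, w.ℓ₁_apply, w.ne, w.ne.symm, if_true, if_false]
  ring

variable (w) in
/-- The quadratic form of the commutator of `symmPart` and `skewPart`, up to exact divergences. -/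
def commutatorForm (f : F → ℝ) (z : F) : ℝ :=
  -8 * w.N * dirDeriv (w.E w.j₀) f z ^ 2 + 4 * w.b 2 z * dirDeriv (w.E w.j₁) f z ^ 2
    + 2 * w.b 2 z * gradSq w.E f z + w.commutatorCoeff z * f z ^ 2

theorem exp_φ_sq_mul_gradSq_le {v : F → ℝ} (hv : ContDiff ℝ ∞ v) (z : F) :
    Real.exp (w.φ z) ^ 2 * gradSq w.E v z ≤
      2 * gradSq w.E (fun z => Real.exp (w.φ z) * v z) z
        + 2 * gradSq w.E w.φ z * (Real.exp (w.φ z) * v z) ^ 2 := by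
  simp only [gradSq, dirDeriv_exp_φ_mul hv, Finset.mul_sum, Finset.sum_mul]
  rw [← Finset.sum_add_distrib]
  refine Finset.sum_le_sum fun j _ => ?_
  nlinarith [sq_nonneg (Real.exp (w.φ z) * (dirDeriv (w.E j) v z
    + 2 * (dirDeriv (w.E j) w.φ z * v z)))]

namespace IsCarlemanOn

variable {K : ℝ} {S : Set F} (h : w.IsCarlemanOn K S) {z : F} (hz : z ∈ S)

include h hz

theorem gradSq_φ_le : gradSq w.E w.φ z ≤ 9 / 2 * K ^ 2 := by
  have hb₁ : w.b 1 z ^ 2 ≤ 4 * K ^ 2 := by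
    nlinarith [h.one_le, h.le_b_one z hz, h.b_one_le z hz]
  rw [gradSq_φ]
  linarith [h.ℓ₀_sq_le hz, sq_nonneg K]

theorem exp_φ_sq_mul_le_commutatorForm {v : F → ℝ} (hv : ContDiff ℝ ∞ v) :
    Real.exp (w.φ z) ^ 2 * w.b 2 z * (gradSq w.E v z + K ^ 2 * v z ^ 2) ≤
      44 * w.commutatorForm (fun z => Real.exp (w.φ z) * v z) z := by
  let f : F → ℝ := fun z => Real.exp (w.φ z) * v z
  have hb₂ := h.b_two_nonneg hz
  have hgradφ := h.gradSq_φ_le hz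
  have hgrad : w.b 2 z * (Real.exp (w.φ z) ^ 2 * gradSq w.E v z) ≤
      w.b 2 z * (2 * gradSq w.E f z + 9 * K ^ 2 * f z ^ 2) := by
    refine mul_le_mul_of_nonneg_left ((exp_φ_sq_mul_gradSq_le hv z).trans ?_) hb₂
    nlinarith [sq_nonneg (f z)]
  have hcoeff : w.b 2 z * (K ^ 2 / 4) * f z ^ 2 ≤ w.commutatorCoeff z * f z ^ 2 :=
    mul_le_mul_of_nonneg_right (h.le_commutatorCoeff hz) (sq_nonneg _)
  have hN : 8 * w.N * dirDeriv (w.E w.j₀) f z ^ 2 ≤ w.b 2 z * gradSq w.E f z :=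
    mul_le_mul (h.le_b_two z hz) (dirDeriv_sq_le_gradSq w.E f w.j₀ z) (sq_nonneg _) hb₂
  have hj₁ : 0 ≤ w.b 2 z * dirDeriv (w.E w.j₁) f z ^ 2 := by positivity
  have hgradf : 0 ≤ w.b 2 z * gradSq w.E f z :=
    mul_nonneg hb₂ ((sq_nonneg _).trans (dirDeriv_sq_le_gradSq w.E f w.j₀ z))
  have hf : 0 ≤ w.b 2 z * K ^ 2 * f z ^ 2 := by positivity
  calc Real.exp (w.φ z) ^ 2 * w.b 2 z * (gradSq w.E v z + K ^ 2 * v z ^ 2)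
      = w.b 2 z * (Real.exp (w.φ z) ^ 2 * gradSq w.E v z) + w.b 2 z * K ^ 2 * f z ^ 2 := by
        simp only [f]
        ring
    _ ≤ 44 * w.commutatorForm f z := by
        rw [commutatorForm]
        linarith

end IsCarlemanOn

section Integral

variable [MeasureSpace F] [BorelSpace F] [(volume : Measure F).IsAddHaarMeasure]

theorem integrable_exp_φ_sq_mul_gradSq_add {v : F → ℝ} (hv : ContDiff ℝ ∞ v)
    (hvc : HasCompactSupport v) (K : ℝ) :
    Integrable fun z => Real.exp (w.φ z) ^ 2 * w.b 2 z * (gradSq w.E v z + K ^ 2 * v z ^ 2) := by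
  have hexp : ContDiff ℝ ∞ fun z => Real.exp (w.φ z) := contDiff_φ.exp
  refine Continuous.integrable_of_hasCompactSupport
    (((hexp.continuous.pow 2).mul (contDiff_b 2).continuous).mul
      ((continuous_gradSq hv).add (continuous_const.mul (hv.continuous.pow 2))))
    (HasCompactSupport.intro hvc fun z hz => ?_)
  simp [gradSq_eq_zero_of_notMem hz, image_eq_zero_of_notMem_tsupport hz]

theorem integrable_exp_φ_mul_frameLaplacian_sq {v : F → ℝ} (hv : ContDiff ℝ ∞ v)
    (hvc : HasCompactSupport v) :
    Integrable fun z => (Real.exp (w.φ z) * frameLaplacian w.E v z) ^ 2 := by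
  have hexp : ContDiff ℝ ∞ fun z => Real.exp (w.φ z) := contDiff_φ.exp
  refine Continuous.integrable_of_hasCompactSupport
    ((hexp.continuous.mul (continuous_frameLaplacian hv)).pow 2)
    (HasCompactSupport.intro hvc fun z hz => ?_)
  simp [frameLaplacian_eq_zero_of_notMem hz]

variable [FiniteDimensional ℝ F]

theorem nullIntegral_symmPart_mul_skewPart {f : F → ℝ} (hf : ContDiff ℝ ∞ f)
    (hfc : HasCompactSupport f) :
    NullIntegral fun z => 2 * w.symmPart f z * w.skewPart f z - w.commutatorForm f z := by
  have ha : ContDiff ℝ ∞ w.ℓ₀ := w.ℓ₀.contDiff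
  have hb : ContDiff ℝ ∞ (w.b 1) := contDiff_b 1
  have hP : ContDiff ℝ ∞ w.potential := contDiff_potential
  have n₁ := nullIntegral_frameLaplacian_mul_first hf hfc ha w.E w.j₀ (c' := fun _ => 1)
    fun j z => by rw [dirDeriv_ℓ₀, w.ℓ₀_apply]
  have n₂ := nullIntegral_frameLaplacian_mul_first hf hfc hb w.E w.j₁ (c' := w.b 2)
    fun j z => by rw [dirDeriv_b, w.ℓ₁_apply, ite_mul, one_mul, zero_mul]
  have n₃ := nullIntegral_frameLaplacian_mul_self hf hfc (contDiff_b (w := w) 2) w.E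
  have n₄ := nullIntegral_frameLaplacian_mul_self hf hfc (c := fun _ => 1) contDiff_const w.E
  have n₅ := nullIntegral_self_mul_first hf hfc (hP.mul ha) (w.E w.j₀)
  have n₆ := nullIntegral_self_mul_first hf hfc (hP.mul hb) (w.E w.j₁)
  refine ((((((n₁.const_mul (8 * w.N)).add (n₂.const_mul (-4))).add (n₃.const_mul (-4))).add
    (n₄.const_mul (4 * w.N))).add (n₅.const_mul (8 * w.N))).add
    (n₆.const_mul (-4))).congr fun z => ?_
  rw [dirDeriv_mul hP ha, dirDeriv_mul hP hb, dirDeriv_potential,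
    dirDeriv_potential, frameLaplacian_b, frameLaplacian_const, dirDeriv_ℓ₀, dirDeriv_b, symmPart,
    skewPart, commutatorForm, commutatorCoeff, potential]
  simp only [w.ℓ₀_apply, w.ℓ₁_apply, w.ne, w.ne.symm, if_true, if_false]
  ring

theorem IsCarlemanOn.integral_le {K : ℝ} {v : F → ℝ} (h : w.IsCarlemanOn K (tsupport v))
    (hv : ContDiff ℝ ∞ v) (hvc : HasCompactSupport v) :
    ∫ z, Real.exp (w.φ z) ^ 2 * w.b 2 z * (gradSq w.E v z + K ^ 2 * v z ^ 2) ≤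
      44 * ∫ z, (Real.exp (w.φ z) * frameLaplacian w.E v z) ^ 2 := by
  let f : F → ℝ := fun z => Real.exp (w.φ z) * v z
  have hnull : NullIntegral fun z => 2 * w.symmPart f z * w.skewPart f z - w.commutatorForm f z :=
    nullIntegral_symmPart_mul_skewPart (contDiff_φ.exp.mul hv) hvc.mul_left
  rw [← integral_const_mul]
  refine (hnull.const_mul (-44)).integral_le (integrable_exp_φ_sq_mul_gradSq_add hv hvc K)
    ((integrable_exp_φ_mul_frameLaplacian_sq hv hvc).const_mul 44) fun z => ?_
  have hform : Real.exp (w.φ z) ^ 2 * w.b 2 z * (gradSq w.E v z + K ^ 2 * v z ^ 2) ≤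
      44 * w.commutatorForm f z := by
    by_cases hz : z ∈ tsupport v
    · exact h.exp_φ_sq_mul_le_commutatorForm hz hv
    · have hz' : z ∉ tsupport f := fun h' => hz (tsupport_mul_subset_right h')
      simp [commutatorForm, gradSq_eq_zero_of_notMem hz, gradSq_eq_zero_of_notMem hz',
        dirDeriv_eq_zero_of_notMem hz', image_eq_zero_of_notMem_tsupport hz,
        image_eq_zero_of_notMem_tsupport hz']
  rw [exp_φ_mul_frameLaplacian hv]
  nlinarith [sq_nonneg (w.symmPart f z), sq_nonneg (w.skewPart f z)]

end Integral

end SeparatedWeight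

end Carleman

section Caccioppoli

variable {F : Type*} [NormedAddCommGroup F] [NormedSpace ℝ F] {J : Type*} [Fintype J]
  {E : J → F} {f ζ : F → ℝ}

theorem caccioppoli_pointwise (hf : ContDiff ℝ ∞ f) (hζ : ContDiff ℝ ∞ ζ) {δ : ℝ} (hδ : 0 < δ)
    (z : F) :
    ζ z ^ 2 * gradSq E f z ≤
      2 * δ * (ζ z * frameLaplacian E f z) ^ 2
        + (ζ z ^ 2 / (2 * δ) + 4 * gradSq E ζ z) * f z ^ 2
        + 2 * ∑ j, dirDeriv (E j) (fun z => ζ z * ζ z * (f z * dirDeriv (E j) f z)) z := by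
  have hterm (j : J) : dirDeriv (E j) (fun z => ζ z * ζ z * (f z * dirDeriv (E j) f z)) z =
      ζ z ^ 2 * dirDeriv (E j) f z ^ 2 + ζ z ^ 2 * f z * dirDeriv (E j) (dirDeriv (E j) f) z
        + 2 * ζ z * dirDeriv (E j) ζ z * f z * dirDeriv (E j) f z := by
    have hfj := contDiff_dirDeriv hf (E j)
    rw [dirDeriv_mul (hζ.mul hζ) (hf.mul hfj), dirDeriv_mul hζ hζ, dirDeriv_mul hf hfj]
    ring
  have hcross : -(ζ z ^ 2 * gradSq E f z) / 2 - 2 * gradSq E ζ z * f z ^ 2 ≤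
      ∑ j, 2 * ζ z * dirDeriv (E j) ζ z * f z * dirDeriv (E j) f z := by
    rw [gradSq, gradSq, Finset.mul_sum, Finset.mul_sum, ← Finset.sum_neg_distrib, Finset.sum_div,
      Finset.sum_mul, ← Finset.sum_sub_distrib]
    refine Finset.sum_le_sum fun j _ => ?_
    nlinarith [sq_nonneg (ζ z * dirDeriv (E j) f z + 2 * dirDeriv (E j) ζ z * f z)]
  have hsum : ∑ j, dirDeriv (E j) (fun z => ζ z * ζ z * (f z * dirDeriv (E j) f z)) z =
      ζ z ^ 2 * gradSq E f z + ζ z ^ 2 * f z * frameLaplacian E f z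
        + ∑ j, 2 * ζ z * dirDeriv (E j) ζ z * f z * dirDeriv (E j) f z := by
    simp only [hterm, Finset.sum_add_distrib, gradSq, frameLaplacian, Finset.mul_sum]
  have hyoung : 0 ≤ δ * (ζ z * frameLaplacian E f z) ^ 2 + ζ z ^ 2 / (2 * δ) / 2 * f z ^ 2
      + ζ z ^ 2 * f z * frameLaplacian E f z := by
    have hsq : δ * (ζ z * frameLaplacian E f z) ^ 2 + ζ z ^ 2 / (2 * δ) / 2 * f z ^ 2
        + ζ z ^ 2 * f z * frameLaplacian E f z =
        δ * (ζ z * frameLaplacian E f z + ζ z * f z / (2 * δ)) ^ 2 := by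
      field_simp
      ring
    rw [hsq]
    positivity
  rw [hsum]
  linarith

variable [MeasureSpace F] [BorelSpace F] [(volume : Measure F).IsAddHaarMeasure]

theorem integrable_sq_mul_gradSq (hf : ContDiff ℝ ∞ f) (hζ : ContDiff ℝ ∞ ζ)
    (hζc : HasCompactSupport ζ) : Integrable fun z => ζ z ^ 2 * gradSq E f z := by
  refine Continuous.integrable_of_hasCompactSupport
    ((hζ.continuous.pow 2).mul (continuous_gradSq hf)) (HasCompactSupport.intro hζc fun z hz => ?_)
  simp [image_eq_zero_of_notMem_tsupport hz]

theorem integrable_caccioppoli_bound (hf : ContDiff ℝ ∞ f) (hζ : ContDiff ℝ ∞ ζ)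
    (hζc : HasCompactSupport ζ) (δ : ℝ) :
    Integrable fun z => 2 * δ * (ζ z * frameLaplacian E f z) ^ 2
      + (ζ z ^ 2 / (2 * δ) + 4 * gradSq E ζ z) * f z ^ 2 := by
  have hζ' := hζ.continuous
  refine Continuous.integrable_of_hasCompactSupport
    ((continuous_const.mul ((hζ'.mul (continuous_frameLaplacian hf)).pow 2)).add
      ((((hζ'.pow 2).div_const _).add (continuous_const.mul (continuous_gradSq hζ))).mul
        (hf.continuous.pow 2)))
    (HasCompactSupport.intro hζc fun z hz => ?_)
  simp [image_eq_zero_of_notMem_tsupport hz, gradSq_eq_zero_of_notMem hz]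

variable [FiniteDimensional ℝ F]

theorem caccioppoli_real (hf : ContDiff ℝ ∞ f) (hζ : ContDiff ℝ ∞ ζ) (hζc : HasCompactSupport ζ)
    {δ : ℝ} (hδ : 0 < δ) :
    ∫ z, ζ z ^ 2 * gradSq E f z ≤
      ∫ z, (2 * δ * (ζ z * frameLaplacian E f z) ^ 2
        + (ζ z ^ 2 / (2 * δ) + 4 * gradSq E ζ z) * f z ^ 2) := by
  have hnull := NullIntegral.sum Finset.univ fun j _ => nullIntegral_dirDeriv
    ((hζ.mul hζ).mul (hf.mul (contDiff_dirDeriv hf (E j)))) hζc.mul_left.mul_right (E j)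
  exact (hnull.const_mul 2).integral_le (integrable_sq_mul_gradSq hf hζ hζc)
    (integrable_caccioppoli_bound hf hζ hζc δ) (caccioppoli_pointwise hf hζ hδ)

end Caccioppoli

section ComplexInequalities

variable {F : Type*} [NormedAddCommGroup F] [NormedSpace ℝ F]

theorem norm_sq_eq_re_sq_add_im_sq (c : ℂ) : ‖c‖ ^ 2 = c.re ^ 2 + c.im ^ 2 := by
  rw [Complex.sq_norm, Complex.normSq_apply]
  ring

theorem norm_real_smul_sq (a : ℝ) (c : ℂ) : ‖a • c‖ ^ 2 = a ^ 2 * ‖c‖ ^ 2 := by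
  rw [norm_smul, mul_pow, Real.norm_eq_abs, sq_abs]

theorem gradSq_re_add_gradSq_im {J : Type*} [Fintype J] (E : J → F) {v : F → ℂ}
    (hv : ContDiff ℝ ∞ v) (z : F) :
    gradSq E (fun z => (v z).re) z + gradSq E (fun z => (v z).im) z =
      ∑ j, ‖dirDeriv (E j) v z‖ ^ 2 := by
  have hre (e : F) : dirDeriv e (fun z => (v z).re) z = (dirDeriv e v z).re :=
    dirDeriv_clm_comp hv Complex.reCLM e z
  have him (e : F) : dirDeriv e (fun z => (v z).im) z = (dirDeriv e v z).im :=
    dirDeriv_clm_comp hv Complex.imCLM e z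
  simp only [gradSq, hre, him, norm_sq_eq_re_sq_add_im_sq, Finset.sum_add_distrib]

theorem frameLaplacian_re_sq_add_im_sq {J : Type*} [Fintype J] (E : J → F) {v : F → ℂ}
    (hv : ContDiff ℝ ∞ v) (z : F) :
    frameLaplacian E (fun z => (v z).re) z ^ 2 + frameLaplacian E (fun z => (v z).im) z ^ 2 =
      ‖frameLaplacian E v z‖ ^ 2 := by
  have hre : frameLaplacian E (fun z => (v z).re) z = (frameLaplacian E v z).re :=
    frameLaplacian_clm_comp hv Complex.reCLM z
  have him : frameLaplacian E (fun z => (v z).im) z = (frameLaplacian E v z).im :=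
    frameLaplacian_clm_comp hv Complex.imCLM z
  rw [hre, him, norm_sq_eq_re_sq_add_im_sq]

theorem dirDeriv_dirDeriv_smul {η : F → ℝ} {u : F → ℂ} (hη : ContDiff ℝ ∞ η)
    (hu : ContDiff ℝ ∞ u) (e z : F) :
    dirDeriv e (dirDeriv e fun z => η z • u z) z =
      η z • dirDeriv e (dirDeriv e u) z + (2 * dirDeriv e η z) • dirDeriv e u z
        + dirDeriv e (dirDeriv e η) z • u z := by
  have hdη := contDiff_dirDeriv hη e
  have hdu := contDiff_dirDeriv hu e
  rw [funext (dirDeriv_smul hη hu e),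
    dirDeriv_add (f := fun z => dirDeriv e η z • u z) (g := fun z => η z • dirDeriv e u z)
      (hdη.smul hu) (hη.smul hdu), dirDeriv_smul hdη hu, dirDeriv_smul hη hdu, two_mul, add_smul]
  abel

end ComplexInequalities

section SmoothComplexInequalities

variable {F : Type*} [NormedAddCommGroup F] [MeasureSpace F] [BorelSpace F]

theorem integrable_norm_sq_of_hasCompactSupport
    [IsFiniteMeasureOnCompacts (volume : Measure F)] {g : F → ℂ} (hg : Continuous g)
    (hgc : HasCompactSupport g) : Integrable fun z => ‖g z‖ ^ 2 :=
  (hg.memLp_of_hasCompactSupport hgc).integrable_norm_pow two_ne_zero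

theorem integrable_norm_smul_sq_of_hasCompactSupport
    [IsFiniteMeasureOnCompacts (volume : Measure F)] {c : F → ℝ} {g : F → ℂ} (hc : Continuous c)
    (hg : Continuous g) (hgc : HasCompactSupport g) : Integrable fun z => ‖c z • g z‖ ^ 2 :=
  integrable_norm_sq_of_hasCompactSupport (hc.smul hg) (.smul_left (f := c) hgc)

variable [NormedSpace ℝ F] [(volume : Measure F).IsAddHaarMeasure] {J : Type*} [Fintype J]

theorem sum_integral_norm_smul_dirDeriv_sq_add {v : F → ℂ} {c d : F → ℝ} (hv : ContDiff ℝ ∞ v)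
    (hvc : HasCompactSupport v) (hc : Continuous c) (hd : Continuous d) (E : J → F) :
    (∑ j, ∫ z, ‖c z • dirDeriv (E j) v z‖ ^ 2) + ∫ z, ‖d z • v z‖ ^ 2 =
      ∫ z, (c z ^ 2 * ∑ j, ‖dirDeriv (E j) v z‖ ^ 2 + d z ^ 2 * ‖v z‖ ^ 2) := by
  have hgrad (j : J) : Integrable fun z => ‖c z • dirDeriv (E j) v z‖ ^ 2 :=
    integrable_norm_smul_sq_of_hasCompactSupport hc (contDiff_dirDeriv hv _).continuous
      (hasCompactSupport_dirDeriv hvc _)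
  have hzero : Integrable fun z => ‖d z • v z‖ ^ 2 :=
    integrable_norm_smul_sq_of_hasCompactSupport hd hv.continuous hvc
  rw [← integral_finsetSum _ fun j _ => hgrad j, ← integral_add
    (integrable_finsetSum _ fun j _ => hgrad j) hzero]
  simp only [norm_real_smul_sq, Finset.mul_sum]

variable [FiniteDimensional ℝ F]

theorem SeparatedWeight.IsCarlemanOn.integral_norm_le [DecidableEq J] {w : SeparatedWeight F J}
    {K : ℝ} {v : F → ℂ} (h : w.IsCarlemanOn K (tsupport v)) (hv : ContDiff ℝ ∞ v)
    (hvc : HasCompactSupport v) :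
    ∫ z, Real.exp (w.φ z) ^ 2 * w.b 2 z * (∑ j, ‖dirDeriv (w.E j) v z‖ ^ 2 + K ^ 2 * ‖v z‖ ^ 2) ≤
      44 * ∫ z, (Real.exp (w.φ z) * ‖frameLaplacian w.E v z‖) ^ 2 := by
  let re : F → ℝ := fun z => (v z).re
  let im : F → ℝ := fun z => (v z).im
  have hre : ContDiff ℝ ∞ re := Complex.reCLM.contDiff.comp hv
  have him : ContDiff ℝ ∞ im := Complex.imCLM.contDiff.comp hv
  have hrec : HasCompactSupport re := hvc.comp_left Complex.zero_re
  have himc : HasCompactSupport im := hvc.comp_left Complex.zero_im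
  have hre_sub : tsupport re ⊆ tsupport v :=
    closure_mono (Function.support_comp_subset Complex.zero_re v)
  have him_sub : tsupport im ⊆ tsupport v :=
    closure_mono (Function.support_comp_subset Complex.zero_im v)
  have hadd := add_le_add ((h.mono hre_sub).integral_le hre hrec)
    ((h.mono him_sub).integral_le him himc)
  rw [← mul_add, ← integral_add (integrable_exp_φ_sq_mul_gradSq_add hre hrec K)
      (integrable_exp_φ_sq_mul_gradSq_add him himc K),
    ← integral_add (integrable_exp_φ_mul_frameLaplacian_sq hre hrec)
      (integrable_exp_φ_mul_frameLaplacian_sq him himc)] at hadd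
  refine le_of_eq_of_le (integral_congr_ae (ae_of_all _ fun z => ?_))
    (hadd.trans_eq (congrArg _ (integral_congr_ae (ae_of_all _ fun z => ?_))))
  · linear_combination (Real.exp (w.φ z) ^ 2 * w.b 2 z) *
      (K ^ 2 * norm_sq_eq_re_sq_add_im_sq (v z) - gradSq_re_add_gradSq_im w.E hv z)
  · linear_combination Real.exp (w.φ z) ^ 2 * frameLaplacian_re_sq_add_im_sq w.E hv z

theorem SeparatedWeight.IsCarlemanOn.sum_integral_norm_smul_le [DecidableEq J]
    {w : SeparatedWeight F J} {K : ℝ} {v : F → ℂ} (h : w.IsCarlemanOn K (tsupport v))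
    (hv : ContDiff ℝ ∞ v) (hvc : HasCompactSupport v) :
    (∑ j, ∫ z, ‖(Real.exp (w.φ z) * √(w.b 2 z)) • dirDeriv (w.E j) v z‖ ^ 2)
        + ∫ z, ‖(Real.exp (w.φ z) * √(w.b 2 z) * K) • v z‖ ^ 2 ≤
      44 * ∫ z, ‖Real.exp (w.φ z) • frameLaplacian w.E v z‖ ^ 2 := by
  have hweight : Continuous fun z => Real.exp (w.φ z) * √(w.b 2 z) :=
    (contDiff_φ (w := w)).exp.continuous.mul (contDiff_b (w := w) 2).continuous.sqrt
  have hleft (z : F) : (Real.exp (w.φ z) * √(w.b 2 z)) ^ 2 * ∑ j, ‖dirDeriv (w.E j) v z‖ ^ 2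
      + (Real.exp (w.φ z) * √(w.b 2 z) * K) ^ 2 * ‖v z‖ ^ 2 =
      Real.exp (w.φ z) ^ 2 * w.b 2 z *
        (∑ j, ‖dirDeriv (w.E j) v z‖ ^ 2 + K ^ 2 * ‖v z‖ ^ 2) := by
    by_cases hz : z ∈ tsupport v
    · linear_combination Real.exp (w.φ z) ^ 2 *
        (∑ j, ‖dirDeriv (w.E j) v z‖ ^ 2 + K ^ 2 * ‖v z‖ ^ 2) *
        Real.sq_sqrt (h.b_two_nonneg hz)
    · simp [dirDeriv_eq_zero_of_notMem hz, image_eq_zero_of_notMem_tsupport hz]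
  rw [sum_integral_norm_smul_dirDeriv_sq_add (c := fun z => Real.exp (w.φ z) * √(w.b 2 z))
    (d := fun z => Real.exp (w.φ z) * √(w.b 2 z) * K) hv hvc hweight
    (hweight.mul continuous_const) w.E]
  simp only [hleft, norm_smul, Real.norm_of_nonneg (Real.exp_nonneg _)]
  exact h.integral_norm_le hv hvc

theorem caccioppoli_complex {E : J → F} {u : F → ℂ} {ζ : F → ℝ} (hu : ContDiff ℝ ∞ u)
    (hζ : ContDiff ℝ ∞ ζ) (hζc : HasCompactSupport ζ) {δ : ℝ} (hδ : 0 < δ) :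
    ∑ j, ∫ z, ‖ζ z • dirDeriv (E j) u z‖ ^ 2 ≤
      2 * δ * (∫ z, ‖ζ z • frameLaplacian E u z‖ ^ 2) + 1 / (2 * δ) * (∫ z, ‖ζ z • u z‖ ^ 2)
        + 4 * ∑ j, ∫ z, ‖dirDeriv (E j) ζ z • u z‖ ^ 2 := by
  let re : F → ℝ := fun z => (u z).re
  let im : F → ℝ := fun z => (u z).im
  have hre : ContDiff ℝ ∞ re := Complex.reCLM.contDiff.comp hu
  have him : ContDiff ℝ ∞ im := Complex.imCLM.contDiff.comp hu
  have hgrad (j : J) : Integrable fun z => ‖ζ z • dirDeriv (E j) u z‖ ^ 2 :=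
    integrable_norm_sq_of_hasCompactSupport
      (hζ.continuous.smul (contDiff_dirDeriv hu _).continuous) hζc.smul_right
  have hlap : Integrable fun z => ‖ζ z • frameLaplacian E u z‖ ^ 2 :=
    integrable_norm_sq_of_hasCompactSupport
      (hζ.continuous.smul (continuous_frameLaplacian hu)) hζc.smul_right
  have hzero : Integrable fun z => ‖ζ z • u z‖ ^ 2 :=
    integrable_norm_sq_of_hasCompactSupport (hζ.continuous.smul hu.continuous) hζc.smul_right
  have hcut (j : J) : Integrable fun z => ‖dirDeriv (E j) ζ z • u z‖ ^ 2 :=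
    integrable_norm_sq_of_hasCompactSupport
      ((contDiff_dirDeriv hζ _).continuous.smul hu.continuous)
      (hasCompactSupport_dirDeriv hζc _).smul_right
  have hadd := add_le_add (caccioppoli_real (E := E) hre hζ hζc hδ)
    (caccioppoli_real (E := E) him hζ hζc hδ)
  rw [← integral_add (integrable_sq_mul_gradSq hre hζ hζc) (integrable_sq_mul_gradSq him hζ hζc),
    ← integral_add (integrable_caccioppoli_bound hre hζ hζc δ)
      (integrable_caccioppoli_bound him hζ hζc δ)] at hadd
  rw [← integral_finsetSum _ fun j _ => hgrad j, ← integral_finsetSum _ fun j _ => hcut j,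
    ← integral_const_mul, ← integral_const_mul, ← integral_const_mul,
    ← integral_add (hlap.const_mul _) (hzero.const_mul _),
    ← integral_add (f := fun z => 2 * δ * ‖ζ z • frameLaplacian E u z‖ ^ 2
        + 1 / (2 * δ) * ‖ζ z • u z‖ ^ 2) ((hlap.const_mul _).add (hzero.const_mul _))
      ((integrable_finsetSum _ fun j _ => hcut j).const_mul _)]
  refine le_of_eq_of_le (integral_congr_ae (ae_of_all _ fun z => ?_))
    (hadd.trans_eq (integral_congr_ae (ae_of_all _ fun z => ?_)))
  · simp only [norm_real_smul_sq, ← Finset.mul_sum]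
    linear_combination -(ζ z ^ 2) * gradSq_re_add_gradSq_im E hu z
  · simp only [norm_real_smul_sq, ← Finset.sum_mul, ← gradSq.eq_1]
    linear_combination 2 * δ * ζ z ^ 2 * frameLaplacian_re_sq_add_im_sq E hu z
      - (ζ z ^ 2 / (2 * δ) + 4 * gradSq E ζ z) * norm_sq_eq_re_sq_add_im_sq (u z)

end SmoothComplexInequalities

section WeakSecondDerivs

variable {F : Type*} [NormedAddCommGroup F] [NormedSpace ℝ F] {J : Type*}

/-- The derivative in the direction `E j` of `η • u` by the product rule, when `du j` is the
derivative of `u` in that direction. -/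
def leibnizDeriv (E : J → F) (η : F → ℝ) (u : F → ℂ) (du : J → F → ℂ) (j : J) (z : F) : ℂ :=
  dirDeriv (E j) η z • u z + η z • du j z

theorem dirDeriv_smul_eq_leibnizDeriv {E : J → F} {η : F → ℝ} {u : F → ℂ}
    (hη : ContDiff ℝ ∞ η) (hu : ContDiff ℝ ∞ u) (j : J) (z : F) :
    dirDeriv (E j) (fun z => η z • u z) z = leibnizDeriv E η u (fun j => dirDeriv (E j) u) j z :=
  dirDeriv_smul hη hu (E j) z

/-- The part of the frame Laplacian of `η • u` in which at least one derivative falls on `η`. -/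
def leibnizCommutator [Fintype J] (E : J → F) (η : F → ℝ) (u : F → ℂ) (du : J → F → ℂ)
    (z : F) : ℂ :=
  ∑ j, ((2 * dirDeriv (E j) η z) • du j z + dirDeriv (E j) (dirDeriv (E j) η) z • u z)

theorem frameLaplacian_smul [Fintype J] {E : J → F} {η : F → ℝ} {u : F → ℂ}
    (hη : ContDiff ℝ ∞ η) (hu : ContDiff ℝ ∞ u) (z : F) :
    frameLaplacian E (fun z => η z • u z) z =
      η z • frameLaplacian E u z + leibnizCommutator E η u (fun j => dirDeriv (E j) u) z := by
  simp only [frameLaplacian, leibnizCommutator, dirDeriv_dirDeriv_smul hη hu, Finset.smul_sum,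
    Finset.sum_add_distrib, add_assoc]

variable [MeasureSpace F]

/-- The families `du j` and `ddu j` are the first and the pure second weak derivatives of `u` in the
directions `E j`, and all these functions are locally square integrable. -/
structure HasWeakSecondDerivs (E : J → F) (u : F → ℂ) (du ddu : J → F → ℂ) : Prop where
  memL2Loc : MemL2Loc u
  memL2Loc_fst : ∀ j, MemL2Loc (du j)
  memL2Loc_snd : ∀ j, MemL2Loc (ddu j)
  isWeakDeriv_fst : ∀ j, IsWeakDeriv (E j) u (du j)
  isWeakDeriv_snd : ∀ j, IsWeakDeriv (E j) (du j) (ddu j)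

variable [BorelSpace F] [FiniteDimensional ℝ F] [(volume : Measure F).IsAddHaarMeasure]

variable (F) in
/-- The mollifications of `f` along `shrinkingBump F`. -/
def mollifySeq (f : F → ℂ) (k : ℕ) : F → ℂ := mollify volume (shrinkingBump F k) f

theorem MemL2Loc.contDiff_mollifySeq {f : F → ℂ} (hf : MemL2Loc f) (k : ℕ) :
    ContDiff ℝ ∞ (mollifySeq F f k) :=
  contDiff_mollify hf.locallyIntegrable

theorem MemL2Loc.tendstoL2_mollifySeq {f : F → ℂ} (hf : MemL2Loc f) {c : F → ℝ}
    (hc : Continuous c) (hcs : HasCompactSupport c) :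
    TendstoL2 volume atTop (fun k z => c z • mollifySeq F f k z) (fun z => c z • f z) :=
  hf.tendstoL2_mollify shrinkingBump_rOut_le_one tendsto_shrinkingBump_rOut hc hcs

namespace HasWeakSecondDerivs

variable {E : J → F} {u : F → ℂ} {du ddu : J → F → ℂ} (h : HasWeakSecondDerivs E u du ddu)

include h

theorem dirDeriv_mollifySeq (j : J) (k : ℕ) :
    dirDeriv (E j) (mollifySeq F u k) = mollifySeq F (du j) k :=
  funext ((h.isWeakDeriv_fst j).fderiv_mollify _)

variable {ρ η : F → ℝ}

theorem tendstoL2_leibnizDeriv (hρ : Continuous ρ) (hη : ContDiff ℝ ∞ η)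
    (hηc : HasCompactSupport η) (j : J) :
    TendstoL2 volume atTop (fun k z => ρ z • leibnizDeriv E η (mollifySeq F u k)
      (fun j => mollifySeq F (du j) k) j z) (fun z => ρ z • leibnizDeriv E η u du j z) := by
  simp only [leibnizDeriv, smul_add, smul_smul]
  exact (h.memL2Loc.tendstoL2_mollifySeq (hρ.mul (contDiff_dirDeriv hη _).continuous)
    (hasCompactSupport_dirDeriv hηc _).mul_left).add
    ((h.memL2Loc_fst j).tendstoL2_mollifySeq (hρ.mul hη.continuous) hηc.mul_left)

variable [Fintype J]

theorem frameLaplacian_mollifySeq (k : ℕ) (z : F) :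
    frameLaplacian E (mollifySeq F u k) z = ∑ j, mollifySeq F (ddu j) k z :=
  Finset.sum_congr rfl fun j _ => by
    rw [h.dirDeriv_mollifySeq]
    exact (h.isWeakDeriv_snd j).fderiv_mollify _ z

theorem tendstoL2_laplacian {c : F → ℝ} (hc : Continuous c) (hcs : HasCompactSupport c) :
    TendstoL2 volume atTop (fun k z => c z • ∑ j, mollifySeq F (ddu j) k z)
      (fun z => c z • ∑ j, ddu j z) := by
  simp only [Finset.smul_sum]
  exact TendstoL2.sum _ fun j _ => (h.memL2Loc_snd j).tendstoL2_mollifySeq hc hcs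

theorem tendstoL2_leibnizCommutator (hρ : Continuous ρ) (hη : ContDiff ℝ ∞ η)
    (hηc : HasCompactSupport η) :
    TendstoL2 volume atTop (fun k z => ρ z • leibnizCommutator E η (mollifySeq F u k)
      (fun j => mollifySeq F (du j) k) z) (fun z => ρ z • leibnizCommutator E η u du z) := by
  simp only [leibnizCommutator, Finset.smul_sum, smul_add, smul_smul]
  have hdη (j : J) := contDiff_dirDeriv hη (E j)
  have hdηc (j : J) := hasCompactSupport_dirDeriv hηc (E j)
  exact TendstoL2.sum _ fun j _ =>
    ((h.memL2Loc_fst j).tendstoL2_mollifySeq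
      (hρ.mul (continuous_const.mul (hdη j).continuous)) (hdηc j).mul_left.mul_left).add
    (h.memL2Loc.tendstoL2_mollifySeq (hρ.mul (contDiff_dirDeriv (hdη j) _).continuous)
      (hasCompactSupport_dirDeriv (hdηc j) _).mul_left)

theorem tendstoL2_leibnizLaplacian (hρ : Continuous ρ) (hη : ContDiff ℝ ∞ η)
    (hηc : HasCompactSupport η) :
    TendstoL2 volume atTop
      (fun k z => ρ z • (η z • ∑ j, mollifySeq F (ddu j) k z
        + leibnizCommutator E η (mollifySeq F u k) (fun j => mollifySeq F (du j) k) z))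
      (fun z => ρ z • (η z • ∑ j, ddu j z + leibnizCommutator E η u du z)) := by
  simp only [smul_add, smul_smul]
  exact (h.tendstoL2_laplacian (hρ.mul hη.continuous) hηc.mul_left).add
    (h.tendstoL2_leibnizCommutator hρ hη hηc)

theorem caccioppoli {ζ : F → ℝ} (hζ : ContDiff ℝ ∞ ζ) (hζc : HasCompactSupport ζ) {δ : ℝ}
    (hδ : 0 < δ) :
    ∑ j, ∫ z, ‖ζ z • du j z‖ ^ 2 ≤
      2 * δ * (∫ z, ‖ζ z • ∑ j, ddu j z‖ ^ 2) + 1 / (2 * δ) * (∫ z, ‖ζ z • u z‖ ^ 2)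
        + 4 * ∑ j, ∫ z, ‖dirDeriv (E j) ζ z • u z‖ ^ 2 := by
  have hsmooth (k : ℕ) := caccioppoli_complex (E := E) (h.memL2Loc.contDiff_mollifySeq k) hζ hζc hδ
  simp only [h.dirDeriv_mollifySeq, h.frameLaplacian_mollifySeq] at hsmooth
  have hgrad (j : J) := (h.memL2Loc_fst j).tendstoL2_mollifySeq hζ.continuous hζc
  have hlap := h.tendstoL2_laplacian hζ.continuous hζc
  have hzero := h.memL2Loc.tendstoL2_mollifySeq hζ.continuous hζc
  have hcut (j : J) := h.memL2Loc.tendstoL2_mollifySeq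
    (contDiff_dirDeriv hζ (E j)).continuous (hasCompactSupport_dirDeriv hζc (E j))
  exact le_of_tendsto_of_tendsto' (tendsto_finsetSum _ fun j _ => (hgrad j).tendsto_integral)
    (((hlap.tendsto_integral.const_mul _).add (hzero.tendsto_integral.const_mul _)).add
      ((tendsto_finsetSum _ fun j _ => (hcut j).tendsto_integral).const_mul _)) hsmooth

end HasWeakSecondDerivs

theorem SeparatedWeight.IsCarlemanOn.sum_integral_leibnizDeriv_le [Fintype J] [DecidableEq J]
    {w : SeparatedWeight F J} {K : ℝ} {η : F → ℝ} (hw : w.IsCarlemanOn K (tsupport η))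
    (hη : ContDiff ℝ ∞ η) (hηc : HasCompactSupport η) {u : F → ℂ} {du ddu : J → F → ℂ}
    (h : HasWeakSecondDerivs w.E u du ddu) :
    (∑ j, ∫ z, ‖(Real.exp (w.φ z) * √(w.b 2 z)) • leibnizDeriv w.E η u du j z‖ ^ 2)
        + ∫ z, ‖(Real.exp (w.φ z) * √(w.b 2 z) * K * η z) • u z‖ ^ 2 ≤
      44 * ∫ z, ‖Real.exp (w.φ z) •
        (η z • ∑ j, ddu j z + leibnizCommutator w.E η u du z)‖ ^ 2 := by
  have hu (k : ℕ) := h.memL2Loc.contDiff_mollifySeq k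
  have hexp : Continuous fun z => Real.exp (w.φ z) := (contDiff_φ (w := w)).exp.continuous
  have hweight : Continuous fun z => Real.exp (w.φ z) * √(w.b 2 z) :=
    hexp.mul (contDiff_b (w := w) 2).continuous.sqrt
  have hsmooth (k : ℕ) := (hw.mono (tsupport_smul_subset_left η (mollifySeq F u k)))
    |>.sum_integral_norm_smul_le (hη.smul (hu k)) hηc.smul_right
  simp only [dirDeriv_smul_eq_leibnizDeriv hη (hu _), frameLaplacian_smul hη (hu _),
    h.dirDeriv_mollifySeq, h.frameLaplacian_mollifySeq, smul_smul] at hsmooth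
  have hgrad (j : J) := h.tendstoL2_leibnizDeriv hweight hη hηc j
  have hzero := h.memL2Loc.tendstoL2_mollifySeq
    (c := fun z => Real.exp (w.φ z) * √(w.b 2 z) * K * η z)
    ((hweight.mul continuous_const).mul hη.continuous) hηc.mul_left
  have hlap := h.tendstoL2_leibnizLaplacian hexp hη hηc
  exact le_of_tendsto_of_tendsto' ((tendsto_finsetSum _ fun j _ => (hgrad j).tendsto_integral).add
    hzero.tendsto_integral) (hlap.tendsto_integral.const_mul _) hsmooth

end WeakSecondDerivs

section Absorption

theorem norm_add_sq_le {G : Type*} [SeminormedAddCommGroup G] (x y : G) :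
    ‖x + y‖ ^ 2 ≤ 2 * (‖x‖ ^ 2 + ‖y‖ ^ 2) :=
  (pow_le_pow_left₀ (norm_nonneg _) (norm_add_le x y) 2).trans add_sq_le

theorem norm_sum_sq_le {G J : Type*} [SeminormedAddCommGroup G] [Fintype J] (x : J → G) :
    ‖∑ j, x j‖ ^ 2 ≤ Fintype.card J * ∑ j, ‖x j‖ ^ 2 :=
  (pow_le_pow_left₀ (norm_nonneg _) (norm_sum_le _ _) 2).trans sq_sum_le_card_mul_sum_sq

theorem sq_le_sq_of_abs_le {x y : ℝ} (h : |x| ≤ y) : x ^ 2 ≤ y ^ 2 :=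
  sq_le_sq' (abs_le.1 h).1 (abs_le.1 h).2

/-- The constant with which the error terms created by a cutoff with derivatives bounded by `B`
enter the Carleman inequality in dimension `d` for potentials of size `C`. -/
def cutoffConstant (d B C : ℝ) : ℝ := 176 * d * B ^ 2 * (2 * C ^ 2 + 4 + d)

/-- The constant in `SeparatedWeight.IsCarlemanOn.integral_b_two_mul_le`. -/
def absorptionConstant (d B C : ℝ) : ℝ :=
  2 * cutoffConstant d B C * (74 + 8 * C ^ 2 + 16 * (d * B ^ 2))

theorem cutoffConstant_nonneg {d : ℝ} (hd : 0 ≤ d) (B C : ℝ) : 0 ≤ cutoffConstant d B C := by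
  unfold cutoffConstant
  positivity

theorem absorptionConstant_nonneg {d : ℝ} (hd : 0 ≤ d) (B C : ℝ) :
    0 ≤ absorptionConstant d B C :=
  mul_nonneg (mul_nonneg zero_le_two (cutoffConstant_nonneg hd B C)) (by positivity)

variable {F : Type*} [NormedAddCommGroup F] [NormedSpace ℝ F] {J : Type*}

/-- Two test functions `η` and `ζ` such that the derivatives of `η` are dominated by `ζ`. In the
application `η` is a cutoff and `ζ` equals one on the shell where `η` is not constant. -/
structure IsCutoffPair (E : J → F) (B : ℝ) (η ζ : F → ℝ) : Prop where
  contDiff_fst : ContDiff ℝ ∞ η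
  hasCompactSupport_fst : HasCompactSupport η
  contDiff_snd : ContDiff ℝ ∞ ζ
  hasCompactSupport_snd : HasCompactSupport ζ
  abs_dirDeriv_fst_le : ∀ j z, |dirDeriv (E j) η z| ≤ B * ζ z
  abs_dirDeriv_dirDeriv_fst_le : ∀ j z, |dirDeriv (E j) (dirDeriv (E j) η) z| ≤ B * ζ z
  abs_snd_le_one : ∀ z, |ζ z| ≤ 1
  abs_dirDeriv_snd_le : ∀ j z, |dirDeriv (E j) ζ z| ≤ B

/-- The differential inequality `|Δu|² ≤ 2 C² (P |u|² + H |∇u|²)` with potentials `P, H ≤ 1`, for a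
function `u` with derivatives `du j` and `ddu j`. -/
structure DifferentialInequality [Fintype J] [MeasureSpace F] (C : ℝ) (P H : F → ℝ) (u : F → ℂ)
    (du ddu : J → F → ℂ) : Prop where
  P_le_one : ∀ z, P z ≤ 1
  H_nonneg : ∀ z, 0 ≤ H z
  H_le_one : ∀ z, H z ≤ 1
  ae_le : ∀ᵐ z, ‖∑ j, ddu j z‖ ^ 2 ≤ 2 * C ^ 2 * (P z * ‖u z‖ ^ 2 + H z * ∑ j, ‖du j z‖ ^ 2)

variable {E : J → F} {B : ℝ} {η ζ : F → ℝ}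

namespace SeparatedWeight

variable [DecidableEq J] {w : SeparatedWeight F J}

theorem sum_sq_dirDeriv_mul_exp_le [Fintype J] (hc : IsCutoffPair w.E B η ζ) (z : F) :
    ∑ j, dirDeriv (w.E j) (fun z => ζ z * Real.exp (w.φ z)) z ^ 2 ≤
      2 * (Fintype.card J * B ^ 2 + gradSq w.E w.φ z) * Real.exp (w.φ z) ^ 2 := by
  have hterm (j : J) : dirDeriv (w.E j) (fun z => ζ z * Real.exp (w.φ z)) z ^ 2 ≤
      2 * (B ^ 2 + dirDeriv (w.E j) w.φ z ^ 2) * Real.exp (w.φ z) ^ 2 := by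
    rw [dirDeriv_mul hc.contDiff_snd contDiff_φ.exp, dirDeriv_exp contDiff_φ]
    have hB := sq_le_sq_of_abs_le (hc.abs_dirDeriv_snd_le j z)
    have hζ := mul_le_of_le_one_left (sq_nonneg (dirDeriv (w.E j) w.φ z))
      ((sq_le_one_iff_abs_le_one _).2 (hc.abs_snd_le_one z))
    calc _ = (dirDeriv (w.E j) ζ z + ζ z * dirDeriv (w.E j) w.φ z) ^ 2
            * Real.exp (w.φ z) ^ 2 := by ring
      _ ≤ _ := by
        gcongr
        linarith [add_sq_le (a := dirDeriv (w.E j) ζ z) (b := ζ z * dirDeriv (w.E j) w.φ z),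
          mul_pow (ζ z) (dirDeriv (w.E j) w.φ z) 2]
  refine (Finset.sum_le_sum fun j _ => hterm j).trans_eq ?_
  rw [← Finset.sum_mul, ← Finset.mul_sum, Finset.sum_add_distrib, Finset.sum_const,
    Finset.card_univ, nsmul_eq_mul, gradSq]

variable [MeasureSpace F] [BorelSpace F]

theorem integrableOn_exp_φ_sq_mul {f : F → ℂ} (hf : MemL2Loc f) {s : Set F} (hs : IsCompact s) :
    IntegrableOn (fun z => Real.exp (w.φ z) ^ 2 * ‖f z‖ ^ 2) s :=
  IntegrableOn.continuousOn_mul ((contDiff_φ (w := w)).exp.continuous.pow 2).continuousOn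
    ((hf s hs).integrable_norm_pow two_ne_zero) hs

theorem integral_norm_mul_exp_smul_sq_le {u : F → ℂ} (hc : IsCutoffPair w.E B η ζ)
    (hu : MemL2Loc u) :
    ∫ z, ‖(ζ z * Real.exp (w.φ z)) • u z‖ ^ 2 ≤
      ∫ z in tsupport ζ, Real.exp (w.φ z) ^ 2 * ‖u z‖ ^ 2 := by
  have hexp : Continuous fun z => Real.exp (w.φ z) := (contDiff_φ (w := w)).exp.continuous
  have hzero (z : F) (hz : z ∉ tsupport ζ) : ‖(ζ z * Real.exp (w.φ z)) • u z‖ ^ 2 = 0 := by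
    simp [image_eq_zero_of_notMem_tsupport hz]
  rw [← setIntegral_eq_integral_of_forall_compl_eq_zero hzero]
  refine integral_mono (hu.integrable_norm_smul_sq (hc.contDiff_snd.continuous.mul hexp)
    hc.hasCompactSupport_snd.mul_right).integrableOn
    (integrableOn_exp_φ_sq_mul hu hc.hasCompactSupport_snd) fun z => ?_
  beta_reduce
  rw [norm_real_smul_sq, mul_pow, mul_assoc]
  exact mul_le_of_le_one_left (by positivity) ((sq_le_one_iff_abs_le_one _).2 (hc.abs_snd_le_one z))

theorem IsCarlemanOn.sum_integral_norm_dirDeriv_mul_exp_smul_sq_le [Fintype J] {K : ℝ} {u : F → ℂ}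
    (hw : w.IsCarlemanOn K (tsupport ζ)) (hc : IsCutoffPair w.E B η ζ) (hu : MemL2Loc u) :
    ∑ j, ∫ z, ‖dirDeriv (w.E j) (fun z => ζ z * Real.exp (w.φ z)) z • u z‖ ^ 2 ≤
      2 * (Fintype.card J * B ^ 2 + 9 / 2 * K ^ 2) *
        ∫ z in tsupport ζ, Real.exp (w.φ z) ^ 2 * ‖u z‖ ^ 2 := by
  have hζexp : ContDiff ℝ ∞ fun z => ζ z * Real.exp (w.φ z) := hc.contDiff_snd.mul contDiff_φ.exp
  have hζexpc : HasCompactSupport fun z => ζ z * Real.exp (w.φ z) :=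
    hc.hasCompactSupport_snd.mul_right
  have hinteg (j : J) := hu.integrable_norm_smul_sq (contDiff_dirDeriv hζexp (w.E j)).continuous
    (hasCompactSupport_dirDeriv hζexpc (w.E j))
  have hzero (z : F) (hz : z ∉ tsupport ζ) :
      ∑ j, ‖dirDeriv (w.E j) (fun z => ζ z * Real.exp (w.φ z)) z • u z‖ ^ 2 = 0 :=
    Finset.sum_eq_zero fun j _ => by
      rw [dirDeriv_eq_zero_of_notMem fun h => hz (tsupport_mul_subset_left h), zero_smul, norm_zero,
        zero_pow two_ne_zero]
  rw [← integral_finsetSum _ fun j _ => hinteg j,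
    ← setIntegral_eq_integral_of_forall_compl_eq_zero hzero, ← integral_const_mul]
  refine setIntegral_mono_on (integrable_finsetSum _ fun j _ => hinteg j).integrableOn
    ((integrableOn_exp_φ_sq_mul hu hc.hasCompactSupport_snd).const_mul _)
    (isClosed_tsupport ζ).measurableSet fun z hz => ?_
  simp only [norm_real_smul_sq, ← Finset.sum_mul]
  rw [← mul_assoc]
  refine mul_le_mul_of_nonneg_right ((sum_sq_dirDeriv_mul_exp_le hc z).trans ?_) (sq_nonneg _)
  gcongr
  exact hw.gradSq_φ_le hz

end SeparatedWeight

variable [Fintype J]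

namespace IsCutoffPair

variable (hc : IsCutoffPair E B η ζ) (u : F → ℂ) (du ddu : J → F → ℂ) (z : F)

include hc

theorem norm_leibnizCommutator_sq_le :
    ‖leibnizCommutator E η u du z‖ ^ 2 ≤ 2 * Fintype.card J * (B * ζ z) ^ 2 *
      (4 * ∑ j, ‖du j z‖ ^ 2 + Fintype.card J * ‖u z‖ ^ 2) := by
  have hterm (j : J) :
      ‖(2 * dirDeriv (E j) η z) • du j z + dirDeriv (E j) (dirDeriv (E j) η) z • u z‖ ^ 2 ≤
        2 * (B * ζ z) ^ 2 * (4 * ‖du j z‖ ^ 2 + ‖u z‖ ^ 2) := by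
    refine (norm_add_sq_le _ _).trans ?_
    rw [norm_real_smul_sq, norm_real_smul_sq]
    have hfst := mul_le_mul_of_nonneg_right
      (sq_le_sq_of_abs_le (hc.abs_dirDeriv_fst_le j z)) (sq_nonneg ‖du j z‖)
    have hsnd := mul_le_mul_of_nonneg_right
      (sq_le_sq_of_abs_le (hc.abs_dirDeriv_dirDeriv_fst_le j z)) (sq_nonneg ‖u z‖)
    linarith
  calc ‖leibnizCommutator E η u du z‖ ^ 2
      ≤ Fintype.card J * ∑ j, 2 * (B * ζ z) ^ 2 * (4 * ‖du j z‖ ^ 2 + ‖u z‖ ^ 2) :=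
        (norm_sum_sq_le _).trans
          (mul_le_mul_of_nonneg_left (Finset.sum_le_sum fun j _ => hterm j) (Nat.cast_nonneg _))
    _ = _ := by
        rw [← Finset.mul_sum, Finset.sum_add_distrib, ← Finset.mul_sum, Finset.sum_const,
          Finset.card_univ, nsmul_eq_mul]
        ring

theorem sq_mul_sum_norm_sq_le :
    η z ^ 2 * ∑ j, ‖du j z‖ ^ 2 ≤
      2 * ∑ j, ‖leibnizDeriv E η u du j z‖ ^ 2
        + 2 * Fintype.card J * (B * ζ z) ^ 2 * ‖u z‖ ^ 2 := by
  have hterm (j : J) : η z ^ 2 * ‖du j z‖ ^ 2 ≤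
      2 * ‖leibnizDeriv E η u du j z‖ ^ 2 + 2 * (B * ζ z) ^ 2 * ‖u z‖ ^ 2 := by
    have hadd := norm_add_sq_le (leibnizDeriv E η u du j z) (-(dirDeriv (E j) η z • u z))
    rw [norm_neg, norm_real_smul_sq, leibnizDeriv, add_neg_cancel_comm, norm_real_smul_sq] at hadd
    have hη := mul_le_mul_of_nonneg_right
      (sq_le_sq_of_abs_le (hc.abs_dirDeriv_fst_le j z)) (sq_nonneg ‖u z‖)
    rw [leibnizDeriv]
    linarith
  calc η z ^ 2 * ∑ j, ‖du j z‖ ^ 2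
      ≤ ∑ j, (2 * ‖leibnizDeriv E η u du j z‖ ^ 2 + 2 * (B * ζ z) ^ 2 * ‖u z‖ ^ 2) := by
        rw [Finset.mul_sum]
        exact Finset.sum_le_sum fun j _ => hterm j
    _ = _ := by
        rw [Finset.sum_add_distrib, ← Finset.mul_sum, Finset.sum_const, Finset.card_univ,
          nsmul_eq_mul]
        ring

variable {u du ddu z} {b C K P H : ℝ}

theorem norm_leibnizLaplacian_sq_le (hH₀ : 0 ≤ H) (hH₁ : H ≤ 1)
    (hle : ‖∑ j, ddu j z‖ ^ 2 ≤ 2 * C ^ 2 * (P * ‖u z‖ ^ 2 + H * ∑ j, ‖du j z‖ ^ 2))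
    (hH : 704 * C ^ 2 * H ≤ b) (hP : 352 * C ^ 2 * P ≤ b * K ^ 2) :
    44 * ‖η z • ∑ j, ddu j z + leibnizCommutator E η u du z‖ ^ 2 ≤
      1 / 2 * (b * ∑ j, ‖leibnizDeriv E η u du j z‖ ^ 2 + b * K ^ 2 * η z ^ 2 * ‖u z‖ ^ 2)
        + cutoffConstant (Fintype.card J) B C * ζ z ^ 2 *
          (‖u z‖ ^ 2 + ∑ j, ‖du j z‖ ^ 2) := by
  let d : ℝ := Fintype.card J
  let U := ‖u z‖ ^ 2
  let G := ∑ j, ‖du j z‖ ^ 2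
  let X := ∑ j, ‖leibnizDeriv E η u du j z‖ ^ 2
  have hX : 0 ≤ X := Finset.sum_nonneg fun j _ => sq_nonneg _
  have hcomm : ‖leibnizCommutator E η u du z‖ ^ 2 ≤ 2 * d * (B * ζ z) ^ 2 * (4 * G + d * U) :=
    hc.norm_leibnizCommutator_sq_le u du z
  have hηG : η z ^ 2 * G ≤ 2 * X + 2 * d * (B * ζ z) ^ 2 * U := hc.sq_mul_sum_norm_sq_le u du z
  have hlap : ‖η z • ∑ j, ddu j z‖ ^ 2 ≤ 2 * C ^ 2 * P * (η z ^ 2 * U)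
      + 2 * C ^ 2 * H * (2 * X + 2 * d * (B * ζ z) ^ 2 * U) := by
    rw [norm_real_smul_sq]
    calc η z ^ 2 * ‖∑ j, ddu j z‖ ^ 2 ≤ η z ^ 2 * (2 * C ^ 2 * (P * U + H * G)) :=
          mul_le_mul_of_nonneg_left hle (sq_nonneg _)
      _ = 2 * C ^ 2 * P * (η z ^ 2 * U) + 2 * C ^ 2 * H * (η z ^ 2 * G) := by ring
      _ ≤ _ := by gcongr
  have hPU : 352 * C ^ 2 * P * (η z ^ 2 * U) ≤ b * K ^ 2 * (η z ^ 2 * U) :=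
    mul_le_mul_of_nonneg_right hP (by positivity)
  have hHX : 704 * C ^ 2 * H * X ≤ b * X := mul_le_mul_of_nonneg_right hH hX
  have hdU : 0 ≤ d * (B * ζ z) ^ 2 * U := by positivity
  have hdG : 0 ≤ d * (B * ζ z) ^ 2 * G := by positivity
  have hHU : 352 * C ^ 2 * H * (d * (B * ζ z) ^ 2 * U) ≤ 352 * C ^ 2 * (d * (B * ζ z) ^ 2 * U) :=
    mul_le_mul_of_nonneg_right (mul_le_of_le_one_right (by positivity) hH₁) hdU
  have hCG : 0 ≤ C ^ 2 * (d * (B * ζ z) ^ 2 * G) := mul_nonneg (sq_nonneg C) hdG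
  have hddG : 0 ≤ d * (d * (B * ζ z) ^ 2 * G) := mul_nonneg (Nat.cast_nonneg _) hdG
  calc 44 * ‖η z • ∑ j, ddu j z + leibnizCommutator E η u du z‖ ^ 2
      ≤ 88 * (‖η z • ∑ j, ddu j z‖ ^ 2 + ‖leibnizCommutator E η u du z‖ ^ 2) := by
        linarith [norm_add_sq_le (η z • ∑ j, ddu j z) (leibnizCommutator E η u du z)]
    _ ≤ 1 / 2 * (b * X + b * K ^ 2 * η z ^ 2 * U) + cutoffConstant d B C * ζ z ^ 2 * (U + G) := by
        rw [cutoffConstant]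
        linarith

end IsCutoffPair

variable [MeasureSpace F] {C K : ℝ} {P H : F → ℝ} {u : F → ℂ} {du ddu : J → F → ℂ}

theorem SeparatedWeight.ae_norm_leibnizLaplacian_sq_le [DecidableEq J] {w : SeparatedWeight F J}
    (hb : ∀ z ∈ tsupport η, 0 ≤ w.b 2 z)
    (hc : IsCutoffPair w.E B η ζ) (hpde : DifferentialInequality C P H u du ddu)
    (hH : ∀ z ∈ tsupport η, 704 * C ^ 2 * H z ≤ w.b 2 z)
    (hP : ∀ z ∈ tsupport η, 352 * C ^ 2 * P z ≤ w.b 2 z * K ^ 2) :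
    ∀ᵐ z, 44 * ‖Real.exp (w.φ z) •
        (η z • ∑ j, ddu j z + leibnizCommutator w.E η u du z)‖ ^ 2 ≤
      1 / 2 * ((∑ j, ‖(Real.exp (w.φ z) * √(w.b 2 z)) • leibnizDeriv w.E η u du j z‖ ^ 2)
        + ‖(Real.exp (w.φ z) * √(w.b 2 z) * K * η z) • u z‖ ^ 2)
      + cutoffConstant (Fintype.card J) B C * (‖(ζ z * Real.exp (w.φ z)) • u z‖ ^ 2
        + ∑ j, ‖(ζ z * Real.exp (w.φ z)) • du j z‖ ^ 2) := by
  filter_upwards [hpde.ae_le] with z hz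
  by_cases hη : z ∈ tsupport η
  · simp only [norm_real_smul_sq, ← Finset.mul_sum, mul_pow, Real.sq_sqrt (hb z hη)]
    linarith [mul_le_mul_of_nonneg_left (hc.norm_leibnizLaplacian_sq_le (hpde.H_nonneg z)
      (hpde.H_le_one z) hz (hH z hη) (hP z hη)) (sq_nonneg (Real.exp (w.φ z)))]
  · have hη₁ (j : J) : dirDeriv (w.E j) η z = 0 := dirDeriv_eq_zero_of_notMem hη
    have hη₂ (j : J) : dirDeriv (w.E j) (dirDeriv (w.E j) η) z = 0 :=
      dirDeriv_eq_zero_of_notMem fun hz => hη (tsupport_dirDeriv_subset _ _ hz)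
    have hnonneg := mul_nonneg (cutoffConstant_nonneg (Fintype.card J).cast_nonneg B C)
      (by positivity : 0 ≤ ‖(ζ z * Real.exp (w.φ z)) • u z‖ ^ 2
        + ∑ j, ‖(ζ z * Real.exp (w.φ z)) • du j z‖ ^ 2)
    simpa [image_eq_zero_of_notMem_tsupport hη, hη₁, hη₂, leibnizDeriv, leibnizCommutator]
      using hnonneg

variable [BorelSpace F] [FiniteDimensional ℝ F] [(volume : Measure F).IsAddHaarMeasure]

namespace DifferentialInequality

variable {ξ : F → ℝ}

theorem integral_norm_smul_laplacian_sq_le (hpde : DifferentialInequality C P H u du ddu)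
    (h : HasWeakSecondDerivs E u du ddu) (hξ : Continuous ξ) (hξc : HasCompactSupport ξ) :
    ∫ z, ‖ξ z • ∑ j, ddu j z‖ ^ 2 ≤
      2 * C ^ 2 * ((∫ z, ‖ξ z • u z‖ ^ 2) + ∑ j, ∫ z, ‖ξ z • du j z‖ ^ 2) := by
  have hu := h.memL2Loc.integrable_norm_smul_sq hξ hξc
  have hdu (j : J) := (h.memL2Loc_fst j).integrable_norm_smul_sq hξ hξc
  have hlap := (h.tendstoL2_laplacian hξ hξc).memLp.integrable_norm_pow two_ne_zero
  have hsum := integrable_finsetSum Finset.univ fun j _ => hdu j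
  rw [← integral_finsetSum _ fun j _ => hdu j, ← integral_add hu hsum, ← integral_const_mul]
  refine integral_mono_ae hlap ((hu.add hsum).const_mul _) ?_
  filter_upwards [hpde.ae_le] with z hz
  simp only [norm_real_smul_sq, ← Finset.mul_sum]
  calc ξ z ^ 2 * ‖∑ j, ddu j z‖ ^ 2
      ≤ ξ z ^ 2 * (2 * C ^ 2 * (P z * ‖u z‖ ^ 2 + H z * ∑ j, ‖du j z‖ ^ 2)) := by gcongr
    _ ≤ ξ z ^ 2 * (2 * C ^ 2 * (1 * ‖u z‖ ^ 2 + 1 * ∑ j, ‖du j z‖ ^ 2)) := by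
        have hP := hpde.P_le_one z
        have hH := hpde.H_le_one z
        gcongr
    _ = _ := by ring

theorem sum_integral_norm_smul_sq_le (hpde : DifferentialInequality C P H u du ddu)
    (h : HasWeakSecondDerivs E u du ddu) (hC : 0 < C) (hξ : ContDiff ℝ ∞ ξ)
    (hξc : HasCompactSupport ξ) :
    ∑ j, ∫ z, ‖ξ z • du j z‖ ^ 2 ≤
      (1 + 8 * C ^ 2) * (∫ z, ‖ξ z • u z‖ ^ 2)
        + 8 * ∑ j, ∫ z, ‖dirDeriv (E j) ξ z • u z‖ ^ 2 := by
  have hcac := h.caccioppoli hξ hξc (δ := 1 / (8 * C ^ 2)) (by positivity)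
  have hlap : 2 * (1 / (8 * C ^ 2)) * ∫ z, ‖ξ z • ∑ j, ddu j z‖ ^ 2 ≤
      1 / 2 * ((∫ z, ‖ξ z • u z‖ ^ 2) + ∑ j, ∫ z, ‖ξ z • du j z‖ ^ 2) := by
    calc _ ≤ 2 * (1 / (8 * C ^ 2)) *
          (2 * C ^ 2 * ((∫ z, ‖ξ z • u z‖ ^ 2) + ∑ j, ∫ z, ‖ξ z • du j z‖ ^ 2)) := by
          gcongr
          exact hpde.integral_norm_smul_laplacian_sq_le h hξ.continuous hξc
      _ = _ := by
          field_simp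
          ring
  have hδ : 1 / (2 * (1 / (8 * C ^ 2))) = 4 * C ^ 2 := by
    field_simp
    norm_num
  rw [hδ] at hcac
  linarith

end DifferentialInequality

namespace SeparatedWeight

variable [DecidableEq J] {w : SeparatedWeight F J}

theorem IsCarlemanOn.integral_norm_smul_sq_le (hw : w.IsCarlemanOn K (tsupport η))
    (hc : IsCutoffPair w.E B η ζ) (h : HasWeakSecondDerivs w.E u du ddu)
    (hpde : DifferentialInequality C P H u du ddu)
    (hH : ∀ z ∈ tsupport η, 704 * C ^ 2 * H z ≤ w.b 2 z)
    (hP : ∀ z ∈ tsupport η, 352 * C ^ 2 * P z ≤ w.b 2 z * K ^ 2) :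
    ∫ z, ‖(Real.exp (w.φ z) * √(w.b 2 z) * K * η z) • u z‖ ^ 2 ≤
      2 * cutoffConstant (Fintype.card J) B C *
        ((∫ z, ‖(ζ z * Real.exp (w.φ z)) • u z‖ ^ 2)
          + ∑ j, ∫ z, ‖(ζ z * Real.exp (w.φ z)) • du j z‖ ^ 2) := by
  have hexp : Continuous fun z => Real.exp (w.φ z) := (contDiff_φ (w := w)).exp.continuous
  have hweight : Continuous fun z => Real.exp (w.φ z) * √(w.b 2 z) :=
    hexp.mul (contDiff_b (w := w) 2).continuous.sqrt
  have hη := hc.contDiff_fst.continuous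
  have hζexp : Continuous fun z => ζ z * Real.exp (w.φ z) := hc.contDiff_snd.continuous.mul hexp
  have hζexpc : HasCompactSupport fun z => ζ z * Real.exp (w.φ z) :=
    hc.hasCompactSupport_snd.mul_right
  have hcarleman := hw.sum_integral_leibnizDeriv_le hc.contDiff_fst hc.hasCompactSupport_fst h
  have iL (j : J) := (h.tendstoL2_leibnizDeriv hweight hc.contDiff_fst hc.hasCompactSupport_fst
    j).memLp.integrable_norm_pow two_ne_zero
  have iM := h.memL2Loc.integrable_norm_smul_sq
    (c := fun z => Real.exp (w.φ z) * √(w.b 2 z) * K * η z)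
    ((hweight.mul continuous_const).mul hη) hc.hasCompactSupport_fst.mul_left
  have iT := (h.tendstoL2_leibnizLaplacian hexp hc.contDiff_fst
    hc.hasCompactSupport_fst).memLp.integrable_norm_pow two_ne_zero
  have iU := h.memL2Loc.integrable_norm_smul_sq hζexp hζexpc
  have iG (j : J) := (h.memL2Loc_fst j).integrable_norm_smul_sq hζexp hζexpc
  have iL' := integrable_finsetSum Finset.univ fun j _ => iL j
  have iG' := integrable_finsetSum Finset.univ fun j _ => iG j
  have hmono := integral_mono_ae (iT.const_mul 44) (((iL'.add iM).const_mul (1 / 2)).add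
    ((iU.add iG').const_mul (cutoffConstant (Fintype.card J) B C)))
    (ae_norm_leibnizLaplacian_sq_le (fun z hz => hw.b_two_nonneg hz) hc hpde hH hP)
  rw [integral_const_mul, integral_add' ((iL'.add iM).const_mul _) ((iU.add iG').const_mul _),
    integral_const_mul, integral_const_mul, integral_add' iL' iM, integral_add' iU iG',
    integral_finsetSum _ fun j _ => iL j, integral_finsetSum _ fun j _ => iG j] at hmono
  have hL : 0 ≤ ∑ j, ∫ z, ‖(Real.exp (w.φ z) * √(w.b 2 z)) •
      leibnizDeriv w.E η u du j z‖ ^ 2 :=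
    Finset.sum_nonneg fun j _ => integral_nonneg fun z => sq_nonneg _
  linarith

/-- The gradient terms created by the cutoff are absorbed through the Caccioppoli inequality, whose
factor `K²` is the one that the Carleman inequality gains. -/
theorem IsCarlemanOn.integral_b_two_mul_le (hw : w.IsCarlemanOn K (tsupport η ∪ tsupport ζ))
    (hc : IsCutoffPair w.E B η ζ) (h : HasWeakSecondDerivs w.E u du ddu)
    (hpde : DifferentialInequality C P H u du ddu) (hC : 0 < C)
    (hH : ∀ z ∈ tsupport η, 704 * C ^ 2 * H z ≤ w.b 2 z)
    (hP : ∀ z ∈ tsupport η, 352 * C ^ 2 * P z ≤ w.b 2 z * K ^ 2) :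
    ∫ z, w.b 2 z * (Real.exp (w.φ z) * η z) ^ 2 * ‖u z‖ ^ 2 ≤
      absorptionConstant (Fintype.card J) B C *
        ∫ z in tsupport ζ, Real.exp (w.φ z) ^ 2 * ‖u z‖ ^ 2 := by
  have hwη := hw.mono Set.subset_union_left
  have habsorb := hwη.integral_norm_smul_sq_le hc h hpde hH hP
  have hgrad := hpde.sum_integral_norm_smul_sq_le h hC
    (hc.contDiff_snd.mul (contDiff_φ (w := w)).exp) hc.hasCompactSupport_snd.mul_right
  have hζu := integral_norm_mul_exp_smul_sq_le (w := w) hc h.memL2Loc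
  have hdζu := (hw.mono Set.subset_union_right).sum_integral_norm_dirDeriv_mul_exp_smul_sq_le hc
    h.memL2Loc
  have hleft : ∫ z, ‖(Real.exp (w.φ z) * √(w.b 2 z) * K * η z) • u z‖ ^ 2 =
      K ^ 2 * ∫ z, w.b 2 z * (Real.exp (w.φ z) * η z) ^ 2 * ‖u z‖ ^ 2 := by
    rw [← integral_const_mul]
    refine integral_congr_ae (ae_of_all _ fun z => ?_)
    by_cases hz : z ∈ tsupport η
    · simp only [norm_real_smul_sq, mul_pow, Real.sq_sqrt (hwη.b_two_nonneg hz)]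
      ring
    · simp [image_eq_zero_of_notMem_tsupport hz]
  rw [hleft] at habsorb
  have hI : 0 ≤ ∫ z in tsupport ζ, Real.exp (w.φ z) ^ 2 * ‖u z‖ ^ 2 :=
    integral_nonneg fun z => by positivity
  generalize (∫ z in tsupport ζ, Real.exp (w.φ z) ^ 2 * ‖u z‖ ^ 2) = I at *
  have hK : 1 ≤ K ^ 2 := one_le_pow₀ hw.one_le
  have hbracket : (∫ z, ‖(ζ z * Real.exp (w.φ z)) • u z‖ ^ 2)
      + ∑ j, ∫ z, ‖(ζ z * Real.exp (w.φ z)) • du j z‖ ^ 2 ≤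
      K ^ 2 * ((74 + 8 * C ^ 2 + 16 * (Fintype.card J * B ^ 2)) * I) := by
    linarith [mul_le_mul_of_nonneg_left hζu (by positivity : 0 ≤ 2 + 8 * C ^ 2),
      mul_le_mul_of_nonneg_right hK
        (by positivity : 0 ≤ (2 + 8 * C ^ 2 + 16 * (Fintype.card J * B ^ 2)) * I)]
  refine le_of_mul_le_mul_left ?_ (zero_lt_one.trans_le hK)
  refine (habsorb.trans (mul_le_mul_of_nonneg_left hbracket
    (mul_nonneg zero_le_two (cutoffConstant_nonneg (Nat.cast_nonneg _) B C)))).trans_eq ?_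
  rw [absorptionConstant]
  ring

end SeparatedWeight

end Absorption

section Profile

theorem hasDerivAt_one_add_sq_rpow (q s : ℝ) :
    HasDerivAt (fun s : ℝ => (1 + s ^ 2) ^ q) (2 * s * (q * (1 + s ^ 2) ^ (q - 1))) s := by
  have h : HasDerivAt (fun s : ℝ => 1 + s ^ 2) (2 * s) s := by
    simpa using (hasDerivAt_pow 2 s).const_add 1
  convert h.rpow_const (p := q) (Or.inl (by positivity)) using 1
  ring

theorem contDiff_one_add_sq_rpow (q : ℝ) : ContDiff ℝ ∞ fun s : ℝ => (1 + s ^ 2) ^ q :=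
  (contDiff_const.add (contDiff_id.pow 2)).rpow_const_of_ne fun s => by positivity

theorem one_add_sq_rpow_eq_mul (q s : ℝ) :
    (1 + s ^ 2) ^ q = (1 + s ^ 2) * (1 + s ^ 2) ^ (q - 1) := by
  rw [Real.rpow_sub_one (by positivity)]
  field_simp

theorem one_add_sq_rpow_sub_one_le (q s : ℝ) : (1 + s ^ 2) ^ (q - 1) ≤ (1 + s ^ 2) ^ q :=
  Real.rpow_le_rpow_of_exponent_le (by nlinarith [sq_nonneg s]) (by linarith)

theorem one_add_sq_rpow_le_one {q : ℝ} (hq : q ≤ 0) (s : ℝ) : (1 + s ^ 2) ^ q ≤ 1 :=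
  Real.rpow_le_one_of_one_le_of_nonpos (by nlinarith [sq_nonneg s]) hq

theorem one_add_sq_le_of_abs_le {s R : ℝ} (hR : 1 ≤ R) (hs : |s| ≤ 4 * R) :
    1 + s ^ 2 ≤ (5 * R) ^ 2 := by
  nlinarith [sq_abs s, abs_nonneg s]

theorem one_add_sq_rpow_le {q s R : ℝ} (hq : 0 ≤ q) (hq' : 2 * q ≤ 1) (hR : 1 ≤ R)
    (hs : |s| ≤ 4 * R) : (1 + s ^ 2) ^ q ≤ 5 * R ^ (2 * q) :=
  calc (1 + s ^ 2) ^ q ≤ ((5 * R) ^ 2) ^ q :=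
        Real.rpow_le_rpow (by positivity) (one_add_sq_le_of_abs_le hR hs) hq
    _ = 5 ^ (2 * q) * R ^ (2 * q) := by
        rw [← Real.rpow_natCast_mul (by positivity), Nat.cast_ofNat,
          Real.mul_rpow (by norm_num) (by positivity)]
    _ ≤ 5 ^ (1 : ℝ) * R ^ (2 * q) := by
        gcongr
        norm_num
    _ = 5 * R ^ (2 * q) := by rw [Real.rpow_one]

theorem le_one_add_sq_rpow {q s R : ℝ} (hq : q ≤ 0) (hq' : -1 ≤ 2 * q) (hR : 1 ≤ R)
    (hs : |s| ≤ 4 * R) : R ^ (2 * q) / 5 ≤ (1 + s ^ 2) ^ q :=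
  calc R ^ (2 * q) / 5 = 5 ^ (-1 : ℝ) * R ^ (2 * q) := by
        rw [Real.rpow_neg_one]
        ring
    _ ≤ 5 ^ (2 * q) * R ^ (2 * q) := by
        gcongr
        norm_num
    _ = ((5 * R) ^ 2) ^ q := by
        rw [← Real.rpow_natCast_mul (by positivity), Nat.cast_ofNat,
          Real.mul_rpow (by norm_num) (by positivity)]
    _ ≤ (1 + s ^ 2) ^ q :=
        Real.rpow_le_rpow_of_nonpos (by positivity) (one_add_sq_le_of_abs_le hR hs) hq

/-- A combination of two consecutive powers of `1 + s²`. Up to powers of `s`, all the derivatives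
of `(1 + s²)^m` are of this form. -/
def consecutiveRpow (a c q s : ℝ) : ℝ := a * (1 + s ^ 2) ^ q + c * (1 + s ^ 2) ^ (q - 1)

theorem hasDerivAt_consecutiveRpow (a c q s : ℝ) :
    HasDerivAt (consecutiveRpow a c q)
      (2 * s * consecutiveRpow (a * q) (c * (q - 1)) (q - 1) s) s := by
  refine (((hasDerivAt_one_add_sq_rpow q s).const_mul a).add
    ((hasDerivAt_one_add_sq_rpow (q - 1) s).const_mul c)).congr_deriv ?_
  rw [consecutiveRpow]
  ring

theorem abs_consecutiveRpow_le {a c A : ℝ} (h : |a| + |c| ≤ A) (q s : ℝ) :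
    |consecutiveRpow a c q s| ≤ A * (1 + s ^ 2) ^ q := by
  have hq : 0 ≤ (1 + s ^ 2) ^ q := by positivity
  have hq' : 0 ≤ (1 + s ^ 2) ^ (q - 1) := by positivity
  calc |consecutiveRpow a c q s| ≤ |a| * (1 + s ^ 2) ^ q + |c| * (1 + s ^ 2) ^ (q - 1) := by
        refine (abs_add_le _ _).trans_eq ?_
        rw [abs_mul, abs_mul, abs_of_nonneg hq, abs_of_nonneg hq']
    _ ≤ |a| * (1 + s ^ 2) ^ q + |c| * (1 + s ^ 2) ^ q := by
        have := one_add_sq_rpow_sub_one_le q s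
        gcongr _ + |c| * ?_
    _ ≤ A * (1 + s ^ 2) ^ q := by
        rw [← add_mul]
        gcongr

/-- The first derivative of `(1 + s²)^m`. -/
def profileDeriv₁ (m s : ℝ) : ℝ := 2 * m * s * (1 + s ^ 2) ^ (m - 1)

/-- The second derivative of `(1 + s²)^m`. -/
def profileDeriv₂ (m s : ℝ) : ℝ :=
  consecutiveRpow (2 * m * (2 * m - 1)) (4 * m * (1 - m)) (m - 1) s

/-- The third derivative of `(1 + s²)^m`. -/
def profileDeriv₃ (m s : ℝ) : ℝ :=
  2 * s * consecutiveRpow (2 * m * (2 * m - 1) * (m - 1)) (4 * m * (1 - m) * (m - 1 - 1))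
    (m - 1 - 1) s

/-- The fourth derivative of `(1 + s²)^m`. -/
def profileDeriv₄ (m s : ℝ) : ℝ :=
  2 * consecutiveRpow (2 * m * (2 * m - 1) * (m - 1)) (4 * m * (1 - m) * (m - 1 - 1))
      (m - 1 - 1) s +
    4 * s ^ 2 * consecutiveRpow (2 * m * (2 * m - 1) * (m - 1) * (m - 1 - 1))
      (4 * m * (1 - m) * (m - 1 - 1) * (m - 1 - 1 - 1)) (m - 1 - 1 - 1) s

theorem hasDerivAt_profileDeriv₁ (m s : ℝ) :
    HasDerivAt (profileDeriv₁ m) (profileDeriv₂ m s) s := by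
  refine (((hasDerivAt_id s).const_mul (2 * m)).mul
    (hasDerivAt_one_add_sq_rpow (m - 1) s)).congr_deriv ?_
  rw [profileDeriv₂, consecutiveRpow, id, one_add_sq_rpow_eq_mul (m - 1)]
  ring

theorem hasDerivAt_profileDeriv₂ (m s : ℝ) :
    HasDerivAt (profileDeriv₂ m) (profileDeriv₃ m s) s :=
  hasDerivAt_consecutiveRpow _ _ _ s

theorem hasDerivAt_profileDeriv₃ (m s : ℝ) :
    HasDerivAt (profileDeriv₃ m) (profileDeriv₄ m s) s := by
  refine (((hasDerivAt_id s).const_mul 2).mul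
    (hasDerivAt_consecutiveRpow _ _ (m - 1 - 1) s)).congr_deriv ?_
  rw [profileDeriv₄, id]
  ring

/-- The dependence of the Carleman weight on the space coordinate. -/
def profile (K M m s : ℝ) : ℝ := K * s + M * (1 + s ^ 2) ^ m

theorem contDiff_profile (K M m : ℝ) : ContDiff ℝ ∞ (profile K M m) :=
  (contDiff_const.mul contDiff_id).add (contDiff_const.mul (contDiff_one_add_sq_rpow m))

theorem iteratedDeriv_one_profile (K M m : ℝ) :
    iteratedDeriv 1 (profile K M m) = fun s => K + M * profileDeriv₁ m s := by
  rw [iteratedDeriv_one]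
  refine deriv_eq fun s => ?_
  refine (((hasDerivAt_id s).const_mul K).add
    ((hasDerivAt_one_add_sq_rpow m s).const_mul M)).congr_deriv ?_
  rw [profileDeriv₁]
  ring

theorem iteratedDeriv_two_profile (K M m : ℝ) :
    iteratedDeriv 2 (profile K M m) = fun s => M * profileDeriv₂ m s := by
  rw [iteratedDeriv_succ, iteratedDeriv_one_profile]
  exact deriv_eq fun s => ((hasDerivAt_profileDeriv₁ m s).const_mul M).const_add K

theorem iteratedDeriv_three_profile (K M m : ℝ) :
    iteratedDeriv 3 (profile K M m) = fun s => M * profileDeriv₃ m s := by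
  rw [iteratedDeriv_succ, iteratedDeriv_two_profile]
  exact deriv_eq fun s => (hasDerivAt_profileDeriv₂ m s).const_mul M

theorem iteratedDeriv_four_profile (K M m : ℝ) :
    iteratedDeriv 4 (profile K M m) = fun s => M * profileDeriv₄ m s := by
  rw [iteratedDeriv_succ, iteratedDeriv_three_profile]
  exact deriv_eq fun s => (hasDerivAt_profileDeriv₃ m s).const_mul M

variable {m : ℝ}

theorem profileDeriv₂_ge (hm : 1 / 2 ≤ m) (hm' : m ≤ 1) (s : ℝ) :
    2 * m * (2 * m - 1) * (1 + s ^ 2) ^ (m - 1) ≤ profileDeriv₂ m s := by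
  rw [profileDeriv₂, consecutiveRpow, le_add_iff_nonneg_right]
  have : 0 ≤ 4 * m * (1 - m) := mul_nonneg (by linarith) (by linarith)
  positivity

section CoefficientBounds

variable (hm : 1 / 2 ≤ m) (hm' : m ≤ 2 / 3)

include hm hm'

theorem abs_leading_coeff_le : |2 * m * (2 * m - 1)| ≤ 1 := by
  rw [abs_of_nonneg (mul_nonneg (by linarith) (by linarith))]
  nlinarith

theorem abs_subleading_coeff_le : |4 * m * (1 - m)| ≤ 1 := by
  rw [abs_of_nonneg (mul_nonneg (by linarith) (by linarith))]
  nlinarith [sq_nonneg (2 * m - 1)]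

theorem profileDeriv₂_le (s : ℝ) : profileDeriv₂ m s ≤ 2 := by
  have hcoeff : |2 * m * (2 * m - 1)| + |4 * m * (1 - m)| ≤ 2 := by
    linarith [abs_leading_coeff_le hm hm', abs_subleading_coeff_le hm hm']
  have hrpow := one_add_sq_rpow_le_one (q := m - 1) (by linarith) s
  exact (le_abs_self _).trans ((abs_consecutiveRpow_le hcoeff _ s).trans (by linarith))

theorem abs_thirdDeriv_coeff_le :
    |2 * m * (2 * m - 1) * (m - 1)| + |4 * m * (1 - m) * (m - 1 - 1)| ≤ 3 := by
  have h₁ : |m - 1| ≤ 1 := abs_le.2 ⟨by linarith, by linarith⟩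
  have h₂ : |m - 1 - 1| ≤ 2 := abs_le.2 ⟨by linarith, by linarith⟩
  rw [abs_mul _ (m - 1), abs_mul _ (m - 1 - 1)]
  linarith [mul_le_mul (abs_leading_coeff_le hm hm') h₁ (abs_nonneg _) zero_le_one,
    mul_le_mul (abs_subleading_coeff_le hm hm') h₂ (abs_nonneg _) zero_le_one]

theorem abs_fourthDeriv_coeff_le :
    |2 * m * (2 * m - 1) * (m - 1) * (m - 1 - 1)| +
      |4 * m * (1 - m) * (m - 1 - 1) * (m - 1 - 1 - 1)| ≤ 8 := by
  have h₁ : |(m - 1) * (m - 1 - 1)| ≤ 2 :=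
    abs_le.2 ⟨by nlinarith, by nlinarith⟩
  have h₂ : |(m - 1 - 1) * (m - 1 - 1 - 1)| ≤ 6 :=
    abs_le.2 ⟨by nlinarith, by nlinarith⟩
  rw [mul_assoc _ (m - 1), mul_assoc _ (m - 1 - 1), abs_mul _ ((m - 1) * _),
    abs_mul _ ((m - 1 - 1) * _)]
  linarith [mul_le_mul (abs_leading_coeff_le hm hm') h₁ (abs_nonneg _) zero_le_one,
    mul_le_mul (abs_subleading_coeff_le hm hm') h₂ (abs_nonneg _) zero_le_one]

theorem abs_profileDeriv₃_le (s : ℝ) : |profileDeriv₃ m s| ≤ 40 * (1 + s ^ 2) ^ (m - 1) := by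
  have hs : |s| ≤ 1 + s ^ 2 := by nlinarith [sq_nonneg (|s| - 1), sq_abs s]
  rw [profileDeriv₃, abs_mul, abs_mul, abs_two]
  calc 2 * |s| * _ ≤ 2 * (1 + s ^ 2) * (3 * (1 + s ^ 2) ^ (m - 1 - 1)) := by
        gcongr
        exact abs_consecutiveRpow_le (abs_thirdDeriv_coeff_le hm hm') _ s
    _ = 6 * (1 + s ^ 2) ^ (m - 1) := by
        rw [one_add_sq_rpow_eq_mul (m - 1)]
        ring
    _ ≤ 40 * (1 + s ^ 2) ^ (m - 1) := by
        gcongr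
        norm_num

theorem abs_profileDeriv₄_le (s : ℝ) : |profileDeriv₄ m s| ≤ 40 * (1 + s ^ 2) ^ (m - 1) := by
  have hs : 4 * s ^ 2 ≤ 4 * (1 + s ^ 2) := by linarith
  rw [profileDeriv₄]
  refine (abs_add_le _ _).trans ?_
  rw [abs_mul 2, abs_two, abs_mul (4 * s ^ 2), abs_of_nonneg (by positivity : 0 ≤ 4 * s ^ 2)]
  calc _ ≤ 2 * (3 * (1 + s ^ 2) ^ (m - 1 - 1)) +
        4 * (1 + s ^ 2) * (8 * (1 + s ^ 2) ^ (m - 1 - 1 - 1)) := by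
        gcongr
        · exact abs_consecutiveRpow_le (abs_thirdDeriv_coeff_le hm hm') _ s
        · exact abs_consecutiveRpow_le (abs_fourthDeriv_coeff_le hm hm') _ s
    _ = 38 * (1 + s ^ 2) ^ (m - 1 - 1) := by
        rw [one_add_sq_rpow_eq_mul (m - 1 - 1)]
        ring
    _ ≤ 40 * (1 + s ^ 2) ^ (m - 1) := by
        gcongr
        · norm_num
        · nlinarith [sq_nonneg s]
        · linarith

theorem abs_profileDeriv₁_le {s R : ℝ} (hR : 1 ≤ R) (hs : |s| ≤ 4 * R) :
    |profileDeriv₁ m s| ≤ 10 * R ^ (2 * m - 1) := by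
  have hsqrt : |s| ≤ (1 + s ^ 2) ^ (1 / 2 : ℝ) := by
    rw [← Real.sqrt_eq_rpow]
    exact Real.abs_le_sqrt (by linarith)
  have hrpow : 0 ≤ (1 + s ^ 2) ^ (m - 1) := by positivity
  rw [profileDeriv₁, abs_mul, abs_mul, abs_of_nonneg (by linarith : 0 ≤ 2 * m), abs_of_nonneg hrpow]
  calc 2 * m * |s| * (1 + s ^ 2) ^ (m - 1)
      ≤ 2 * 1 * (1 + s ^ 2) ^ (1 / 2 : ℝ) * (1 + s ^ 2) ^ (m - 1) := by
        gcongr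
        linarith
    _ = 2 * (1 + s ^ 2) ^ (m - 1 / 2) := by
        rw [mul_one, mul_assoc, ← Real.rpow_add (by positivity)]
        ring_nf
    _ ≤ 2 * (5 * R ^ (2 * (m - 1 / 2))) := by
        gcongr
        exact one_add_sq_rpow_le (by linarith) (by linarith) hR hs
    _ = 10 * R ^ (2 * m - 1) := by ring_nf

end CoefficientBounds

end Profile

section Weight

variable {n : ℕ}

/-- The coordinate directions of space-time; `none` stands for time. -/
def coordDir (n : ℕ) : Option (Fin n) → SpaceTime n
  | none => (1, 0)
  | some i => (0, EuclideanSpace.single i 1)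

/-- The weight `K x_i + M (1 + x_i²)^m - N t²`. -/
def carlemanWeight (i : Fin n) (K M m N : ℝ) : SeparatedWeight (SpaceTime n) (Option (Fin n)) where
  E := coordDir n
  j₀ := none
  j₁ := some i
  ℓ₀ := ContinuousLinearMap.fst ℝ ℝ (Space n)
  ℓ₁ := (EuclideanSpace.proj i).comp (ContinuousLinearMap.snd ℝ ℝ (Space n))
  N := N
  B := profile K M m
  ne := (Option.some_ne_none i).symm
  ℓ₀_apply j := by cases j <;> simp [coordDir]
  ℓ₁_apply j := by cases j <;> simp [coordDir, eq_comm]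
  contDiff_B := contDiff_profile K M m

variable (i : Fin n) (K M m N : ℝ) (z : SpaceTime n)

theorem carlemanWeight_φ :
    (carlemanWeight i K M m N).φ z = K * z.2 i + M * (1 + z.2 i ^ 2) ^ m - N * z.1 ^ 2 := rfl

theorem carlemanWeight_b_one :
    (carlemanWeight i K M m N).b 1 z = K + M * profileDeriv₁ m (z.2 i) :=
  congrFun (iteratedDeriv_one_profile K M m) (z.2 i)

theorem carlemanWeight_b_two :
    (carlemanWeight i K M m N).b 2 z = M * profileDeriv₂ m (z.2 i) :=
  congrFun (iteratedDeriv_two_profile K M m) (z.2 i)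

theorem carlemanWeight_b_three :
    (carlemanWeight i K M m N).b 3 z = M * profileDeriv₃ m (z.2 i) :=
  congrFun (iteratedDeriv_three_profile K M m) (z.2 i)

theorem carlemanWeight_b_four :
    (carlemanWeight i K M m N).b 4 z = M * profileDeriv₄ m (z.2 i) :=
  congrFun (iteratedDeriv_four_profile K M m) (z.2 i)

end Weight

section Cutoff

variable {F : Type*} [NormedAddCommGroup F] [NormedSpace ℝ F]

theorem dirDeriv_comp_smul {g : F → ℝ} (hg : ContDiff ℝ ∞ g) (c : ℝ) (e z : F) :
    dirDeriv e (fun z => g (c • z)) z = c * dirDeriv e g (c • z) := by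
  have h : HasFDerivAt (fun z : F => g (c • z)) _ z :=
    ((hg.differentiable (by simp)).differentiableAt (x := c • z)).hasFDerivAt.comp z
      ((hasFDerivAt_id z).const_smul c)
  rw [dirDeriv, h.fderiv]
  simp [dirDeriv]

theorem dirDeriv_dirDeriv_comp_smul {g : F → ℝ} (hg : ContDiff ℝ ∞ g) (c : ℝ) (e z : F) :
    dirDeriv e (dirDeriv e fun z => g (c • z)) z = c ^ 2 * dirDeriv e (dirDeriv e g) (c • z) := by
  have hg' := contDiff_dirDeriv hg e
  have hg'' : ContDiff ℝ ∞ fun z => dirDeriv e g (c • z) := hg'.comp (contDiff_const_smul c)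
  rw [show dirDeriv e (fun z => g (c • z)) = fun z => c * dirDeriv e g (c • z) from
      funext (dirDeriv_comp_smul hg c e),
    dirDeriv_mul contDiff_const hg'', dirDeriv_const, dirDeriv_comp_smul hg']
  ring

theorem dirDeriv_eq_zero_of_eventuallyEq_const {g : F → ℝ} {a : ℝ} {z : F}
    (h : g =ᶠ[𝓝 z] fun _ => a) (e : F) : dirDeriv e g z = 0 := by
  rw [dirDeriv, h.fderiv_eq, fderiv_const_apply, zero_apply]

variable [FiniteDimensional ℝ F]

variable (F) in
/-- A smooth bump function on `F`, equal to `1` on the unit ball and supported in its double. -/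
def unitBump : ContDiffBump (0 : F) := ⟨1, 2, one_pos, one_lt_two⟩

/-- A smooth cutoff, equal to `1` on the ball of radius `r` and supported in its double. -/
def ballCutoff (r : ℝ) (z : F) : ℝ := unitBump F (r⁻¹ • z)

/-- A smooth cutoff, equal to `1` between the radii `R` and `2 R`, which carries the derivatives of
`ballCutoff R`, and supported away from the ball of radius `R / 2`. -/
def shellCutoff (R : ℝ) (z : F) : ℝ := ballCutoff (2 * R) z * (1 + -1 * ballCutoff (R / 2) z)

theorem contDiff_ballCutoff (r : ℝ) : ContDiff ℝ ∞ (ballCutoff r : F → ℝ) :=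
  (unitBump F).contDiff.comp (contDiff_const_smul r⁻¹)

theorem ballCutoff_nonneg (r : ℝ) (z : F) : 0 ≤ ballCutoff r z := (unitBump F).nonneg

theorem ballCutoff_le_one (r : ℝ) (z : F) : ballCutoff r z ≤ 1 := (unitBump F).le_one

variable {r R : ℝ} {z : F}

theorem hasCompactSupport_ballCutoff (hr : 0 < r) :
    HasCompactSupport (ballCutoff r : F → ℝ) :=
  (unitBump F).hasCompactSupport.comp_homeomorph (Homeomorph.smulOfNeZero r⁻¹ (by positivity))

theorem ballCutoff_eq_one (hr : 0 < r) (hz : ‖z‖ ≤ r) : ballCutoff r z = 1 := by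
  refine (unitBump F).one_of_mem_closedBall (mem_closedBall_zero_iff.2 ?_)
  rw [norm_smul, norm_inv, Real.norm_of_nonneg hr.le]
  exact inv_mul_le_one_of_le₀ hz hr.le

theorem ballCutoff_eq_zero (hr : 0 < r) (hz : 2 * r ≤ ‖z‖) : ballCutoff r z = 0 := by
  refine (unitBump F).zero_of_le_dist ?_
  rw [dist_zero_right, norm_smul, norm_inv, Real.norm_of_nonneg hr.le, ← div_eq_inv_mul]
  exact (le_div_iff₀ hr).2 hz

theorem norm_le_of_mem_tsupport_ballCutoff (hr : 0 < r)
    (hz : z ∈ tsupport (ballCutoff r : F → ℝ)) : ‖z‖ ≤ 2 * r := by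
  refine closure_minimal (fun w hw => ?_) (isClosed_le continuous_norm continuous_const) hz
  exact (lt_of_not_ge fun h => hw (ballCutoff_eq_zero hr h)).le

theorem contDiff_shellCutoff (R : ℝ) : ContDiff ℝ ∞ (shellCutoff R : F → ℝ) :=
  (contDiff_ballCutoff _).mul (contDiff_const.add (contDiff_const.mul (contDiff_ballCutoff _)))

theorem hasCompactSupport_shellCutoff (hR : 0 < R) : HasCompactSupport (shellCutoff R : F → ℝ) :=
  (hasCompactSupport_ballCutoff (by positivity)).mul_right

theorem shellCutoff_nonneg (R : ℝ) (z : F) : 0 ≤ shellCutoff R z :=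
  mul_nonneg (ballCutoff_nonneg _ z) (by linarith [ballCutoff_le_one (R / 2) z])

theorem shellCutoff_le_one (R : ℝ) (z : F) : shellCutoff R z ≤ 1 :=
  mul_le_one₀ (ballCutoff_le_one _ z) (by linarith [ballCutoff_le_one (R / 2) z])
    (by linarith [ballCutoff_nonneg (R / 2) z])

theorem shellCutoff_eq_one (hR : 0 < R) (hz : R ≤ ‖z‖) (hz' : ‖z‖ ≤ 2 * R) :
    shellCutoff R z = 1 := by
  rw [shellCutoff, ballCutoff_eq_one (by positivity) hz',
    ballCutoff_eq_zero (by positivity) (by linarith)]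
  norm_num

theorem norm_mem_Icc_of_mem_tsupport_shellCutoff (hR : 0 < R)
    (hz : z ∈ tsupport (shellCutoff R : F → ℝ)) : ‖z‖ ∈ Set.Icc (R / 2) (4 * R) := by
  refine closure_minimal (fun w hw => ?_) (isClosed_Icc.preimage continuous_norm) hz
  obtain ⟨hw₁, hw₂⟩ := mul_ne_zero_iff.1 hw
  constructor
  · refine (lt_of_not_ge fun h => hw₂ ?_).le
    rw [ballCutoff_eq_one (by positivity) h]
    norm_num
  · exact (lt_of_not_ge fun h => hw₁ (ballCutoff_eq_zero (by positivity) (by linarith))).le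

theorem shellCutoff_eq_one_of_mem_tsupport_dirDeriv_ballCutoff (hR : 0 < R) {e : F}
    (hz : z ∈ tsupport (dirDeriv e (ballCutoff R))) : shellCutoff R z = 1 := by
  refine shellCutoff_eq_one hR ?_
    (norm_le_of_mem_tsupport_ballCutoff hR (tsupport_dirDeriv_subset _ _ hz))
  refine closure_minimal (fun w hw => ?_) (isClosed_le continuous_const continuous_norm) hz
  refine (le_of_not_gt fun h => hw ?_ : R ≤ ‖w‖)
  refine dirDeriv_eq_zero_of_eventuallyEq_const (a := 1) ?_ e
  filter_upwards [(isOpen_lt continuous_norm continuous_const).mem_nhds h] with x hx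
  exact ballCutoff_eq_one hR (le_of_lt hx)

theorem exists_abs_dirDeriv_ballCutoff_le (e : F) : ∃ A : ℝ, ∀ r, 1 / 2 ≤ r → ∀ z,
    |dirDeriv e (ballCutoff r) z| ≤ A ∧ |dirDeriv e (dirDeriv e (ballCutoff r)) z| ≤ A := by
  have hsmooth : ContDiff ℝ ∞ (unitBump F) := (unitBump F).contDiff
  have hsupp := (unitBump F).hasCompactSupport
  have hsmooth' := contDiff_dirDeriv hsmooth e
  have hsupp' := hasCompactSupport_dirDeriv hsupp e
  obtain ⟨A₁, hA₁⟩ := hsupp'.exists_bound_of_continuous hsmooth'.continuous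
  obtain ⟨A₂, hA₂⟩ := (hasCompactSupport_dirDeriv hsupp' e).exists_bound_of_continuous
    (contDiff_dirDeriv hsmooth' e).continuous
  refine ⟨max (2 * A₁) (2 ^ 2 * A₂), fun r hr z => ?_⟩
  have hr₀ : 0 ≤ r⁻¹ := by positivity
  have hr₂ : r⁻¹ ≤ 2 := by simpa using inv_anti₀ (by norm_num) hr
  unfold ballCutoff
  rw [dirDeriv_comp_smul hsmooth, dirDeriv_dirDeriv_comp_smul hsmooth, abs_mul, abs_mul,
    abs_of_nonneg hr₀, abs_of_nonneg (pow_nonneg hr₀ 2)]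
  exact ⟨le_max_of_le_left (mul_le_mul hr₂ (hA₁ _) (abs_nonneg _) zero_le_two),
    le_max_of_le_right (mul_le_mul (pow_le_pow_left₀ hr₀ hr₂ 2) (hA₂ _) (abs_nonneg _)
      (by norm_num))⟩

theorem abs_dirDeriv_shellCutoff_le {A : ℝ} (hR : 1 ≤ R) {e : F}
    (hA : ∀ r, 1 / 2 ≤ r → ∀ z, |dirDeriv e (ballCutoff r) z| ≤ A) (z : F) :
    |dirDeriv e (shellCutoff R) z| ≤ 2 * A := by
  have hfst := hA (2 * R) (by linarith) z
  have hsnd := hA (R / 2) (by linarith) z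
  have hout := ballCutoff_nonneg (2 * R) z
  have hin : 0 ≤ 1 + -1 * ballCutoff (R / 2) z := by linarith [ballCutoff_le_one (R / 2) z]
  have hin' : 1 + -1 * ballCutoff (R / 2) z ≤ 1 := by linarith [ballCutoff_nonneg (R / 2) z]
  have hsmooth := contDiff_const (c := (-1 : ℝ)).mul (contDiff_ballCutoff (F := F) (R / 2))
  have hd : dirDeriv e (shellCutoff R) z =
      dirDeriv e (ballCutoff (2 * R)) z * (1 + -1 * ballCutoff (R / 2) z) +
        ballCutoff (2 * R) z * -dirDeriv e (ballCutoff (R / 2)) z := by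
    unfold shellCutoff
    rw [dirDeriv_mul (contDiff_ballCutoff _) (contDiff_const.add hsmooth),
      dirDeriv_add contDiff_const hsmooth, dirDeriv_mul contDiff_const (contDiff_ballCutoff _),
      dirDeriv_const, dirDeriv_const]
    ring
  rw [hd]
  refine (abs_add_le _ _).trans ?_
  rw [abs_mul, abs_mul, abs_neg, abs_of_nonneg hin, abs_of_nonneg hout]
  linarith [mul_le_mul hfst hin' hin ((abs_nonneg _).trans hfst),
    mul_le_mul (ballCutoff_le_one (2 * R) z) hsnd (abs_nonneg _) zero_le_one]

theorem exists_isCutoffPair {J : Type*} [Finite J] (E : J → F) :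
    ∃ B : ℝ, ∀ R, 1 ≤ R → IsCutoffPair E B (ballCutoff R) (shellCutoff R) := by
  choose A hA using fun j => exists_abs_dirDeriv_ballCutoff_le (E j)
  obtain ⟨A', hA'⟩ := (Set.finite_range A).bddAbove
  have hle : ∀ j, A j ≤ 2 * |A'| := fun j => by
    linarith [hA' (Set.mem_range_self j), le_abs_self A', abs_nonneg A']
  refine ⟨2 * |A'|, fun R hR => ?_⟩
  have hR₀ : 0 < R := by linarith
  have hnonneg : ∀ z : F, 0 ≤ 2 * |A'| * shellCutoff R z := fun z =>
    mul_nonneg (by positivity) (shellCutoff_nonneg R z)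
  exact
  { contDiff_fst := contDiff_ballCutoff R
    hasCompactSupport_fst := hasCompactSupport_ballCutoff hR₀
    contDiff_snd := contDiff_shellCutoff R
    hasCompactSupport_snd := hasCompactSupport_shellCutoff hR₀
    abs_dirDeriv_fst_le := fun j z => by
      by_cases hz : z ∈ tsupport (dirDeriv (E j) (ballCutoff R))
      · rw [shellCutoff_eq_one_of_mem_tsupport_dirDeriv_ballCutoff hR₀ hz, mul_one]
        exact ((hA j R (by linarith) z).1).trans (hle j)
      · rw [image_eq_zero_of_notMem_tsupport hz, abs_zero]
        exact hnonneg z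
    abs_dirDeriv_dirDeriv_fst_le := fun j z => by
      by_cases hz : z ∈ tsupport (dirDeriv (E j) (ballCutoff R))
      · rw [shellCutoff_eq_one_of_mem_tsupport_dirDeriv_ballCutoff hR₀ hz, mul_one]
        exact ((hA j R (by linarith) z).2).trans (hle j)
      · rw [dirDeriv_eq_zero_of_notMem hz, abs_zero]
        exact hnonneg z
    abs_snd_le_one := fun z => by
      rw [abs_of_nonneg (shellCutoff_nonneg R z)]
      exact shellCutoff_le_one R z
    abs_dirDeriv_snd_le := fun j z =>
      (abs_dirDeriv_shellCutoff_le hR (fun r hr z => (hA j r hr z).1) z).trans (by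
        linarith [hA' (Set.mem_range_self j), le_abs_self A']) }

end Cutoff

section ScaledWeight

/-- The constant in the lower bound for the second derivative of `(1 + s²)^m`. -/
def convexityCoeff (m : ℝ) : ℝ := 2 * m * (2 * m - 1)

/-- The slope of the weight adapted to the scale `R`. It is large enough to bound the derivatives
of `M (1 + s²)^m` for `|s| ≤ 4 R`, with the same dependence on `R`. -/
def weightSlope (m M R : ℝ) : ℝ := 1600 / convexityCoeff m * M * R ^ (2 * m - 1)

/-- The concavity in time of the weight adapted to the scale `R`, which is as large as the second
derivative of `M (1 + s²)^m` for `|s| ≤ 4 R` allows. -/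
def weightConcavity (m M R : ℝ) : ℝ := M * convexityCoeff m * R ^ (2 * m - 2) / 40

variable {n : ℕ}

/-- The Carleman weight adapted to the scale `R`. -/
def scaledWeight (i : Fin n) (m M R : ℝ) : SeparatedWeight (SpaceTime n) (Option (Fin n)) :=
  carlemanWeight i (weightSlope m M R) M m (weightConcavity m M R)

theorem abs_coord_le_norm (z : SpaceTime n) (i : Fin n) : |z.2 i| ≤ ‖z‖ :=
  (PiLp.norm_apply_le z.2 i).trans (norm_snd_le z)

section Bounds

variable {m M R : ℝ} (hm : 1 / 2 < m) (hm' : m ≤ 2 / 3)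

include hm in
theorem convexityCoeff_pos : 0 < convexityCoeff m :=
  mul_pos (by linarith) (by linarith)

include hm hm'

theorem convexityCoeff_le : convexityCoeff m ≤ 4 / 9 := by
  rw [convexityCoeff]
  nlinarith

variable (hM : 1 ≤ M)

include hM

theorem mul_le_scaledWeight_b_two (i : Fin n) (R : ℝ) (z : SpaceTime n) :
    M * convexityCoeff m * (1 + z.2 i ^ 2) ^ (m - 1) ≤ (scaledWeight i m M R).b 2 z := by
  rw [scaledWeight, carlemanWeight_b_two, mul_assoc]
  gcongr
  exact profileDeriv₂_ge hm.le (by linarith) _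

theorem scaledWeight_b_two_nonneg (i : Fin n) (R : ℝ) (z : SpaceTime n) :
    0 ≤ (scaledWeight i m M R).b 2 z := by
  have := convexityCoeff_pos hm
  exact le_trans (by positivity) (mul_le_scaledWeight_b_two hm hm' hM i R z)

variable (hR : 1 ≤ R)

include hR

theorem mul_le_weightSlope : 3600 * (M * R ^ (2 * m - 1)) ≤ weightSlope m M R := by
  have : 3600 ≤ 1600 / convexityCoeff m := by
    rw [le_div_iff₀ (convexityCoeff_pos hm)]
    linarith [convexityCoeff_le hm hm']
  rw [weightSlope, mul_assoc]
  gcongr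

theorem le_weightSlope : 3600 * M ≤ weightSlope m M R := by
  refine le_trans ?_ (mul_le_weightSlope hm hm' hM hR)
  have := Real.one_le_rpow hR (by linarith : 0 ≤ 2 * m - 1)
  gcongr
  exact le_mul_of_one_le_right (by linarith) this

theorem mul_rpow_le_weightSlope_mul_b_two (i : Fin n) (z : SpaceTime n) :
    1600 * (M * (1 + z.2 i ^ 2) ^ (m - 1)) ≤
      weightSlope m M R * (scaledWeight i m M R).b 2 z := by
  have hγ := convexityCoeff_pos hm
  calc 1600 * (M * (1 + z.2 i ^ 2) ^ (m - 1))
      = 1600 / convexityCoeff m * 1 * 1 *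
          (M * convexityCoeff m * (1 + z.2 i ^ 2) ^ (m - 1)) := by
        field_simp
    _ ≤ weightSlope m M R * (scaledWeight i m M R).b 2 z := by
        rw [weightSlope]
        gcongr
        · exact Real.one_le_rpow hR (by linarith)
        · exact mul_le_scaledWeight_b_two hm hm' hM i R z

theorem abs_scaledWeight_b_one_sub_le (i : Fin n) {z : SpaceTime n} (hz : ‖z‖ ≤ 4 * R) :
    |(scaledWeight i m M R).b 1 z - weightSlope m M R| ≤ weightSlope m M R / 2 := by
  have hM₀ : 0 ≤ M := by linarith
  have hslope := mul_le_weightSlope hm hm' hM hR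
  have hderiv := mul_le_mul_of_nonneg_left
    (abs_profileDeriv₁_le hm.le hm' hR ((abs_coord_le_norm z i).trans hz)) hM₀
  have hpos : 0 ≤ M * R ^ (2 * m - 1) := by positivity
  rw [scaledWeight, carlemanWeight_b_one, add_sub_cancel_left, abs_mul, abs_of_nonneg hM₀]
  linarith

theorem weightConcavity_mul_abs_le {t : ℝ} (ht : |t| ≤ 4 * R) :
    16 * weightConcavity m M R * |t| ≤ weightSlope m M R := by
  have hγ := convexityCoeff_pos hm
  have hpos : 0 ≤ M * R ^ (2 * m - 1) := by positivity
  calc 16 * weightConcavity m M R * |t| ≤ 16 * weightConcavity m M R * (4 * R) := by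
        rw [weightConcavity]
        gcongr
    _ = 8 / 5 * (M * R ^ (2 * m - 1)) * convexityCoeff m := by
        rw [weightConcavity, show 2 * m - 1 = 2 * m - 2 + 1 by ring,
          Real.rpow_add_one (by linarith)]
        ring
    _ ≤ 8 / 5 * (M * R ^ (2 * m - 1)) * (4 / 9) := by
        gcongr
        exact convexityCoeff_le hm hm'
    _ ≤ weightSlope m M R := by linarith [mul_le_weightSlope hm hm' hM hR]

theorem weightConcavity_le_scaledWeight_b_two (i : Fin n) {z : SpaceTime n} (hz : ‖z‖ ≤ 4 * R) :
    8 * weightConcavity m M R ≤ (scaledWeight i m M R).b 2 z := by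
  have hγ := convexityCoeff_pos hm
  have hrpow := le_one_add_sq_rpow (q := m - 1) (by linarith) (by linarith) hR
    ((abs_coord_le_norm z i).trans hz)
  calc 8 * weightConcavity m M R = M * convexityCoeff m * (R ^ (2 * (m - 1)) / 5) := by
        rw [weightConcavity]
        ring_nf
    _ ≤ M * convexityCoeff m * (1 + z.2 i ^ 2) ^ (m - 1) := by gcongr
    _ ≤ (scaledWeight i m M R).b 2 z := mul_le_scaledWeight_b_two hm hm' hM i R z

theorem isCarlemanOn_scaledWeight (i : Fin n) :
    (scaledWeight i m M R).IsCarlemanOn (weightSlope m M R) (Metric.closedBall 0 (4 * R)) where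
  one_le := by linarith [le_weightSlope hm hm' hM hR]
  N_nonneg := by
    have := convexityCoeff_pos hm
    change 0 ≤ weightConcavity m M R
    rw [weightConcavity]
    positivity
  abs_ℓ₀_le z hz := weightConcavity_mul_abs_le hm hm' hM hR
    ((norm_fst_le z).trans (mem_closedBall_zero_iff.1 hz))
  le_b_one z hz := by
    linarith [abs_le.1 (abs_scaledWeight_b_one_sub_le hm hm' hM hR i
      (mem_closedBall_zero_iff.1 hz))]
  b_one_le z hz := by
    linarith [abs_le.1 (abs_scaledWeight_b_one_sub_le hm hm' hM hR i
      (mem_closedBall_zero_iff.1 hz)), le_weightSlope hm hm' hM hR]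
  le_b_two z hz := weightConcavity_le_scaledWeight_b_two hm hm' hM hR i
    (mem_closedBall_zero_iff.1 hz)
  b_two_le z _ := by
    have hb := mul_le_mul_of_nonneg_left (profileDeriv₂_le hm.le hm' (z.2 i))
      (zero_le_one.trans hM)
    have hslope := le_weightSlope hm hm' hM hR
    rw [scaledWeight, carlemanWeight_b_two]
    nlinarith
  abs_b_three_le z _ := by
    refine le_trans ?_ (mul_rpow_le_weightSlope_mul_b_two hm hm' hM hR i z)
    rw [scaledWeight, carlemanWeight_b_three, abs_mul, abs_of_nonneg (zero_le_one.trans hM)]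
    linarith [mul_le_mul_of_nonneg_left (abs_profileDeriv₃_le hm.le hm' (z.2 i))
      (zero_le_one.trans hM)]
  abs_b_four_le z _ := by
    refine le_trans ?_ (mul_rpow_le_weightSlope_mul_b_two hm hm' hM hR i z)
    rw [scaledWeight, carlemanWeight_b_four, abs_mul, abs_of_nonneg (zero_le_one.trans hM)]
    linarith [mul_le_mul_of_nonneg_left (abs_profileDeriv₄_le hm.le hm' (z.2 i))
      (zero_le_one.trans hM)]

variable {C : ℝ} (hMC : 704 * C ^ 2 ≤ M * convexityCoeff m)

include hMC

theorem potential_le_scaledWeight_b_two_mul (i : Fin n) {z : SpaceTime n} (hz : ‖z‖ ≤ 4 * R) :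
    352 * C ^ 2 * (1 + z.2 i ^ 2) ^ (3 * m - 2) ≤
      (scaledWeight i m M R).b 2 z * weightSlope m M R ^ 2 := by
  have hγ := convexityCoeff_pos hm
  have hrpow := one_add_sq_rpow_le (q := 2 * m - 1) (by linarith) (by linarith) hR
    ((abs_coord_le_norm z i).trans hz)
  have hslope : 5 * R ^ (2 * (2 * m - 1)) ≤ weightSlope m M R ^ 2 := by
    have hK : 3600 * R ^ (2 * m - 1) ≤ weightSlope m M R := by
      refine le_trans ?_ (mul_le_weightSlope hm hm' hM hR)
      gcongr
      exact le_mul_of_one_le_left (by positivity) hM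
    have hsq : R ^ (2 * (2 * m - 1)) = (R ^ (2 * m - 1)) ^ 2 := by
      rw [mul_comm, Real.rpow_mul (by linarith), Real.rpow_two]
    rw [hsq]
    nlinarith [sq_nonneg (R ^ (2 * m - 1)), pow_le_pow_left₀ (by positivity) hK 2]
  calc 352 * C ^ 2 * (1 + z.2 i ^ 2) ^ (3 * m - 2)
      = 352 * C ^ 2 * (1 + z.2 i ^ 2) ^ (m - 1) * (1 + z.2 i ^ 2) ^ (2 * m - 1) := by
        rw [mul_assoc _ _ ((1 + z.2 i ^ 2) ^ (2 * m - 1)), ← Real.rpow_add (by positivity)]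
        ring_nf
    _ ≤ M * convexityCoeff m * (1 + z.2 i ^ 2) ^ (m - 1) * weightSlope m M R ^ 2 := by
        have hMC' : 352 * C ^ 2 ≤ M * convexityCoeff m := by linarith [sq_nonneg C]
        exact mul_le_mul (mul_le_mul_of_nonneg_right hMC' (by positivity)) (hrpow.trans hslope)
          (by positivity) (by positivity)
    _ ≤ (scaledWeight i m M R).b 2 z * weightSlope m M R ^ 2 := by
        gcongr
        exact mul_le_scaledWeight_b_two hm hm' hM i R z

end Bounds

/-- The region between the radii `R / 2` and `4 R` of space-time, to which the Carleman inequality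
at scale `R` confines the error terms. -/
def shell (n : ℕ) (R : ℝ) : Set (SpaceTime n) := norm ⁻¹' Set.Icc (R / 2) (4 * R)

theorem isClosed_shell (n : ℕ) (R : ℝ) : IsClosed (shell n R) :=
  isClosed_Icc.preimage continuous_norm

theorem isCompact_shell (n : ℕ) (R : ℝ) : IsCompact (shell n R) :=
  (isCompact_closedBall 0 (4 * R)).of_isClosed_subset (isClosed_shell n R) fun _ hz =>
    mem_closedBall_zero_iff.2 hz.2

instance : (volume : Measure (SpaceTime n)).IsAddHaarMeasure :=
  inferInstanceAs ((volume : Measure ℝ).prod (volume : Measure (Space n))).IsAddHaarMeasure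

variable {i : Fin n} {m M R : ℝ} {u : SpaceTime n → ℂ}

theorem setIntegral_closedBall_le_integral_mul_cutoff (hm : 1 / 2 < m) (hm' : m ≤ 2 / 3)
    (hM : 1 ≤ M) {η : SpaceTime n → ℝ} (hη : Continuous η) (hη' : HasCompactSupport η)
    (hη_one : ∀ z, ‖z‖ ≤ R → η z = 1) (hu : MemL2Loc u) :
    ∫ z in Metric.closedBall 0 R, (scaledWeight i m M R).b 2 z *
        Real.exp ((scaledWeight i m M R).φ z) ^ 2 * ‖u z‖ ^ 2 ≤
      ∫ z, (scaledWeight i m M R).b 2 z *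
        (Real.exp ((scaledWeight i m M R).φ z) * η z) ^ 2 * ‖u z‖ ^ 2 := by
  have hb := scaledWeight_b_two_nonneg hm hm' hM i R
  have hcont : Continuous fun z => √((scaledWeight i m M R).b 2 z) *
      Real.exp ((scaledWeight i m M R).φ z) * η z :=
    ((SeparatedWeight.contDiff_b 2).continuous.sqrt.mul
      SeparatedWeight.contDiff_φ.continuous.rexp).mul hη
  have hinteg : Integrable fun z => (scaledWeight i m M R).b 2 z *
      (Real.exp ((scaledWeight i m M R).φ z) * η z) ^ 2 * ‖u z‖ ^ 2 := by
    refine (hu.integrable_norm_smul_sq hcont hη'.mul_left).congr (ae_of_all _ fun z => ?_)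
    beta_reduce
    rw [norm_real_smul_sq, mul_pow, mul_pow, Real.sq_sqrt (hb z)]
    ring
  calc ∫ z in Metric.closedBall 0 R, (scaledWeight i m M R).b 2 z *
          Real.exp ((scaledWeight i m M R).φ z) ^ 2 * ‖u z‖ ^ 2
      = ∫ z in Metric.closedBall 0 R, (scaledWeight i m M R).b 2 z *
          (Real.exp ((scaledWeight i m M R).φ z) * η z) ^ 2 * ‖u z‖ ^ 2 := by
        refine setIntegral_congr_fun measurableSet_closedBall fun z hz => ?_
        rw [hη_one z (mem_closedBall_zero_iff.1 hz), mul_one]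
    _ ≤ _ := setIntegral_le_integral hinteg (ae_of_all _ fun z =>
        mul_nonneg (mul_nonneg (hb z) (sq_nonneg _)) (sq_nonneg _))

/-- In the notation of the theorem, `3 * m - 2 = -α` and `m - 1 = -(1 + α) / 3` are twice the decay
exponents of the two potentials. -/
theorem exists_setIntegral_closedBall_le_setIntegral_shell (i : Fin n) {C : ℝ} (hm : 1 / 2 < m)
    (hm' : m ≤ 2 / 3) (hC : 0 < C) (hM : 1 ≤ M) (hMC : 704 * C ^ 2 ≤ M * convexityCoeff m) :
    ∃ A, 0 ≤ A ∧ ∀ R, 1 ≤ R → ∀ (u : SpaceTime n → ℂ) (du ddu : Option (Fin n) → SpaceTime n → ℂ),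
      HasWeakSecondDerivs (coordDir n) u du ddu →
      DifferentialInequality C (fun z => (1 + z.2 i ^ 2) ^ (3 * m - 2))
        (fun z => (1 + z.2 i ^ 2) ^ (m - 1)) u du ddu →
      ∫ z in Metric.closedBall 0 R, (scaledWeight i m M R).b 2 z *
          Real.exp ((scaledWeight i m M R).φ z) ^ 2 * ‖u z‖ ^ 2 ≤
        A * ∫ z in shell n R, Real.exp ((scaledWeight i m M R).φ z) ^ 2 * ‖u z‖ ^ 2 := by
  obtain ⟨B, hB⟩ := exists_isCutoffPair (coordDir n)
  have hA := absorptionConstant_nonneg (Nat.cast_nonneg (Fintype.card (Option (Fin n)))) B C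
  refine ⟨_, hA, fun R hR u du ddu hu hpde => ?_⟩
  have hR₀ : 0 < R := by linarith
  have hη : tsupport (ballCutoff R) ⊆ Metric.closedBall (0 : SpaceTime n) (4 * R) := fun z hz =>
    mem_closedBall_zero_iff.2 (by linarith [norm_le_of_mem_tsupport_ballCutoff hR₀ hz])
  have hζ : tsupport (shellCutoff R) ⊆ shell n R := fun z hz =>
    norm_mem_Icc_of_mem_tsupport_shellCutoff hR₀ hz
  have hw := (isCarlemanOn_scaledWeight hm hm' hM hR i).mono
    (Set.union_subset hη (hζ.trans fun z hz => mem_closedBall_zero_iff.2 hz.2))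
  calc _ ≤ _ := setIntegral_closedBall_le_integral_mul_cutoff hm hm' hM
          (contDiff_ballCutoff R).continuous (hasCompactSupport_ballCutoff hR₀)
          (fun z hz => ballCutoff_eq_one hR₀ hz) hu.memL2Loc
    _ ≤ _ := hw.integral_b_two_mul_le (hB R hR) hu hpde hC
          (fun z _ => (mul_le_mul_of_nonneg_right hMC (by positivity)).trans
            (mul_le_scaledWeight_b_two hm hm' hM i R z))
          (fun z hz => potential_le_scaledWeight_b_two_mul hm hm' hM hR hMC i
            (mem_closedBall_zero_iff.1 (hη hz)))
    _ ≤ _ := by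
      refine mul_le_mul_of_nonneg_left (setIntegral_mono_set
        (SeparatedWeight.integrableOn_exp_φ_sq_mul hu.memL2Loc (isCompact_shell n R))
        (ae_of_all _ fun z => ?_) hζ.eventuallyLE) hA
      exact mul_nonneg (sq_nonneg _) (sq_nonneg _)

end ScaledWeight

section Decay

theorem one_add_sq_rpow_le_one_add {m s ρ : ℝ} (hm : 0 ≤ m) (hm' : m ≤ 1) (hs : |s| ≤ ρ) :
    (1 + s ^ 2) ^ m ≤ 1 + ρ ^ (2 * m) := by
  have hρ : 0 ≤ ρ := (abs_nonneg s).trans hs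
  calc (1 + s ^ 2) ^ m ≤ 1 ^ m + (s ^ 2) ^ m :=
        Real.rpow_add_le_add_rpow zero_le_one (sq_nonneg _) hm hm'
    _ ≤ 1 ^ m + (ρ ^ 2) ^ m := by
        rw [← sq_abs s]
        gcongr
    _ = 1 + ρ ^ (2 * m) := by
        rw [Real.one_rpow, Real.rpow_mul hρ, Real.rpow_two]

theorem mul_rpow_mul_le_add {q κ ε x y : ℝ} (hq : 0 ≤ q) (hκ : 0 ≤ κ)
    (hε : 0 < ε) (hx : 0 ≤ x) (hy : 0 ≤ y) :
    κ * x ^ q * y ≤ ε * x ^ (q + 1) + κ * (κ / ε) ^ q * y ^ (q + 1) := by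
  have hq₁ : q + 1 ≠ 0 := by linarith
  rw [Real.rpow_add_one' hx hq₁, Real.rpow_add_one' hy hq₁]
  obtain h | h := le_total (κ * y) (ε * x)
  · calc κ * x ^ q * y = x ^ q * (κ * y) := by ring
      _ ≤ x ^ q * (ε * x) := by gcongr
      _ = ε * (x ^ q * x) := by ring
      _ ≤ _ := le_add_of_nonneg_right (by positivity)
  · have hxy : x ≤ κ / ε * y := by
      rw [div_mul_eq_mul_div, le_div_iff₀ hε]
      linarith
    calc κ * x ^ q * y ≤ κ * (κ / ε * y) ^ q * y := by gcongr
      _ = κ * (κ / ε) ^ q * (y ^ q * y) := by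
        rw [Real.mul_rpow (by positivity) hy]
        ring
      _ ≤ _ := le_add_of_nonneg_left (by positivity)

theorem rpow_le_of_half_le {m R t ρ : ℝ} (hm : 0 ≤ m) (hm' : m ≤ 1) (hR : 0 < R) (hρ : 0 ≤ ρ)
    (hfar : R / 2 ≤ |t| ∨ R / 2 ≤ ρ) :
    R ^ (2 * m) ≤ 4 * R ^ (2 * m - 2) * t ^ 2 + 4 * ρ ^ (2 * m) := by
  obtain h | h := hfar
  · calc R ^ (2 * m) = 4 * R ^ (2 * m - 2) * (R / 2) ^ 2 := by
          rw [Real.rpow_sub hR, Real.rpow_two]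
          field_simp
          norm_num
      _ ≤ 4 * R ^ (2 * m - 2) * t ^ 2 := by
          rw [← sq_abs t]
          gcongr
      _ ≤ _ := le_add_of_nonneg_right (by positivity)
  · calc R ^ (2 * m) ≤ (2 * ρ) ^ (2 * m) := by
          gcongr
          linarith
      _ = 2 ^ (2 * m) * ρ ^ (2 * m) := Real.mul_rpow zero_le_two hρ
      _ ≤ 2 ^ (2 : ℝ) * ρ ^ (2 * m) := by
          gcongr
          · exact one_le_two
          · linarith
      _ = 4 * ρ ^ (2 * m) := by norm_num
      _ ≤ _ := le_add_of_nonneg_left (by positivity)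

/-- The rate of exponential decay in space above which the decay of a solution compensates the
growth of `scaledWeight i m M R` in space, for all scales `R` at once. -/
def decayThreshold (m M : ℝ) : ℝ :=
  M * (1 + 1600 / convexityCoeff m *
    (1600 / convexityCoeff m / (convexityCoeff m / 320)) ^ (2 * m - 1) + convexityCoeff m / 40)

variable {n : ℕ} {m M R : ℝ}

theorem decayThreshold_nonneg (hm : 1 / 2 < m) (hM : 0 ≤ M) : 0 ≤ decayThreshold m M := by
  have := convexityCoeff_pos hm
  rw [decayThreshold]
  positivity

theorem scaledWeight_φ_le (i : Fin n) (hm : 1 / 2 < m) (hm' : m ≤ 1) (hM : 0 ≤ M) (hR : 0 < R)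
    {z : SpaceTime n} (hz : R / 2 ≤ ‖z‖) :
    (scaledWeight i m M R).φ z ≤
      M - M * (convexityCoeff m / 320) * R ^ (2 * m) + decayThreshold m M * ‖z.2‖ ^ (2 * m) := by
  have hγ := convexityCoeff_pos hm
  have hs : |z.2 i| ≤ ‖z.2‖ := PiLp.norm_apply_le z.2 i
  have hfar : R / 2 ≤ |z.1| ∨ R / 2 ≤ ‖z.2‖ := by
    rwa [Prod.norm_def, le_max_iff, Real.norm_eq_abs] at hz
  have hprofile := one_add_sq_rpow_le_one_add (by linarith) hm' hs
  have htime := rpow_le_of_half_le (by linarith) hm' hR (norm_nonneg z.2) hfar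
  have hslope : 1600 / convexityCoeff m * R ^ (2 * m - 1) * z.2 i ≤
      1600 / convexityCoeff m * R ^ (2 * m - 1) * ‖z.2‖ :=
    mul_le_mul_of_nonneg_left ((le_abs_self _).trans hs) (by positivity)
  have hyoung := mul_rpow_mul_le_add (q := 2 * m - 1) (κ := 1600 / convexityCoeff m)
    (ε := convexityCoeff m / 320) (by linarith) (by positivity) (by positivity) hR.le
    (norm_nonneg z.2)
  rw [sub_add_cancel] at hyoung
  have hunit : 1600 / convexityCoeff m * R ^ (2 * m - 1) * z.2 i + (1 + z.2 i ^ 2) ^ m -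
      convexityCoeff m * R ^ (2 * m - 2) / 40 * z.1 ^ 2 ≤
      1 - convexityCoeff m / 320 * R ^ (2 * m) + (1 + 1600 / convexityCoeff m *
        (1600 / convexityCoeff m / (convexityCoeff m / 320)) ^ (2 * m - 1) +
        convexityCoeff m / 40) * ‖z.2‖ ^ (2 * m) := by
    linarith [mul_le_mul_of_nonneg_left htime (by positivity : 0 ≤ convexityCoeff m / 160)]
  rw [scaledWeight, carlemanWeight_φ, weightSlope, weightConcavity, decayThreshold]
  linarith [mul_le_mul_of_nonneg_left hunit hM]

theorem exists_mul_exp_le_scaledWeight (i : Fin n) (hm : 1 / 2 < m) (hm' : m ≤ 2 / 3)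
    (hM : 1 ≤ M) (r : ℝ) :
    ∃ c₀ > 0, ∃ c, ∀ R, 1 ≤ R → ∀ z ∈ Metric.closedBall (0 : SpaceTime n) r,
      c₀ * Real.exp (-(c * R ^ (2 * m - 1))) ≤
        (scaledWeight i m M R).b 2 z * Real.exp ((scaledWeight i m M R).φ z) ^ 2 := by
  have hγ := convexityCoeff_pos hm
  refine ⟨M * convexityCoeff m * (1 + r ^ 2) ^ (m - 1), by positivity,
    2 * (1600 / convexityCoeff m * M * r + M * convexityCoeff m / 40 * r ^ 2),
    fun R hR z hz => ?_⟩
  rw [mem_closedBall_zero_iff] at hz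
  have hs : |z.2 i| ≤ r := (abs_coord_le_norm z i).trans hz
  have ht : |z.1| ≤ r := (norm_fst_le z).trans hz
  have hs_sq : z.2 i ^ 2 ≤ r ^ 2 := sq_le_sq' (abs_le.1 hs).1 (abs_le.1 hs).2
  have ht_sq : z.1 ^ 2 ≤ r ^ 2 := sq_le_sq' (abs_le.1 ht).1 (abs_le.1 ht).2
  refine mul_le_mul ?_ ?_ (Real.exp_pos _).le (scaledWeight_b_two_nonneg hm hm' hM i R z)
  · refine le_trans ?_ (mul_le_scaledWeight_b_two hm hm' hM i R z)
    exact mul_le_mul_of_nonneg_left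
      (Real.rpow_le_rpow_of_nonpos (by positivity) (by linarith) (by linarith)) (by positivity)
  · rw [← Real.exp_nat_mul, Real.exp_le_exp, scaledWeight, carlemanWeight_φ, weightSlope,
      weightConcavity]
    have hslope : -(1600 / convexityCoeff m * M * R ^ (2 * m - 1) * r) ≤
        1600 / convexityCoeff m * M * R ^ (2 * m - 1) * z.2 i := by
      rw [← mul_neg]
      exact mul_le_mul_of_nonneg_left (abs_le.1 hs).1 (by positivity)
    have htime : M * convexityCoeff m * R ^ (2 * m - 2) / 40 * z.1 ^ 2 ≤
        M * convexityCoeff m * R ^ (2 * m - 1) / 40 * r ^ 2 := by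
      gcongr
      exact one_le_two
    have hprofile : 0 ≤ M * (1 + z.2 i ^ 2) ^ m := by positivity
    push_cast
    linarith

theorem tendsto_mul_exp_rpow_sub_rpow {s b : ℝ} (hs : 1 ≤ s) (hb : 0 < b) (c : ℝ) :
    Tendsto (fun R : ℝ => R * Real.exp (c * R ^ (s - 1) - b * R ^ s)) atTop (𝓝 0) := by
  have hlim := tendsto_rpow_mul_exp_neg_mul_atTop_nhds_zero 1 (b / 2) (half_pos hb)
  simp only [Real.rpow_one] at hlim
  refine squeeze_zero' ?_ ?_ hlim
  · filter_upwards [eventually_ge_atTop 0] with R hR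
    positivity
  · filter_upwards [eventually_ge_atTop 1, eventually_ge_atTop (2 * c / b)] with R hR hcR
    have hc : c ≤ b / 2 * R := by
      rw [div_le_iff₀ hb] at hcR
      linarith
    have hpow : R ≤ R ^ s := Real.self_le_rpow_of_one_le hR hs
    have hsplit : R ^ s = R ^ (s - 1) * R := by
      rw [← Real.rpow_add_one (by linarith), sub_add_cancel]
    gcongr
    calc c * R ^ (s - 1) - b * R ^ s ≤ b / 2 * R * R ^ (s - 1) - b * R ^ s := by gcongr
      _ = -(b / 2) * R ^ s := by
        rw [hsplit]
        ring
      _ ≤ -(b / 2) * R := by nlinarith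

theorem nonpos_of_eventually_mul_exp_le {s b c c₀ D I : ℝ} (hs : 1 ≤ s) (hb : 0 < b)
    (hc₀ : 0 < c₀)
    (h : ∀ᶠ R : ℝ in atTop, c₀ * Real.exp (-(c * R ^ (s - 1))) * I ≤
      D * (R * Real.exp (-(b * R ^ s)))) : I ≤ 0 := by
  have hlim := (tendsto_mul_exp_rpow_sub_rpow hs hb c).const_mul D
  rw [mul_zero] at hlim
  refine nonpos_of_mul_nonpos_right (ge_of_tendsto hlim ?_) hc₀
  filter_upwards [h] with R hR
  have hexp := mul_le_mul_of_nonneg_right hR (Real.exp_pos (c * R ^ (s - 1))).le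
  rw [Real.exp_neg] at hexp
  rw [sub_eq_add_neg, Real.exp_add]
  field_simp at hexp
  linarith

end Decay

section Vanishing

variable {n : ℕ}

theorem lintegral_slab_le {u : SpaceTime n → ℂ} (hu : AEStronglyMeasurable u volume)
    {g : Space n → ℝ≥0∞} (hg : Measurable g) {A : ℝ≥0∞}
    (hA : ∀ t : ℝ, ∫⁻ x, g x * ‖u (t, x)‖ₑ ^ 2 ≤ A) (T : ℝ) :
    ∫⁻ z in Set.Icc (-T) T ×ˢ (Set.univ : Set (Space n)), g z.2 * ‖u z‖ₑ ^ 2 ≤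
      ENNReal.ofReal (2 * T) * A := by
  have hslab : (volume : Measure (SpaceTime n)).restrict (Set.Icc (-T) T ×ˢ Set.univ) =
      (volume.restrict (Set.Icc (-T) T)).prod volume := by
    rw [Measure.volume_eq_prod, ← Measure.prod_restrict, Measure.restrict_univ]
  have hmeas : AEMeasurable (fun z : SpaceTime n => g z.2 * ‖u z‖ₑ ^ 2)
      ((volume.restrict (Set.Icc (-T) T)).prod volume) := by
    rw [← hslab]
    exact ((hg.comp measurable_snd).aemeasurable.mul (hu.enorm.pow_const 2)).restrict
  rw [hslab, lintegral_prod _ hmeas]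
  calc ∫⁻ t in Set.Icc (-T) T, ∫⁻ x, g x * ‖u (t, x)‖ₑ ^ 2
      ≤ ∫⁻ _ in Set.Icc (-T) T, A := lintegral_mono hA
    _ = ENNReal.ofReal (2 * T) * A := by
        rw [setLIntegral_const, Real.volume_Icc, mul_comm]
        ring_nf

/-- The solution decays in `L²` at rate `lam` in space, uniformly in time. -/
def HasSliceDecay (m lam : ℝ) (A : ℝ≥0∞) (u : SpaceTime n → ℂ) : Prop :=
  ∀ t : ℝ, ∫⁻ x : Space n,
    ENNReal.ofReal (Real.exp (4 * lam * ‖x‖ ^ (2 * m))) * ‖u (t, x)‖ₑ ^ 2 ≤ A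

variable {i : Fin n} {m M lam : ℝ} {u : SpaceTime n → ℂ} {A : ℝ≥0∞}

theorem exp_scaledWeight_φ_sq_le (hm : 1 / 2 < m) (hm' : m ≤ 1) (hM : 0 ≤ M) {R : ℝ}
    (hR : 0 < R) (hlam : decayThreshold m M ≤ lam) {z : SpaceTime n} (hz : R / 2 ≤ ‖z‖) :
    Real.exp ((scaledWeight i m M R).φ z) ^ 2 ≤
      Real.exp (2 * (M - M * (convexityCoeff m / 320) * R ^ (2 * m))) *
        Real.exp (4 * lam * ‖z.2‖ ^ (2 * m)) := by
  have hφ := scaledWeight_φ_le i hm hm' hM hR hz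
  have hdecay := mul_le_mul_of_nonneg_right hlam (by positivity : 0 ≤ ‖z.2‖ ^ (2 * m))
  have hlam₀ := (decayThreshold_nonneg hm hM).trans hlam
  have hpos : 0 ≤ lam * ‖z.2‖ ^ (2 * m) := by positivity
  rw [← Real.exp_nat_mul, ← Real.exp_add, Real.exp_le_exp]
  push_cast
  linarith

theorem setIntegral_shell_le (hm : 1 / 2 < m) (hm' : m ≤ 1) (hM : 0 ≤ M) {R : ℝ} (hR : 0 < R)
    (hlam : decayThreshold m M ≤ lam) (hu : AEStronglyMeasurable u volume) (hA : A ≠ ⊤)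
    (hdecay : HasSliceDecay m lam A u) :
    ∫ z in shell n R, Real.exp ((scaledWeight i m M R).φ z) ^ 2 * ‖u z‖ ^ 2 ≤
      Real.exp (2 * (M - M * (convexityCoeff m / 320) * R ^ (2 * m))) * (8 * R * A.toReal) := by
  set E := Real.exp (2 * (M - M * (convexityCoeff m / 320) * R ^ (2 * m)))
  have hE : 0 ≤ E := (Real.exp_pos _).le
  let g (x : Space n) : ℝ≥0∞ := ENNReal.ofReal (Real.exp (4 * lam * ‖x‖ ^ (2 * m)))
  have hg : Measurable g := by fun_prop
  have hmeas : AEStronglyMeasurable (fun z => Real.exp ((scaledWeight i m M R).φ z) ^ 2 *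
      ‖u z‖ ^ 2) (volume.restrict (shell n R)) :=
    (SeparatedWeight.contDiff_φ.continuous.rexp.pow 2).aestronglyMeasurable.mul
      (hu.restrict.norm.pow 2)
  have hpointwise (z : SpaceTime n) (hz : z ∈ shell n R) :
      ENNReal.ofReal (Real.exp ((scaledWeight i m M R).φ z) ^ 2 * ‖u z‖ ^ 2) ≤
        ENNReal.ofReal E * (g z.2 * ‖u z‖ₑ ^ 2) := by
    rw [← ofReal_norm, ← ENNReal.ofReal_pow (norm_nonneg _),
      ← ENNReal.ofReal_mul (Real.exp_pos _).le, ← ENNReal.ofReal_mul hE, ← mul_assoc]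
    gcongr
    exact exp_scaledWeight_φ_sq_le hm hm' hM hR hlam hz.1
  have hsub : shell n R ⊆ Set.Icc (-(4 * R)) (4 * R) ×ˢ Set.univ := fun z hz =>
    ⟨abs_le.1 ((norm_fst_le z).trans hz.2), trivial⟩
  rw [integral_eq_lintegral_of_nonneg_ae (ae_of_all _ fun z => by positivity) hmeas]
  refine ENNReal.toReal_le_of_le_ofReal (by positivity) ?_
  calc ∫⁻ z in shell n R, ENNReal.ofReal
          (Real.exp ((scaledWeight i m M R).φ z) ^ 2 * ‖u z‖ ^ 2)
      ≤ ∫⁻ z in shell n R, ENNReal.ofReal E * (g z.2 * ‖u z‖ₑ ^ 2) :=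
        setLIntegral_mono' (isClosed_shell n R).measurableSet hpointwise
    _ = ENNReal.ofReal E * ∫⁻ z in shell n R, g z.2 * ‖u z‖ₑ ^ 2 :=
        lintegral_const_mul' _ _ ENNReal.ofReal_ne_top
    _ ≤ ENNReal.ofReal E * (ENNReal.ofReal (2 * (4 * R)) * A) := by
        gcongr
        exact (lintegral_mono_set hsub).trans (lintegral_slab_le hu hg hdecay _)
    _ = ENNReal.ofReal (E * (8 * R * A.toReal)) := by
        rw [ENNReal.ofReal_mul hE, ENNReal.ofReal_mul (p := 8 * R) (by positivity),
          ENNReal.ofReal_toReal hA]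
        ring_nf

theorem MemL2Loc.ae_eq_zero_of_setIntegral_closedBall (hu : MemL2Loc u)
    (h : ∀ r : ℝ, ∫ z in Metric.closedBall (0 : SpaceTime n) r, ‖u z‖ ^ 2 ≤ 0) :
    ∀ᵐ z : SpaceTime n, u z = 0 := by
  have hball (k : ℕ) : ∀ᵐ z : SpaceTime n, z ∈ Metric.closedBall (0 : SpaceTime n) k → u z = 0 := by
    have hinteg := (hu _ (isCompact_closedBall (0 : SpaceTime n) k)).integrable_norm_pow two_ne_zero
    have hzero := (integral_eq_zero_iff_of_nonneg (fun z => sq_nonneg _) hinteg).1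
      (le_antisymm (h k) (integral_nonneg fun z => sq_nonneg _))
    rw [← ae_restrict_iff' measurableSet_closedBall]
    filter_upwards [hzero] with z hz
    exact norm_eq_zero.1 (pow_eq_zero_iff two_ne_zero |>.1 hz)
  filter_upwards [ae_all_iff.2 hball] with z hz
  obtain ⟨k, hk⟩ := exists_nat_ge ‖z‖
  exact hz k (mem_closedBall_zero_iff.2 hk)

theorem mul_setIntegral_closedBall_le (hm : 1 / 2 < m) (hm' : m ≤ 2 / 3) (hM : 1 ≤ M)
    (hu : MemL2Loc u) {r R ε : ℝ} (hrR : r ≤ R)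
    (hε : ∀ z ∈ Metric.closedBall (0 : SpaceTime n) r,
      ε ≤ (scaledWeight i m M R).b 2 z * Real.exp ((scaledWeight i m M R).φ z) ^ 2) :
    ε * ∫ z in Metric.closedBall (0 : SpaceTime n) r, ‖u z‖ ^ 2 ≤
      ∫ z in Metric.closedBall (0 : SpaceTime n) R, (scaledWeight i m M R).b 2 z *
        Real.exp ((scaledWeight i m M R).φ z) ^ 2 * ‖u z‖ ^ 2 := by
  have hinteg (ρ : ℝ) {w : SpaceTime n → ℝ} (hw : Continuous w) :
      IntegrableOn (fun z => w z * ‖u z‖ ^ 2) (Metric.closedBall 0 ρ) :=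
    IntegrableOn.continuousOn_mul hw.continuousOn
      ((hu _ (isCompact_closedBall _ _)).integrable_norm_pow two_ne_zero)
      (isCompact_closedBall _ _)
  have hcont : Continuous fun z => (scaledWeight i m M R).b 2 z *
      Real.exp ((scaledWeight i m M R).φ z) ^ 2 :=
    (SeparatedWeight.contDiff_b 2).continuous.mul
      (SeparatedWeight.contDiff_φ.continuous.rexp.pow 2)
  rw [← integral_const_mul]
  refine (setIntegral_mono_on (hinteg r continuous_const) (hinteg r hcont) measurableSet_closedBall
    fun z hz => mul_le_mul_of_nonneg_right (hε z hz) (sq_nonneg _)).trans ?_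
  refine setIntegral_mono_set (hinteg R hcont) (ae_of_all _ fun z => ?_)
    (Metric.closedBall_subset_closedBall hrR).eventuallyLE
  exact mul_nonneg (mul_nonneg (scaledWeight_b_two_nonneg hm hm' hM i R z) (sq_nonneg _))
    (sq_nonneg _)

theorem ae_eq_zero_of_hasSliceDecay {C : ℝ} (hm : 1 / 2 < m) (hm' : m ≤ 2 / 3) (hC : 0 < C)
    (hM : 1 ≤ M) (hMC : 704 * C ^ 2 ≤ M * convexityCoeff m)
    {du ddu : Option (Fin n) → SpaceTime n → ℂ} (hu : HasWeakSecondDerivs (coordDir n) u du ddu)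
    (hpde : DifferentialInequality C (fun z => (1 + z.2 i ^ 2) ^ (3 * m - 2))
      (fun z => (1 + z.2 i ^ 2) ^ (m - 1)) u du ddu)
    (hlam : decayThreshold m M ≤ lam) (hA : A ≠ ⊤) (hdecay : HasSliceDecay m lam A u) :
    ∀ᵐ z : SpaceTime n, u z = 0 := by
  refine hu.memL2Loc.ae_eq_zero_of_setIntegral_closedBall fun r => ?_
  have hγ := convexityCoeff_pos hm
  obtain ⟨B, hB, hball⟩ :=
    exists_setIntegral_closedBall_le_setIntegral_shell i hm hm' hC hM hMC
  obtain ⟨c₀, hc₀, c, hnear⟩ := exists_mul_exp_le_scaledWeight i hm hm' hM r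
  refine nonpos_of_eventually_mul_exp_le (s := 2 * m) (c := c)
    (b := 2 * (M * (convexityCoeff m / 320))) (D := B * (Real.exp (2 * M) * (8 * A.toReal)))
    (by linarith) (by positivity) hc₀ ?_
  filter_upwards [eventually_ge_atTop 1, eventually_ge_atTop r] with R hR hrR
  calc c₀ * Real.exp (-(c * R ^ (2 * m - 1))) *
        ∫ z in Metric.closedBall (0 : SpaceTime n) r, ‖u z‖ ^ 2
      ≤ _ := mul_setIntegral_closedBall_le hm hm' hM hu.memL2Loc hrR (hnear R hR)
    _ ≤ _ := hball R hR u du ddu hu hpde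
    _ ≤ _ := mul_le_mul_of_nonneg_left (setIntegral_shell_le hm (by linarith) (by linarith)
        (by linarith) hlam (hu.isWeakDeriv_fst none).locallyIntegrable.aestronglyMeasurable hA
        hdecay) hB
    _ = _ := by
        rw [mul_sub, sub_eq_add_neg, Real.exp_add]
        ring_nf

end Vanishing

section Reduction

variable {n : ℕ} {V u : SpaceTime n → ℂ} {W : SpaceTime n → CVec n}

/-- The weak partial derivatives of `u`, indexed by time (`none`) and the space coordinates. -/
def weakPartial (u : SpaceTime n → ℂ) (j : Option (Fin n)) : SpaceTime n → ℂ :=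
  weakDeriv (coordDir n j) u

theorem weakSpaceTimeLaplacian_eq_sum (u : SpaceTime n → ℂ) (z : SpaceTime n) :
    weakSpaceTimeLaplacian u z = ∑ j, weakPartial (weakPartial u j) j z := by
  rw [Fintype.sum_option]
  rfl

theorem norm_firstOrderTerm_sq_le (W : SpaceTime n → CVec n) (u : SpaceTime n → ℂ)
    (z : SpaceTime n) :
    ‖firstOrderTerm W u z‖ ^ 2 ≤ ‖W z‖ ^ 2 * ∑ j, ‖weakPartial u j z‖ ^ 2 := by
  let a (j : Option (Fin n)) : ℂ := j.elim (W z).fst (W z).snd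
  have hterm : firstOrderTerm W u z = ∑ j, a j * weakPartial u j z := by
    rw [Fintype.sum_option]
    rfl
  have hnorm : ‖W z‖ ^ 2 = ∑ j, ‖a j‖ ^ 2 := by
    rw [Fintype.sum_option, WithLp.prod_norm_sq_eq_of_L2, EuclideanSpace.norm_sq_eq]
    rfl
  calc ‖firstOrderTerm W u z‖ ^ 2 ≤ (∑ j, ‖a j‖ * ‖weakPartial u j z‖) ^ 2 := by
        rw [hterm]
        gcongr
        refine (norm_sum_le _ _).trans_eq ?_
        simp only [norm_mul]
    _ ≤ _ := by
        rw [hnorm]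
        exact Finset.sum_mul_sq_le_sq_mul_sq _ _ _

theorem sq_le_of_le_div_rpow {C a b x q : ℝ} (hx : 0 ≤ x) (hb : 0 ≤ b) (hba : b ≤ a)
    (hq : 0 ≤ q) (h : x ≤ C / (1 + a) ^ q) : x ^ 2 ≤ C ^ 2 * (1 + b) ^ (-(2 * q)) := by
  calc x ^ 2 ≤ (C / (1 + a) ^ q) ^ 2 := by gcongr
    _ = C ^ 2 * (1 + a) ^ (-(2 * q)) := by
        rw [div_pow, ← Real.rpow_mul_natCast (by linarith), Real.rpow_neg (by linarith),
          div_eq_mul_inv, Nat.cast_ofNat, mul_comm q]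
    _ ≤ C ^ 2 * (1 + b) ^ (-(2 * q)) := mul_le_mul_of_nonneg_left
        (Real.rpow_le_rpow_of_nonpos (by linarith) (by linarith) (by linarith)) (sq_nonneg C)

theorem norm_weakSpaceTimeLaplacian_sq_le (i : Fin n) {C α : ℝ} (hα : 0 ≤ α) {z : SpaceTime n}
    (hV : ‖V z‖ ≤ C / (1 + ‖z.2‖ ^ 2) ^ (α / 2))
    (hW : ‖W z‖ ≤ C / (1 + ‖z.2‖ ^ 2) ^ ((1 + α) / 6))
    (hpde : ‖weakSpaceTimeLaplacian u z‖ ≤ ‖V z * u z‖ + ‖firstOrderTerm W u z‖) :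
    ‖weakSpaceTimeLaplacian u z‖ ^ 2 ≤
      2 * C ^ 2 * ((1 + z.2 i ^ 2) ^ (-(2 * (α / 2))) * ‖u z‖ ^ 2
        + (1 + z.2 i ^ 2) ^ (-(2 * ((1 + α) / 6))) * ∑ j, ‖weakPartial u j z‖ ^ 2) := by
  have hs : z.2 i ^ 2 ≤ ‖z.2‖ ^ 2 := sq_le_sq_of_abs_le (PiLp.norm_apply_le z.2 i)
  have hV_sq := sq_le_of_le_div_rpow (norm_nonneg _) (sq_nonneg _) hs (by positivity) hV
  have hW_sq := sq_le_of_le_div_rpow (norm_nonneg _) (sq_nonneg _) hs (by positivity) hW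
  calc ‖weakSpaceTimeLaplacian u z‖ ^ 2 ≤ (‖V z * u z‖ + ‖firstOrderTerm W u z‖) ^ 2 := by gcongr
    _ ≤ 2 * (‖V z * u z‖ ^ 2 + ‖firstOrderTerm W u z‖ ^ 2) := add_sq_le
    _ ≤ 2 * (‖V z‖ ^ 2 * ‖u z‖ ^ 2 + ‖W z‖ ^ 2 * ∑ j, ‖weakPartial u j z‖ ^ 2) := by
        rw [norm_mul, mul_pow]
        gcongr
        exact norm_firstOrderTerm_sq_le W u z
    _ ≤ 2 * (C ^ 2 * (1 + z.2 i ^ 2) ^ (-(2 * (α / 2))) * ‖u z‖ ^ 2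
          + C ^ 2 * (1 + z.2 i ^ 2) ^ (-(2 * ((1 + α) / 6))) *
            ∑ j, ‖weakPartial u j z‖ ^ 2) := by
        gcongr
    _ = _ := by ring

theorem differentialInequality_weakPartial (i : Fin n) {C α : ℝ} (hα : 0 ≤ α)
    (hV : ∀ᵐ z : SpaceTime n, ‖V z‖ ≤ C / (1 + ‖z.2‖ ^ 2) ^ (α / 2))
    (hW : ∀ᵐ z : SpaceTime n, ‖W z‖ ≤ C / (1 + ‖z.2‖ ^ 2) ^ ((1 + α) / 6))
    (hpde : ∀ᵐ z : SpaceTime n,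
      ‖weakSpaceTimeLaplacian u z‖ ≤ ‖V z * u z‖ + ‖firstOrderTerm W u z‖) :
    DifferentialInequality C (fun z => (1 + z.2 i ^ 2) ^ (-(2 * (α / 2))))
      (fun z => (1 + z.2 i ^ 2) ^ (-(2 * ((1 + α) / 6)))) u (weakPartial u)
      (fun j => weakPartial (weakPartial u j) j) where
  P_le_one z := one_add_sq_rpow_le_one (by linarith) (z.2 i)
  H_nonneg z := by positivity
  H_le_one z := one_add_sq_rpow_le_one (by linarith) (z.2 i)
  ae_le := by
    filter_upwards [hV, hW, hpde] with z hVz hWz hz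
    rw [← weakSpaceTimeLaplacian_eq_sum]
    exact norm_weakSpaceTimeLaplacian_sq_le i hα hVz hWz hz

theorem MemHLoc.hasWeakSecondDerivs (hu : MemHLoc 2 u) :
    HasWeakSecondDerivs (coordDir n) u (weakPartial u)
      (fun j => weakPartial (weakPartial u j) j) where
  memL2Loc := hu.memL2Loc
  memL2Loc_fst j := (hu.weakDeriv (coordDir n j)).memL2Loc
  memL2Loc_snd j := ((hu.weakDeriv (coordDir n j)).weakDeriv (coordDir n j)).memL2Loc
  isWeakDeriv_fst j := hu.isWeakDeriv (coordDir n j)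
  isWeakDeriv_snd j := (hu.weakDeriv (coordDir n j)).isWeakDeriv (coordDir n j)

theorem MemC1H1.ae_slice_eq_zero (hu : MemC1H1 u) (h : ∀ᵐ z : SpaceTime n, u z = 0) (t : ℝ) :
    ∀ᵐ x : Space n, u (t, x) = 0 := by
  obtain ⟨v, hv, hvu⟩ := hu
  have hcont : Continuous fun t => (v t).1.fst :=
    (WithLp.continuous_fst 2 _ _).comp (continuous_subtype_val.comp hv.continuous)
  have hae : ∀ᵐ s : ℝ, (v s).1.fst = 0 := by
    rw [Measure.volume_eq_prod] at h
    filter_upwards [Measure.ae_ae_of_ae_prod h] with s hs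
    rw [Lp.eq_zero_iff_ae_eq_zero]
    filter_upwards [hs, hvu s] with x hx hvx
    rw [← hvx, hx, Pi.zero_apply]
  have hzero : (v t).1.fst = 0 :=
    congrFun ((Continuous.ae_eq_iff_eq volume hcont continuous_const).1 hae) t
  filter_upwards [hvu t, (Lp.eq_zero_iff_ae_eq_zero).1 hzero] with x hvx hx
  rw [hvx, hx, Pi.zero_apply]

end Reduction

theorem theorem2_general (n : ℕ) (hn : 1 ≤ n) (C : ℝ) (hC : 0 < C) (α : ℝ) (hα₀ : 0 ≤ α)
    (hα₁ : α < 1 / 2) :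
    ∃ lam₀ : ℝ, ∀ (V : SpaceTime n → ℂ) (W : SpaceTime n → CVec n) (u : SpaceTime n → ℂ),
      (∀ᵐ z : SpaceTime n, ‖V z‖ ≤ C / (1 + ‖z.2‖ ^ 2) ^ (α / 2)) →
      (∀ᵐ z : SpaceTime n, ‖W z‖ ≤ C / (1 + ‖z.2‖ ^ 2) ^ ((1 + α) / 6)) →
      MemHLoc 2 u →
      (∀ᵐ z : SpaceTime n,
        ‖weakSpaceTimeLaplacian u z‖ ≤ ‖V z * u z‖ + ‖firstOrderTerm W u z‖) →
      (∃ lam : ℝ, lam₀ < lam ∧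
        (⨆ t : ℝ, ∫⁻ x : Space n,
          ENNReal.ofReal (Real.exp (4 * lam * ‖x‖ ^ ((4 - 2 * α) / 3))) * ‖u (t, x)‖ₑ ^ 2) < ⊤) →
      ∀ᵐ z : SpaceTime n, u z = 0 := by
  obtain ⟨m, rfl⟩ : ∃ m, α = 2 - 3 * m := ⟨(2 - α) / 3, by ring⟩
  have hm : 1 / 2 < m := by linarith
  have hγ := convexityCoeff_pos hm
  obtain ⟨M, hM, hMC⟩ : ∃ M, 1 ≤ M ∧ 704 * C ^ 2 ≤ M * convexityCoeff m :=
    ⟨max 1 (704 * C ^ 2 / convexityCoeff m), le_max_left _ _,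
      (div_le_iff₀ hγ).1 (le_max_right _ _)⟩
  refine ⟨decayThreshold m M, fun V W u hV hW hu hpde ⟨lam, hlam, hdecay⟩ => ?_⟩
  have hineq := differentialInequality_weakPartial ⟨0, hn⟩ hα₀ hV hW hpde
  rw [show -(2 * ((2 - 3 * m) / 2)) = 3 * m - 2 by ring,
    show -(2 * ((1 + (2 - 3 * m)) / 6)) = m - 1 by ring] at hineq
  rw [show (4 - 2 * (2 - 3 * m)) / 3 = 2 * m by ring] at hdecay
  exact ae_eq_zero_of_hasSliceDecay hm (by linarith) hC hM hMC hu.hasWeakSecondDerivs hineq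
    hlam.le hdecay.ne (iSup_le_iff.1 le_rfl)

end

theorem theorem2 (n : ℕ) (hn : 1 ≤ n) (C : ℝ) (hC : 0 < C) (α : ℝ) (hα₀ : 0 ≤ α)
    (hα₁ : α < 1 / 2) :
    ∃ lam₀ : ℝ, ∀ (V : SpaceTime n → ℂ) (W : SpaceTime n → CVec n) (u : SpaceTime n → ℂ),
      MemLp V ⊤ volume →
      (∀ᵐ z : SpaceTime n, ‖V z‖ ≤ C / (1 + ‖z.2‖ ^ 2) ^ (α / 2)) →
      MemLp W ⊤ volume →
      (∀ᵐ z : SpaceTime n, ‖W z‖ ≤ C / (1 + ‖z.2‖ ^ 2) ^ ((1 + α) / 6)) →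
      MemC1H1 u →
      MemHLoc 2 u →
      (∀ᵐ z : SpaceTime n,
        ‖weakSpaceTimeLaplacian u z‖ ≤ ‖V z * u z‖ + ‖firstOrderTerm W u z‖) →
      (∃ lam : ℝ, lam₀ < lam ∧
        (⨆ t : ℝ, ∫⁻ x : Space n,
          ENNReal.ofReal (Real.exp (4 * lam * ‖x‖ ^ ((4 - 2 * α) / 3))) * ‖u (t, x)‖ₑ ^ 2) < ⊤) →
      ∀ t : ℝ, ∀ᵐ x : Space n, u (t, x) = 0 := by
  obtain ⟨lam₀, h⟩ := theorem2_general n hn C hC α hα₀ hα₁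
  exact ⟨lam₀, fun V W u _ hV _ hW hu hu2 hpde hdecay =>
    hu.ae_slice_eq_zero (h V W u hV hW hu2 hpde hdecay)⟩
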